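/- Let $\mathcal C$ be the following category. An object is a finite-dimensional complex vector space $V$ with a real structure, given by its complex conjugation $v\mapsto\bar v$ (an antilinear involution of $V$), and three decreasing filtrations $F_0^\bullet,F_1^\bullet,F_2^\bullet$ by complex subspaces, indexed by $\mathbf Z$, with $F_i^p=0$ for some $p$ and $F_i^q=V$ for some $q$, such that: (a) the filtrations are opposed: $\mathrm{Gr}_{F_1}^p\,\mathrm{Gr}_{F_2}^q\,\mathrm{Gr}_{F_0}^n V=0$ whenever $p+q+n\neq 0$; (b) $F_0$ is defined over $\mathbf R$ ($\overline{F_0^p}=F_0^p$ for all $p$), and $F_1,F_2$ are complex conjugate ($\overline{F_1^p}=F_2^p$ for all $p$). A morphism $f:V\to V'$ is a $\mathbf C$-linear map that commutes with the conjugations and is strictly compatible with the three filtrations: $f(F_i^p)=f(V)\cap F_i'^p$ for all $i$ and $p$. On $\mathbf P^2=\mathbf P^2_{\mathbf C}$ with homogeneous coordinates $u_0,u_1,u_2$, let $T=\mathbf G_m^3/\mathbf G_m$ be the torus acting diagonally, let $\tau$ be the antiholomorphic involution $[u_0:u_1:u_2]\mapsto[\bar u_0:\bar u_2:\bar u_1]$,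 and let $T^\tau$ be the group of transformations generated by $T$ and $\tau$. A $T^\tau$-equivariant vector bundle is an algebraic vector bundle $E$ with a $T$-linearization and an antilinear lift of $\tau$ to $E$ with square the identity, such that these satisfy the relation $\tau t\tau^{-1}=\tau(t)$ for $t\in T$, where $\tau(t_0,t_1,t_2)=(\bar t_0,\bar t_2,\bar t_1)$. The slope of a bundle is $\deg/\mathrm{rk}$, and $0$ in rank $0$. A bundle on $\mathbf P^2$ is called $\mathbf P^1_0$-semistable if its restriction to the line $\mathbf P^1_0=\{u_0=0\}$ is slope-semistable. Let $\mathcal B$ have as objects the $T^\tau$-equivariant vector bundles on $\mathbf P^2$ that are $\mathbf P^1_0$-semistable of slope $0$, and as morphisms the $T^\tau$-equivariant morphisms of $\mathcal O$-modules whose cokernel is locally free outside the point $(1:0:0)$. Then in both cases these morphisms contain the identities and are stable under composition, so that $\mathcal C$ and $\mathcal B$ are categories, and $\mathcal C$ and $\mathcal B$ are equivalent. An equivalence $\mathcal C\to\mathcal B$ is given by the Rees construction: for a nonempty $S\subseteq\{0,1,2\}$ let $U_S\subseteq\mathbf P^2$ be the open set where all $u_k$ with $k\in S$ are invertible; the bundle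 attached to $V$ has as sections over $U_S$ the finite sums of terms $u^m v$ with $m\in\mathbf Z^3$, $m_0+m_1+m_2=0$ and $v\in\bigcap_{i\notin S}F_i^{-m_i}$. Here $T$ acts on $u^mv$ through the character $m$, the involution acts by $u_0^{m_0}u_1^{m_1}u_2^{m_2}v\mapsto u_0^{m_0}u_1^{m_2}u_2^{m_1}\bar v$, and a morphism $f$ goes to $u^mv\mapsto u^mf(v)$. -/

import Mathlib

open CategoryTheory

universe u

noncomputable section

namespace ReesPlane

/-! ## Projective space through its standard affine cover

`ι` indexes the homogeneous coordinates `u_i`; the projective plane is the case `ι = Fin 3` and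
the projective line the case `ι = Fin 2`. For a nonempty set `S` of indices, `U_S` denotes the
affine open set on which all `u_k`, `k ∈ S`, are invertible. These open sets are the standard charts
and their intersections. -/

section Space

variable (ι : Type) [Fintype ι]

/-- Exponents `m` of the Laurent monomials `u^m` of degree `0`. This is also the character group
of the torus `T = 𝔾_m^ι / 𝔾_m`. -/
def Lat : AddSubgroup (ι → ℤ) where
  carrier := {m | ∑ i, m i = 0}
  zero_mem' := by simp
  add_mem' := by
    intro a b ha hb
    simp only [Set.mem_ofPred_eq, Pi.add_apply, Finset.sum_add_distrib] at *
    rw [ha, hb, add_zero]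
  neg_mem' := by
    intro a ha
    simp only [Set.mem_ofPred_eq, Pi.neg_apply, Finset.sum_neg_distrib] at *
    rw [ha, neg_zero]

/-- Laurent polynomials of degree `0` in the homogeneous coordinates: the functions on the open
orbit of the torus, and also the functions on the torus `T` itself. -/
abbrev Laurent : Type := AddMonoidAlgebra ℂ (Lat ι)

/-- The indices `S` of the open sets `U_S`. A larger `S` means a smaller open set. -/
abbrev Chart : Type := {S : Finset ι // S.Nonempty}

variable {ι}

/-- The ring `𝒪(U_S)`, spanned by the monomials `u^m` of degree `0` without pole along `u_i = 0`
for `i ∉ S`. -/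
def regularFunctions (S : Chart ι) : Subalgebra ℂ (Laurent ι) where
  carrier := {f | ∀ m, f.coeff m ≠ 0 → ∀ i ∉ S.1, 0 ≤ m.1 i}
  mul_mem' := by
    classical
    intro f g hf hg m hm i hi
    rw [AddMonoidAlgebra.coeff_mul_apply_left] at hm
    obtain ⟨a, -, ha⟩ := Finset.exists_ne_zero_of_sum_ne_zero hm
    have h1 := hf a (left_ne_zero_of_mul ha) i hi
    have h2 : (0 : ℤ) ≤ -a.1 i + m.1 i := hg _ (right_ne_zero_of_mul ha) i hi
    omega
  add_mem' := by
    intro f g hf hg m hm i hi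
    by_cases h : f.coeff m = 0
    · refine hg m (fun h' => hm ?_) i hi
      rw [AddMonoidAlgebra.coeff_add, Finsupp.add_apply, h, h', add_zero]
    · exact hf m h i hi
  algebraMap_mem' := by
    classical
    intro c m hm i hi
    have : m = 0 := by
      by_contra h
      apply hm
      show (AddMonoidAlgebra.single (0 : Lat ι) c).coeff m = 0
      simp [Ne.symm h]
    subst this
    exact le_rfl

/-- `𝒪(U_S)` as a type. -/
def O (S : Chart ι) : Type := regularFunctions S

instance (S : Chart ι) : CommRing (O S) := inferInstanceAs (CommRing (regularFunctions S))

/-- Restriction of functions from `U_S` to the smaller open set `U_{S'}`. -/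
def resO {S S' : Chart ι} (h : S ≤ S') : O S →+* O S' :=
  (Subalgebra.inclusion (S := regularFunctions S) (T := regularFunctions S')
    (fun _ hf m hm i hi => hf m hm i (fun hi' => hi (h hi')))).toRingHom

/-- The monomial `c u^m` as a function on `U_S`. -/
def mono (S : Chart ι) (m : Lat ι) (hm : ∀ i ∉ S.1, 0 ≤ m.1 i) (c : ℂ) : O S :=
  ⟨AddMonoidAlgebra.single m c, by
    classical
    intro m' hm' i hi
    have : m = m' := by
      by_contra h
      exact hm' (by simp [h])
    exact this ▸ hm i hi⟩

variable [DecidableEq ι]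

/-- The exponent of `u_i / u_k`. -/
def quotExp (i k : ι) : Lat ι :=
  ⟨Pi.single i 1 - Pi.single k 1, by
    show ∑ j, _ = _
    simp [Finset.sum_sub_distrib]⟩

/-- The chart `U_k`. -/
def chart (k : ι) : Chart ι := ⟨{k}, Finset.singleton_nonempty k⟩

/-- The intersection of the charts `U_k` and `U_l`. -/
def overlap (k l : ι) : Chart ι := ⟨{k, l}, Finset.insert_nonempty _ _⟩

set_option linter.unusedSectionVars false in
theorem chart_le_left (k l : ι) : chart k ≤ overlap k l := by
  show ({k} : Finset ι) ⊆ {k, l}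
  simp

set_option linter.unusedSectionVars false in
theorem chart_le_right (k l : ι) : chart l ≤ overlap k l := by
  show ({l} : Finset ι) ⊆ {k, l}
  simp

/-- The coordinate function `u_i / u_k` on the chart `U_k`. -/
def coord (k i : ι) : O (chart k) :=
  mono (chart k) (quotExp i k) (by
    intro j hj
    have hj : j ≠ k := by simpa [chart] using hj
    show (0 : ℤ) ≤ (Pi.single i 1 - Pi.single k 1 : ι → ℤ) j
    rw [Pi.sub_apply, Pi.single_eq_of_ne hj, sub_zero, Pi.single_apply]
    split_ifs <;> simp) 1

/-- The function `c (u_k / u_l)^d` on `U_k ∩ U_l`. -/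
def overlapUnit (k l : ι) (d : ℤ) (c : ℂ) : O (overlap k l) :=
  mono (overlap k l) (d • quotExp k l) (by
    intro j hj
    have hj : j ≠ k ∧ j ≠ l := by simpa [overlap] using hj
    show (0 : ℤ) ≤ d • ((Pi.single k 1 - Pi.single l 1 : ι → ℤ) j)
    simp [hj.1, hj.2]) c

end Space

/-! ## Sheaves of modules and vector bundles -/

section Sheaves

variable (ι : Type) [Fintype ι]

/-- An `𝒪`-module on the standard cover: a module of sections over every `U_S` with restriction
maps. -/
structure ChartModule where
  /-- sections over `U_S` -/
  sec : Chart ι → Type u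
  [grp : ∀ S, AddCommGroup (sec S)]
  [mod : ∀ S, Module (O S) (sec S)]
  /-- restriction from `U_S` to `U_{S'}` -/
  res : ∀ {S S' : Chart ι}, S ≤ S' → sec S →+ sec S'
  res_smul : ∀ {S S' : Chart ι} (h : S ≤ S') (f : O S) (x : sec S),
    res h (f • x) = resO h f • res h x
  res_refl : ∀ {S : Chart ι} (x : sec S), res (le_refl S) x = x
  res_trans : ∀ {S S' S'' : Chart ι} (h : S ≤ S') (h' : S' ≤ S'') (x : sec S),
    res h' (res h x) = res (h.trans h') x

attribute [instance] ChartModule.grp ChartModule.mod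

variable {ι}

namespace ChartModule

/-- Quasi-coherence: for `U_{S'} ⊆ U_S`, the module over `U_{S'}` is the localization of the module
over `U_S` at the functions on `U_S` that are invertible on `U_{S'}`. A family of this kind is the
same as a quasi-coherent sheaf on projective space. -/
structure IsQuasiCoherent (E : ChartModule.{u} ι) : Prop where
  surj : ∀ {S S' : Chart ι} (h : S ≤ S') (y : E.sec S'),
    ∃ f : O S, IsUnit (resO h f) ∧ ∃ x : E.sec S, E.res h x = resO h f • y
  inj : ∀ {S S' : Chart ι} (h : S ≤ S') (x : E.sec S), E.res h x = 0 →
    ∃ f : O S, IsUnit (resO h f) ∧ f • x = 0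

variable [DecidableEq ι]

/-- Vector bundles, i.e. locally free sheaves of finite rank: quasi-coherent sheaves whose modules
over the affine charts are finitely generated and projective. -/
structure IsVectorBundle (E : ChartModule.{u} ι) : Prop where
  quasiCoherent : E.IsQuasiCoherent
  finite : ∀ k, Module.Finite (O (chart k)) (E.sec (chart k))
  projective : ∀ k, Module.Projective (O (chart k)) (E.sec (chart k))

/-- Coherent subsheaves. -/
structure CoherentSub (E : ChartModule.{u} ι) where
  /-- sections of the subsheaf over `U_S` -/
  sub : ∀ S, Submodule (O S) (E.sec S)
  res_mem : ∀ {S S' : Chart ι} (h : S ≤ S'), ∀ x ∈ sub S, E.res h x ∈ sub S'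
  res_span : ∀ {S S' : Chart ι} (h : S ≤ S'),
    sub S' ≤ Submodule.span (O S') (E.res h '' (sub S : Set (E.sec S)))
  fg : ∀ S, (sub S).FG

/-- The subsheaf with sections `N` has rank `r` and degree `d`: it has frames `b_k` over the charts
`U_k`, of size `r`, such that the determinant of the transition matrix from `b_l` to `b_k` is
`(u_k / u_l)^d` up to a constant. So the determinant line bundle is isomorphic to `𝒪(d)`. Vector
bundles on the affine spaces `U_k` are free, so that frames over the `U_k` do exist for every vector
bundle on the line or the plane. -/
def HasRankDegree (E : ChartModule.{u} ι) (N : ∀ S, Submodule (O S) (E.sec S)) (r : ℕ) (d : ℤ) :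
    Prop :=
  ∃ b : ∀ k, Module.Basis (Fin r) (O (chart k)) (N (chart k)), ∀ k l,
    ∃ (g : Matrix (Fin r) (Fin r) (O (overlap k l))) (c : ℂ), c ≠ 0 ∧
      (∀ j, E.res (chart_le_left k l) (b k j : E.sec (chart k)) =
        ∑ i, g i j • E.res (chart_le_right k l) (b l i : E.sec (chart l))) ∧
      g.det = overlapUnit k l d c

/-- The slope `d / r`, with the convention that it is `0` in rank `0`. -/
def HasSlope (E : ChartModule.{u} ι) (N : ∀ S, Submodule (O S) (E.sec S)) (μ : ℚ) : Prop :=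
  ∃ (r : ℕ) (d : ℤ), E.HasRankDegree N r d ∧ μ = (d : ℚ) / r

/-- Slope semistability: nonzero coherent subsheaves have at most the slope of the whole. -/
def IsSemistable (E : ChartModule.{u} ι) : Prop :=
  ∀ N : E.CoherentSub, (∃ S, N.sub S ≠ ⊥) → ∀ μ ν : ℚ,
    E.HasSlope N.sub μ → E.HasSlope (fun _ => ⊤) ν → μ ≤ ν

end ChartModule

end Sheaves

/-! ## Restriction to the line `u_0 = 0` of the plane -/

section Line

/-- The exponent of the monomial in `u_1, u_2` as an exponent for `u_0, u_1, u_2`. -/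
def extendExp (m : Lat (Fin 2)) : Lat (Fin 3) :=
  ⟨Fin.cons 0 m.1, by
    show ∑ i, _ = _
    rw [Fin.sum_univ_succ]
    have h : ∑ i, m.1 i = 0 := m.2
    simpa using h⟩

theorem extendExp_injective : Function.Injective extendExp := by
  intro a b h
  apply Subtype.ext
  funext i
  exact congrFun (congrArg Subtype.val h) i.succ

/-- The open set of the plane that cuts out `U_S` on the line. The coordinates `u_1, u_2` of the
plane are the coordinates with index `0, 1` of the line. -/
def planeChart (S : Chart (Fin 2)) : Chart (Fin 3) :=
  ⟨S.1.map (Fin.succEmb 2), S.2.map⟩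

theorem zero_notMem_planeChart (S : Chart (Fin 2)) : (0 : Fin 3) ∉ (planeChart S).1 := by
  intro h
  obtain ⟨i, -, hi⟩ := Finset.mem_map.1 h
  exact Fin.succ_ne_zero i hi

theorem planeChart_mono {S S' : Chart (Fin 2)} (h : S ≤ S') : planeChart S ≤ planeChart S' :=
  Finset.map_subset_map.2 h

theorem extendExp_of_eq_zero {m : Lat (Fin 3)} (h : m.1 0 = 0) : ∃ m', extendExp m' = m := by
  refine ⟨⟨Fin.tail m.1, ?_⟩, ?_⟩
  · have hm : ∑ i, m.1 i = 0 := m.2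
    rw [Fin.sum_univ_succ, h, zero_add] at hm
    exact hm
  · apply Subtype.ext
    show Fin.cons 0 (Fin.tail m.1) = m.1
    rw [← h]
    exact Fin.cons_self_tail m.1

/-- Restriction of functions on the plane to the line `u_0 = 0`: setting `u_0 = 0` keeps exactly
the monomials in which `u_0` does not occur. -/
def lineRes (S : Chart (Fin 2)) : O (planeChart S) →+* O S where
  toFun f := ⟨AddMonoidAlgebra.ofCoeff
      (Finsupp.comapDomain extendExp f.1.coeff extendExp_injective.injOn), by
    intro m hm i hi
    have h := f.2 (extendExp m) hm i.succ (by
      intro h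
      obtain ⟨j, hj, hji⟩ := Finset.mem_map.1 h
      exact hi (Fin.succ_injective _ hji ▸ hj))
    simpa [extendExp] using h⟩
  map_zero' := by
    apply Subtype.ext
    apply AddMonoidAlgebra.ext
    ext m
    rfl
  map_add' f g := by
    apply Subtype.ext
    apply AddMonoidAlgebra.ext
    ext m
    rfl
  map_one' := by
    classical
    apply Subtype.ext
    apply AddMonoidAlgebra.ext
    ext m
    have h0 : (0 : Lat (Fin 3)) = extendExp 0 := by
      apply Subtype.ext
      funext i
      refine Fin.cases ?_ (fun j => ?_) i <;> rfl
    show (AddMonoidAlgebra.single (0 : Lat (Fin 3)) (1 : ℂ)).coeff (extendExp m)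
      = (AddMonoidAlgebra.single (0 : Lat (Fin 2)) (1 : ℂ)).coeff m
    rw [AddMonoidAlgebra.coeff_single, AddMonoidAlgebra.coeff_single, Finsupp.single_apply,
      Finsupp.single_apply, h0]
    simp only [extendExp_injective.eq_iff]
  map_mul' f g := by
    classical
    apply Subtype.ext
    apply AddMonoidAlgebra.ext
    ext m
    show (f.1 * g.1).coeff (extendExp m) = (AddMonoidAlgebra.coeff (_ * _)) m
    rw [AddMonoidAlgebra.coeff_mul_apply_left, AddMonoidAlgebra.coeff_mul_apply_left]
    rw [Finsupp.sum, Finsupp.sum]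
    symm
    refine Finset.sum_of_injOn extendExp extendExp_injective.injOn ?_ ?_ ?_
    · intro a ha
      exact Finsupp.mem_support_iff.2 (Finsupp.mem_support_iff.1 (Finset.mem_coe.1 ha) :)
    · intro a ha hna
      by_contra hne
      have h1 := f.2 a (left_ne_zero_of_mul hne) 0 (zero_notMem_planeChart S)
      have h2 := g.2 _ (right_ne_zero_of_mul hne) 0 (zero_notMem_planeChart S)
      have h3 : (0 : ℤ) ≤ -(a.1 0) + 0 := h2
      obtain ⟨a', rfl⟩ := extendExp_of_eq_zero (m := a) (by omega)
      exact hna ⟨a', Finset.mem_coe.2 (Finsupp.mem_support_iff.2 (left_ne_zero_of_mul hne)), rfl⟩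
    · intro a _
      have h : extendExp (-a + m) = -extendExp a + extendExp m := by
        apply Subtype.ext
        funext i
        refine Fin.cases ?_ (fun j => ?_) i <;> simp [extendExp]
      rw [← h]
      rfl

instance lineAlgebra (S : Chart (Fin 2)) : Algebra (O (planeChart S)) (O S) :=
  (lineRes S).toAlgebra

theorem lineRes_resO {S S' : Chart (Fin 2)} (h : S ≤ S') (f : O (planeChart S)) :
    lineRes S' (resO (planeChart_mono h) f) = resO h (lineRes S f) := rfl

open TensorProduct in
/-- The restriction map of the pullback to the line. -/
def lineResMap (E : ChartModule.{u} (Fin 3)) {S S' : Chart (Fin 2)} (h : S ≤ S') :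
    (O S ⊗[O (planeChart S)] E.sec (planeChart S)) →+
      (O S' ⊗[O (planeChart S')] E.sec (planeChart S')) :=
  TensorProduct.liftAddHom
    { toFun := fun a =>
        { toFun := fun x => resO h a ⊗ₜ E.res (planeChart_mono h) x
          map_zero' := by simp
          map_add' := by simp [TensorProduct.tmul_add] }
      map_zero' := by ext; simp
      map_add' := by
        intro a b
        ext x
        simp [TensorProduct.add_tmul] }
    (by
      intro f a x
      show resO h (lineRes S f * a) ⊗ₜ _ = resO h a ⊗ₜ E.res _ (f • x)
      rw [E.res_smul, map_mul, ← lineRes_resO, TensorProduct.tmul_smul, TensorProduct.smul_tmul']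
      rfl)

open TensorProduct in
theorem lineResMap_tmul (E : ChartModule.{u} (Fin 3)) {S S' : Chart (Fin 2)} (h : S ≤ S') (a : O S)
    (x : E.sec (planeChart S)) :
    lineResMap E h (a ⊗ₜ x) = resO h a ⊗ₜ E.res (planeChart_mono h) x := rfl

open TensorProduct in
/-- The pullback `j^*E` of a sheaf on the plane along the inclusion `j` of the line `u_0 = 0`. -/
def ChartModule.restrictLine (E : ChartModule.{u} (Fin 3)) : ChartModule.{u} (Fin 2) where
  sec S := O S ⊗[O (planeChart S)] E.sec (planeChart S)
  res h := lineResMap E h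
  res_smul h f x := by
    induction x using TensorProduct.induction_on with
    | zero => simp
    | tmul a x =>
      rw [TensorProduct.smul_tmul', lineResMap_tmul, lineResMap_tmul, TensorProduct.smul_tmul',
        smul_eq_mul, map_mul, smul_eq_mul]
    | add x y hx hy => rw [smul_add, map_add, hx, hy, map_add, smul_add]
  res_refl x := by
    induction x using TensorProduct.induction_on with
    | zero => simp
    | tmul a x => rw [lineResMap_tmul, E.res_refl]; rfl
    | add x y hx hy => rw [map_add, hx, hy]
  res_trans h h' x := by
    induction x using TensorProduct.induction_on with
    | zero => simp
    | tmul a x => rw [lineResMap_tmul, lineResMap_tmul, lineResMap_tmul, E.res_trans]; rfl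
    | add x y hx hy => rw [map_add, map_add, hx, hy, map_add]

end Line

/-! ## The involution and equivariant sheaves on the plane -/

section Equivariant

/-- The permutation of the coordinates in `τ : [u₀ : u₁ : u₂] ↦ [ū₀ : ū₂ : ū₁]`. -/
abbrev sw : Equiv.Perm (Fin 3) := Equiv.swap 1 2

/-- `u^m ↦ u^{m ∘ sw}` on exponents. -/
def swLat : Lat (Fin 3) →+ Lat (Fin 3) where
  toFun m := ⟨m.1 ∘ sw, by
    show ∑ i, m.1 (sw i) = 0
    rw [Equiv.sum_comp sw m.1]
    exact m.2⟩
  map_zero' := rfl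
  map_add' _ _ := rfl

theorem swLat_swLat (m : Lat (Fin 3)) : swLat (swLat m) = m := by
  apply Subtype.ext
  funext i
  show m.1 (sw (sw i)) = m.1 i
  rw [Equiv.swap_apply_self]

/-- The index of the open set `τ(U_S)`. -/
def swChart (S : Chart (Fin 3)) : Chart (Fin 3) :=
  ⟨S.1.map sw.toEmbedding, S.2.map⟩

theorem mem_swChart {S : Chart (Fin 3)} {i : Fin 3} : i ∈ (swChart S).1 ↔ sw i ∈ S.1 := by
  constructor
  · intro h
    obtain ⟨j, hj, rfl⟩ := Finset.mem_map.1 h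
    show sw (sw j) ∈ S.1
    rwa [Equiv.swap_apply_self]
  · intro h
    refine Finset.mem_map.2 ⟨sw i, h, ?_⟩
    show sw (sw i) = i
    rw [Equiv.swap_apply_self]

theorem swChart_mono {S S' : Chart (Fin 3)} (h : S ≤ S') : swChart S ≤ swChart S' :=
  Finset.map_subset_map.2 h

theorem swChart_swChart_le (S : Chart (Fin 3)) : swChart (swChart S) ≤ S := by
  intro i hi
  have := mem_swChart.1 (mem_swChart.1 hi)
  rwa [Equiv.swap_apply_self] at this

/-- The action of `τ` on functions, `f ↦ conj ∘ f ∘ τ`: it conjugates the coefficients and exchanges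
`u₁` and `u₂`. -/
def tauLaurent : Laurent (Fin 3) →+* Laurent (Fin 3) :=
  (AddMonoidAlgebra.mapDomainRingHom ℂ swLat).comp
    (AddMonoidAlgebra.mapRingHom (Lat (Fin 3)) (starRingEnd ℂ))

theorem tauLaurent_single (m : Lat (Fin 3)) (c : ℂ) :
    tauLaurent (AddMonoidAlgebra.single m c) =
      AddMonoidAlgebra.single (swLat m) (starRingEnd ℂ c) := by
  simp [tauLaurent]

theorem tauLaurent_coeff (f : Laurent (Fin 3)) (m : Lat (Fin 3)) :
    (tauLaurent f).coeff (swLat m) = starRingEnd ℂ (f.coeff m) := by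
  classical
  induction f using AddMonoidAlgebra.induction_linear with
  | zero => simp
  | add f g hf hg => simp [hf, hg]
  | single a c =>
    have hinj : Function.Injective swLat := Function.LeftInverse.injective swLat_swLat
    rw [tauLaurent_single, AddMonoidAlgebra.coeff_single, AddMonoidAlgebra.coeff_single,
      Finsupp.single_apply, Finsupp.single_apply]
    by_cases h : a = m
    · simp [h]
    · simp [h, hinj.eq_iff]

/-- The action of `τ` on functions, from functions on `U_S` to functions on `τ(U_S)`. -/
def tauO (S : Chart (Fin 3)) : O S →+* O (swChart S) :=
  RingHom.codRestrict (tauLaurent.comp (regularFunctions S).val.toRingHom)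
    (regularFunctions (swChart S)) (by
      intro f m hm i hi
      have h : f.1.coeff (swLat m) ≠ 0 := by
        intro h
        apply hm
        have := tauLaurent_coeff f.1 (swLat m)
        rw [swLat_swLat, h, map_zero] at this
        exact this
      have := f.2 _ h (sw i) (fun h' => hi (mem_swChart.2 h'))
      have h2 : (swLat m).1 (sw i) = m.1 i := by
        show m.1 (sw (sw i)) = m.1 i
        rw [Equiv.swap_apply_self]
      rwa [h2] at this)

/-- `𝒪`-modules on the plane, equivariant under the group `T^τ` generated by the torus
`T = 𝔾_m³ / 𝔾_m` and the antiholomorphic involution `τ`.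

* The `T`-linearization is given, on each of the `T`-stable open sets `U_S`, by its coaction
  `M_S → M_S ⊗ ℂ[T]`. As `ℂ[T]` has the characters of `T` as a basis, an element of `M_S ⊗ ℂ[T]` is
  a finitely supported function on the characters. The coaction is counital, coassociative, and
  compatible with the coaction `u^m ↦ u^m ⊗ t^m` on functions.
* The `τ`-structure is a morphism `E → τ^*E` with square the identity: maps from sections over `U_S`
  to sections over `τ(U_S)`, linear along the action of `τ` on functions.
* The two are compatible: `τ ∘ t = τ(t) ∘ τ` for `t` in `T`, where
  `τ(t₀, t₁, t₂) = (t̄₀, t̄₂, t̄₁)`. -/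
structure EquivariantModule where
  /-- the underlying `𝒪`-module -/
  E : ChartModule.{u} (Fin 3)
  /-- the coaction of the torus -/
  coact : ∀ S, E.sec S →+ (Lat (Fin 3) →₀ E.sec S)
  coact_counit : ∀ S (x : E.sec S), ((coact S x).sum fun _ y => y) = x
  coact_coassoc : ∀ S (x : E.sec S) (χ : Lat (Fin 3)),
    coact S (coact S x χ) = Finsupp.single χ (coact S x χ)
  coact_smul : ∀ S (m : Lat (Fin 3)) (hm : ∀ i ∉ S.1, 0 ≤ m.1 i) (c : ℂ) (x : E.sec S)
    (χ : Lat (Fin 3)), coact S (mono S m hm c • x) (m + χ) = mono S m hm c • coact S x χ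
  coact_res : ∀ {S S'} (h : S ≤ S') (x : E.sec S) (χ : Lat (Fin 3)),
    coact S' (E.res h x) χ = E.res h (coact S x χ)
  /-- the `τ`-structure -/
  tau : ∀ S, E.sec S →+ E.sec (swChart S)
  tau_smul : ∀ S (f : O S) (x : E.sec S), tau S (f • x) = tauO S f • tau S x
  tau_res : ∀ {S S'} (h : S ≤ S') (x : E.sec S),
    tau S' (E.res h x) = E.res (swChart_mono h) (tau S x)
  tau_tau : ∀ S (x : E.sec S), E.res (swChart_swChart_le S) (tau _ (tau S x)) = x
  coact_tau : ∀ S (x : E.sec S) (χ : Lat (Fin 3)),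
    coact (swChart S) (tau S x) (swLat χ) = tau S (coact S x χ)

namespace EquivariantModule

/-- Morphisms of `T^τ`-equivariant `𝒪`-modules. -/
@[ext]
structure Hom (A B : EquivariantModule.{u}) where
  /-- the map on sections over `U_S` -/
  app : ∀ S, A.E.sec S →ₗ[O S] B.E.sec S
  app_res : ∀ {S S'} (h : S ≤ S') (x : A.E.sec S), app S' (A.E.res h x) = B.E.res h (app S x)
  app_coact : ∀ S (x : A.E.sec S) (χ : Lat (Fin 3)),
    B.coact S (app S x) χ = app S (A.coact S x χ)
  app_tau : ∀ S (x : A.E.sec S), app (swChart S) (A.tau S x) = B.tau S (app S x)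

instance : Category EquivariantModule.{u} where
  Hom := Hom
  id A :=
    { app := fun _ => LinearMap.id
      app_res := fun _ _ => rfl
      app_coact := fun _ _ _ => rfl
      app_tau := fun _ _ => rfl }
  comp f g :=
    { app := fun S => g.app S ∘ₗ f.app S
      app_res := fun h x => by simp [f.app_res, g.app_res]
      app_coact := fun S x χ => by simp [f.app_coact, g.app_coact]
      app_tau := fun S x => by simp [f.app_tau, g.app_tau] }

/-- `ℙ¹₀`-semistable vector bundles of slope `0`, where `ℙ¹₀` is the line `u₀ = 0`. -/
def semistableBundle : ObjectProperty EquivariantModule.{u} := fun A =>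
  A.E.IsVectorBundle ∧ A.E.restrictLine.IsSemistable ∧ A.E.HasSlope (fun _ => ⊤) 0

/-- The category of `ℙ¹₀`-semistable `T^τ`-equivariant vector bundles of slope `0` on the plane, with
all `T^τ`-equivariant morphisms. -/
abbrev SemistableBundle : Type (u + 1) := semistableBundle.{u}.FullSubcategory

/-- The cokernel sheaf, over the open set `U_S`. -/
abbrev Hom.coker {A B : EquivariantModule.{u}} (f : Hom A B) (S : Chart (Fin 3)) : Type u :=
  B.E.sec S ⧸ LinearMap.range (f.app S)

/-- The singularities of the cokernel are supported at the point `(1 : 0 : 0)`: at every point `p` of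
a chart `U_k` at which the cokernel is not free, `u₁` and `u₂` vanish. -/
def singularOnlyAtPoint : MorphismProperty SemistableBundle.{u} := fun _ _ f =>
  ∀ (k : Fin 3) (p : PrimeSpectrum (O (chart k))),
    p ∉ Module.freeLocus (O (chart k)) (Hom.coker f.hom (chart k)) →
      coord k 1 ∈ p.asIdeal ∧ coord k 2 ∈ p.asIdeal

end EquivariantModule

end Equivariant

/-! ## Trifiltered vector spaces with a real structure -/

section Filtrations

variable {V : Type u} [AddCommGroup V] [Module ℂ V]

/-- The graded piece `Gr_F^n V = F^n / F^{n+1}` of a decreasing filtration. -/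
abbrev Gr (F : ℤ → Submodule ℂ V) (n : ℤ) : Type u :=
  F n ⧸ (F (n + 1)).submoduleOf (F n)

/-- The filtration induced by `G` on `Gr_F^n V`. -/
def grFiltration (F G : ℤ → Submodule ℂ V) (n : ℤ) : ℤ → Submodule ℂ (Gr F n) := fun q =>
  ((G q).submoduleOf (F n)).map ((F (n + 1)).submoduleOf (F n)).mkQ

/-- `Gr_{F₁}^p Gr_{F₂}^q Gr_{F₀}^n V = 0` whenever `p + q + n ≠ 0`. -/
def Opposed (F₀ F₁ F₂ : ℤ → Submodule ℂ V) : Prop :=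
  ∀ p q n : ℤ, p + q + n ≠ 0 →
    Subsingleton (Gr (grFiltration (grFiltration F₀ F₂ n) (grFiltration F₀ F₁ n) q) p)

end Filtrations

/-- Finite-dimensional complex vector spaces with a real structure, given by its complex
conjugation, and three opposed filtrations, the first one defined over `ℝ` and the other two complex
conjugate to each other. -/
structure RealTrifiltered where
  /-- the vector space -/
  V : Type u
  [grp : AddCommGroup V]
  [mod : Module ℂ V]
  [fin : FiniteDimensional ℂ V]
  /-- complex conjugation on `V = V_ℝ ⊗ ℂ` -/
  conj : V →ₛₗ[starRingEnd ℂ] V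
  conj_conj : ∀ v, conj (conj v) = v
  /-- the three filtrations -/
  F : Fin 3 → ℤ → Submodule ℂ V
  decreasing : ∀ i, Antitone (F i)
  exhaustive : ∀ i, (∃ p, F i p = ⊥) ∧ ∃ q, F i q = ⊤
  opposed : Opposed (F 0) (F 1) (F 2)
  real : ∀ p, (F 0 p).map conj = F 0 p
  conjugate : ∀ p, (F 1 p).map conj = F 2 p

attribute [instance] RealTrifiltered.grp RealTrifiltered.mod RealTrifiltered.fin

namespace RealTrifiltered

/-- Morphisms: complex linear maps respecting the real structures and compatible with the
filtrations. -/
@[ext]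
structure Hom (X Y : RealTrifiltered.{u}) where
  /-- the linear map -/
  f : X.V →ₗ[ℂ] Y.V
  map_conj : ∀ v, f (X.conj v) = Y.conj (f v)
  map_F : ∀ i p, ∀ v ∈ X.F i p, f v ∈ Y.F i p

instance : Category RealTrifiltered.{u} where
  Hom := Hom
  id X :=
    { f := LinearMap.id
      map_conj := fun _ => rfl
      map_F := fun _ _ _ h => h }
  comp g h :=
    { f := h.f ∘ₗ g.f
      map_conj := fun v => by simp [g.map_conj, h.map_conj]
      map_F := fun i p v hv => h.map_F i p _ (g.map_F i p v hv) }

/-- Morphisms strictly compatible with the three filtrations. -/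
def strict : MorphismProperty RealTrifiltered.{u} := fun X Y g =>
  ∀ (i : Fin 3) (p : ℤ), (X.F i p).map (Hom.f g) = LinearMap.range (Hom.f g) ⊓ Y.F i p

theorem conj_mem (X : RealTrifiltered.{u}) (i : Fin 3) (p : ℤ) (v : X.V) (hv : v ∈ X.F i p) :
    X.conj v ∈ X.F (sw i) p := by
  fin_cases i
  · show X.conj v ∈ X.F 0 p
    rw [← X.real p]
    exact Submodule.mem_map_of_mem hv
  · show X.conj v ∈ X.F 2 p
    rw [← X.conjugate p]
    exact Submodule.mem_map_of_mem hv
  · show X.conj v ∈ X.F 1 p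
    have hv : v ∈ X.F 2 p := hv
    rw [← X.conjugate p] at hv
    obtain ⟨w, hw, rfl⟩ := Submodule.mem_map.1 hv
    rwa [X.conj_conj]

end RealTrifiltered

/-! ## The Rees construction -/

section Rees

/-- `V ⊗ ℂ[u^m]`, the finite sums of terms `u^m v` with `m` of degree `0` and `v ∈ V`. -/
def LaurentVec (V : Type u) [AddCommGroup V] [Module ℂ V] : Type u := Lat (Fin 3) →₀ V

variable (V : Type u) [AddCommGroup V] [Module ℂ V]

instance : AddCommGroup (LaurentVec V) := inferInstanceAs (AddCommGroup (Lat (Fin 3) →₀ V))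

instance : Module ℂ (LaurentVec V) := inferInstanceAs (Module ℂ (Lat (Fin 3) →₀ V))

/-- Multiplication by Laurent polynomials, `u^m (u^n v) = u^{m+n} v`. -/
def laurentAction : Laurent (Fin 3) →ₐ[ℂ] Module.End ℂ (LaurentVec V) :=
  AddMonoidAlgebra.lift ℂ (Module.End ℂ (LaurentVec V)) (Lat (Fin 3))
    { toFun := fun m => Finsupp.lmapDomain V ℂ (m.toAdd + ·)
      map_one' := by
        apply LinearMap.ext
        intro x
        show Finsupp.mapDomain _ x = x
        convert Finsupp.mapDomain_id using 2
        funext n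
        simp
      map_mul' := by
        intro a b
        apply LinearMap.ext
        intro x
        show Finsupp.mapDomain _ x = Finsupp.mapDomain _ (Finsupp.mapDomain _ x)
        rw [← Finsupp.mapDomain_comp]
        congr 1
        funext n
        simp [add_assoc] }

instance : Module (Laurent (Fin 3)) (LaurentVec V) :=
  Module.compHom _ (laurentAction V).toRingHom

variable {V}

/-- The coefficient of `u^m`. -/
def LaurentVec.coeff (x : LaurentVec V) (m : Lat (Fin 3)) : V :=
  (show Lat (Fin 3) →₀ V from x) m

@[ext]
theorem LaurentVec.ext {x y : LaurentVec V} (h : ∀ m, x.coeff m = y.coeff m) : x = y :=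
  Finsupp.ext h

theorem LaurentVec.coeff_add (x y : LaurentVec V) (m : Lat (Fin 3)) :
    (x + y).coeff m = x.coeff m + y.coeff m := rfl

theorem LaurentVec.coeff_zero (m : Lat (Fin 3)) : (0 : LaurentVec V).coeff m = 0 := rfl

theorem LaurentVec.single_smul_coeff (a : Lat (Fin 3)) (c : ℂ) (x : LaurentVec V)
    (m : Lat (Fin 3)) :
    ((AddMonoidAlgebra.single a c : Laurent (Fin 3)) • x).coeff (a + m) = c • x.coeff m := by
  show (laurentAction V (AddMonoidAlgebra.single a c) x).coeff (a + m) = _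
  rw [laurentAction, AddMonoidAlgebra.lift_single]
  show c • (Finsupp.mapDomain (a + ·) (show Lat (Fin 3) →₀ V from x)) (a + m) = _
  rw [Finsupp.mapDomain_apply (add_right_injective a)]
  rfl

theorem LaurentVec.smul_coeff (f : Laurent (Fin 3)) (x : LaurentVec V) (m : Lat (Fin 3)) :
    (f • x).coeff m = f.coeff.sum fun a c => c • x.coeff (m - a) := by
  classical
  induction f using AddMonoidAlgebra.induction_linear with
  | zero => simp [LaurentVec.coeff_zero]
  | add f g hf hg =>
    rw [add_smul, LaurentVec.coeff_add, hf, hg, AddMonoidAlgebra.coeff_add,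
      Finsupp.sum_add_index']
    · simp
    · intro a b c
      rw [add_smul]
  | single a c =>
    rw [AddMonoidAlgebra.coeff_single, Finsupp.sum_single_index (by simp),
      ← LaurentVec.single_smul_coeff, add_sub_cancel]

instance (S : Chart (Fin 3)) : Module (O S) (LaurentVec V) :=
  Module.compHom _ (regularFunctions S).val.toRingHom

theorem LaurentVec.regular_smul (S : Chart (Fin 3)) (f : O S) (x : LaurentVec V) :
    f • x = f.1 • x := rfl

namespace RealTrifiltered

variable (X Y : RealTrifiltered.{u})

/-- The sections over `U_S` of the Rees bundle: the sums of terms `u^m v` with `v ∈ F_i^{-m_i}` for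
all `i ∉ S`. -/
def reesSections (S : Chart (Fin 3)) : Submodule (O S) (LaurentVec X.V) where
  carrier := {x | ∀ m, ∀ i ∉ S.1, x.coeff m ∈ X.F i (-m.1 i)}
  zero_mem' := fun _ _ _ => Submodule.zero_mem _
  add_mem' := fun hx hy m i hi => Submodule.add_mem _ (hx m i hi) (hy m i hi)
  smul_mem' := by
    intro f x hx m i hi
    rw [LaurentVec.regular_smul, LaurentVec.smul_coeff]
    refine Submodule.sum_mem _ fun a ha => Submodule.smul_mem _ _ ?_
    have h := f.2 a (Finsupp.mem_support_iff.1 ha) i hi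
    refine X.decreasing i ?_ (hx (m - a) i hi)
    show -m.1 i ≤ -(m.1 i - a.1 i)
    omega

/-- The Rees `𝒪`-module of a trifiltered vector space. -/
def reesModule : ChartModule.{u} (Fin 3) where
  sec S := X.reesSections S
  res h :=
    { toFun := fun x => ⟨x.1, fun m i hi => x.2 m i fun hi' => hi (h hi')⟩
      map_zero' := rfl
      map_add' := fun _ _ => rfl }
  res_smul _ _ _ := rfl
  res_refl _ := rfl
  res_trans _ _ _ := rfl

variable {X}

/-- The term `u^m x_m` of a section `x`. -/
def reesTerm {S : Chart (Fin 3)} (x : X.reesSections S) (m : Lat (Fin 3)) : X.reesSections S :=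
  ⟨Finsupp.single m (x.1.coeff m), by
    classical
    intro n i hi
    show Finsupp.single m (x.1.coeff m) n ∈ _
    rw [Finsupp.single_apply]
    split_ifs with h
    · exact h ▸ x.2 m i hi
    · exact Submodule.zero_mem _⟩

theorem reesTerm_coeff {S : Chart (Fin 3)} (x : X.reesSections S) (m n : Lat (Fin 3)) :
    (reesTerm x m).1.coeff n = Finsupp.single m (x.1.coeff m) n := rfl

theorem reesTerm_zero {S : Chart (Fin 3)} (m : Lat (Fin 3)) :
    reesTerm (0 : X.reesSections S) m = 0 :=
  Subtype.ext (Finsupp.single_zero m)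

/-- The torus acts on `u^m v` through the character `m`. -/
def reesCoact (S : Chart (Fin 3)) :
    X.reesSections S →+ (Lat (Fin 3) →₀ X.reesSections S) where
  toFun x := Finsupp.onFinset (Finsupp.support (show Lat (Fin 3) →₀ X.V from x.1)) (reesTerm x) (by
    intro m hm
    refine Finsupp.mem_support_iff.2 fun h => hm (Subtype.ext ?_)
    show Finsupp.single m (x.1.coeff m) = 0
    rw [show x.1.coeff m = 0 from h, Finsupp.single_zero])
  map_zero' := Finsupp.ext fun m => reesTerm_zero m
  map_add' x y := Finsupp.ext fun m => Subtype.ext (Finsupp.single_add m _ _)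

theorem reesCoact_apply (S : Chart (Fin 3)) (x : X.reesSections S) (m : Lat (Fin 3)) :
    reesCoact S x m = reesTerm x m := rfl

variable (X) in
/-- The action of `τ`, given by `u^m v ↦ u^{m ∘ sw} v̄`. -/
def tauVec : LaurentVec X.V →+ LaurentVec X.V :=
  (Finsupp.mapDomain.addMonoidHom swLat).comp (Finsupp.mapRange.addMonoidHom X.conj.toAddMonoidHom)

theorem tauVec_coeff (x : LaurentVec X.V) (m : Lat (Fin 3)) :
    (X.tauVec x).coeff m = X.conj (x.coeff (swLat m)) := by
  have h := Finsupp.mapDomain_apply (Function.LeftInverse.injective swLat_swLat)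
    (Finsupp.mapRange.addMonoidHom X.conj.toAddMonoidHom x) (swLat m)
  rw [swLat_swLat] at h
  exact h

theorem tauVec_smul (f : Laurent (Fin 3)) (x : LaurentVec X.V) :
    X.tauVec (f • x) = tauLaurent f • X.tauVec x := by
  induction f using AddMonoidAlgebra.induction_linear with
  | zero => simp
  | add f g hf hg => rw [add_smul, map_add, hf, hg, map_add, add_smul]
  | single a c =>
    ext m
    rw [tauLaurent_single]
    obtain ⟨n, rfl⟩ : ∃ n, m = swLat a + n := ⟨-swLat a + m, by abel⟩
    rw [LaurentVec.single_smul_coeff, tauVec_coeff, tauVec_coeff, map_add, swLat_swLat,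
      LaurentVec.single_smul_coeff, LinearMap.map_smulₛₗ]

/-- The `τ`-structure on the Rees module. -/
def reesTau (S : Chart (Fin 3)) : X.reesSections S →+ X.reesSections (swChart S) where
  toFun x := ⟨X.tauVec x.1, by
    intro m i hi
    rw [tauVec_coeff]
    have h := X.conj_mem (sw i) _ _ (x.2 (swLat m) (sw i) fun h => hi (mem_swChart.2 h))
    have h2 : (swLat m).1 (sw i) = m.1 i := by
      show m.1 (sw (sw i)) = m.1 i
      rw [Equiv.swap_apply_self]
    rwa [Equiv.swap_apply_self, h2] at h⟩
  map_zero' := Subtype.ext (map_zero X.tauVec)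
  map_add' x y := Subtype.ext (map_add X.tauVec x.1 y.1)

theorem reesCoact_counit (S : Chart (Fin 3)) (x : X.reesSections S) :
    ((reesCoact S x).sum fun _ y => y) = x := by
  apply Subtype.ext
  show (X.reesSections S).subtype (∑ m ∈ (reesCoact S x).support, reesCoact S x m) = x.1
  rw [map_sum]
  have h : (reesCoact S x).support = Finsupp.support (show Lat (Fin 3) →₀ X.V from x.1) := by
    ext m
    rw [Finsupp.mem_support_iff, Finsupp.mem_support_iff, not_iff_not, reesCoact_apply,
      Subtype.ext_iff]
    exact Finsupp.single_eq_zero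
  rw [h]
  exact Finsupp.sum_single (show Lat (Fin 3) →₀ X.V from x.1)

theorem reesCoact_reesTau (S : Chart (Fin 3)) (x : X.reesSections S) (χ : Lat (Fin 3)) :
    reesCoact (swChart S) (reesTau S x) (swLat χ) = reesTau S (reesCoact S x χ) := by
  classical
  apply Subtype.ext
  apply LaurentVec.ext
  intro m
  show Finsupp.single (swLat χ) ((X.tauVec x.1).coeff (swLat χ)) m =
    (X.tauVec (reesTerm x χ).1).coeff m
  rw [tauVec_coeff, tauVec_coeff, reesTerm_coeff, swLat_swLat, Finsupp.single_apply,
    Finsupp.single_apply]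
  have h : swLat χ = m ↔ χ = swLat m :=
    ⟨fun h => by rw [← h, swLat_swLat], fun h => by rw [h, swLat_swLat]⟩
  simp only [h]
  split_ifs <;> simp

variable (X) in
/-- The Rees module with its action of `T^τ`. -/
def rees : EquivariantModule.{u} where
  E := X.reesModule
  coact S := reesCoact S
  coact_counit S x := reesCoact_counit S x
  coact_coassoc S x χ := by
    classical
    apply Finsupp.ext
    intro m
    show reesTerm (reesTerm x χ) m = Finsupp.single χ (reesTerm x χ) m
    by_cases h : χ = m
    · subst h
      rw [Finsupp.single_eq_same]
      apply Subtype.ext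
      show Finsupp.single χ (Finsupp.single χ (x.1.coeff χ) χ) = Finsupp.single χ (x.1.coeff χ)
      rw [Finsupp.single_eq_same]
    · rw [Finsupp.single_eq_of_ne (Ne.symm h)]
      apply Subtype.ext
      show Finsupp.single m (Finsupp.single χ (x.1.coeff χ) m) = 0
      rw [Finsupp.single_eq_of_ne (Ne.symm h), Finsupp.single_zero]
  coact_smul S m hm c x χ := by
    classical
    apply Subtype.ext
    apply LaurentVec.ext
    intro n
    obtain ⟨n, rfl⟩ : ∃ n', n = m + n' := ⟨-m + n, by abel⟩
    have h (y : LaurentVec X.V) (a : Lat (Fin 3)) :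
        (mono S m hm c • y).coeff (m + a) = c • y.coeff a :=
      LaurentVec.single_smul_coeff m c y a
    refine Eq.trans ?_ (h (reesTerm x χ).1 n).symm
    show Finsupp.single (m + χ) ((mono S m hm c • x.1).coeff (m + χ)) (m + n) =
      c • Finsupp.single χ (x.1.coeff χ) n
    rw [h, Finsupp.single_apply, Finsupp.single_apply]
    simp only [add_right_inj]
    split_ifs <;> simp
  coact_res _ _ _ := rfl
  tau S := reesTau S
  tau_smul S f x := Subtype.ext (tauVec_smul f.1 x.1)
  tau_res _ _ := rfl
  tau_tau S x := by
    apply Subtype.ext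
    apply LaurentVec.ext
    intro m
    show (X.tauVec (X.tauVec x.1)).coeff m = x.1.coeff m
    rw [tauVec_coeff, tauVec_coeff, X.conj_conj, swLat_swLat]
  coact_tau S x χ := reesCoact_reesTau S x χ

variable {Y}

/-- `u^m v ↦ u^m f(v)`. -/
def mapVec (f : X.V →ₗ[ℂ] Y.V) : LaurentVec X.V →+ LaurentVec Y.V :=
  Finsupp.mapRange.addMonoidHom f.toAddMonoidHom

theorem mapVec_coeff (f : X.V →ₗ[ℂ] Y.V) (x : LaurentVec X.V) (m : Lat (Fin 3)) :
    (mapVec f x).coeff m = f (x.coeff m) := rfl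

theorem mapVec_smul (f : X.V →ₗ[ℂ] Y.V) (a : Laurent (Fin 3)) (x : LaurentVec X.V) :
    mapVec f (a • x) = a • mapVec f x := by
  ext m
  rw [mapVec_coeff, LaurentVec.smul_coeff, LaurentVec.smul_coeff, map_finsuppSum]
  simp only [map_smul, mapVec_coeff]

/-- The morphism of Rees modules given by a morphism of trifiltered vector spaces. -/
def reesMap (f : Hom X Y) : EquivariantModule.Hom X.rees Y.rees where
  app S :=
    { toFun := fun x => ⟨mapVec f.f x.1, fun m i hi => f.map_F i _ _ (x.2 m i hi)⟩
      map_add' := fun x y => Subtype.ext (map_add (mapVec f.f) x.1 y.1)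
      map_smul' := fun a x => Subtype.ext (mapVec_smul f.f a.1 x.1) }
  app_res _ _ := rfl
  app_coact S x χ := by
    apply Subtype.ext
    show Finsupp.single χ (f.f (x.1.coeff χ)) =
      Finsupp.mapRange f.f (map_zero f.f) (Finsupp.single χ (x.1.coeff χ))
    rw [Finsupp.mapRange_single]
  app_tau S x := by
    apply Subtype.ext
    apply LaurentVec.ext
    intro m
    show (mapVec f.f (X.tauVec x.1)).coeff m = (Y.tauVec (mapVec f.f x.1)).coeff m
    rw [mapVec_coeff, tauVec_coeff, tauVec_coeff, mapVec_coeff, f.map_conj]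

end RealTrifiltered

/-- The Rees functor. -/
def reesFunctor : RealTrifiltered.{u} ⥤ EquivariantModule.{u} where
  obj X := X.rees
  map f := RealTrifiltered.reesMap f
  map_id X := by
    apply EquivariantModule.Hom.ext
    funext S
    apply LinearMap.ext
    intro x
    apply Subtype.ext
    apply LaurentVec.ext
    intro m
    rfl
  map_comp f g := by
    apply EquivariantModule.Hom.ext
    funext S
    apply LinearMap.ext
    intro x
    apply Subtype.ext
    apply LaurentVec.ext
    intro m
    rfl

end Rees

end ReesPlane

end

/-! Strictness, and local freeness of the cokernel off (1:0:0), hold for every morphism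
(`strict_eq_top`, `singularOnlyAtPoint_eq_top`). So both wide subcategories contain all morphisms,
composition is no issue, and it remains to see that the Rees functor is fully faithful with the
semistable bundles of slope 0 as its essential image.

Full faithfulness is a matter of weights. An equivariant map preserves the term of each character
and commutes with monomials, so it is determined by one linear map on coefficients (`app_coeff`);
regularity over the charts forces this map to respect the filtrations.

For essential surjectivity, take the torus-invariant sections over the open orbit, filtered by order
of vanishing along the lines u_i = 0. The coaction identifies all sections over the orbit with
Laurent polynomials in these invariants (`orbitEquiv`). A section of a bundle extends to U_S as soon
as it extends across each divisor separately (`IsVectorBundle.mem_extendable`), whence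
`vanishingPresentation`. Conversely the Rees module of any three filtrations is a bundle, because a
chart U_k sees only two of them and two filtrations always have a common splitting basis
(`exists_adapted`).

Opposedness corresponds to semistability. Lift one basis of Gr for F₀, adapted to both induced
filtrations, once compatibly with F₁ and once with F₂ (`exists_triadapted`). The lifts agree modulo
a deeper step of F₀, that is, modulo u_0, so the restriction to the line is the sum of the line
bundles 𝒪(n_j + p_j + q_j) (`exists_lineSplitting`). Opposedness says that all these degrees vanish
(`opposed_iff_of_adapted`). A split bundle with degrees 0 is semistable because maximal minors of
subsheaves have no poles; conversely, semistability of slope 0 tested on the summands forces all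
degrees to be 0.

Strictness follows Deligne. Opposedness gives a complement `oppositeSpace` of F₁^p ∩ F₀^n in F₀^n
and a lift `deligneSpace` of the bigraded pieces of Gr, both functorial. A morphism preserves them,
hence is strict for F₀, strict for F₁ inside each step of F₀, and such that in the cokernel the
images of F₀ and F₁ meet in the image of F₀ ∩ F₁. The same holds for F₂ by symmetry. Therefore on
U_1 and U_2 the cokernel is the Rees module of the quotient filtrations, hence free. On U_0 the pair
F₁, F₂ may misbehave, but off (1:0:0) one of u_1, u_2 is invertible and only one filtration matters.
-/

noncomputable section
namespace ReesPlane

/-! ### Monomials and regular functions on the charts -/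

section Functions

variable {ι : Type} [Fintype ι]

instance (S : Chart ι) : Algebra ℂ (O S) := inferInstanceAs (Algebra ℂ (regularFunctions S))

/-- A function on `U_S` as a Laurent polynomial. -/
def toLaurent (S : Chart ι) : O S →ₐ[ℂ] Laurent ι := (regularFunctions S).val

theorem toLaurent_injective (S : Chart ι) : Function.Injective (toLaurent S) :=
  Subtype.val_injective

theorem toLaurent_resO {S S' : Chart ι} (h : S ≤ S') (f : O S) :
    toLaurent S' (resO h f) = toLaurent S f := rfl

theorem toLaurent_mono (S : Chart ι) (m : Lat ι) (hm) (c : ℂ) :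
    toLaurent S (mono S m hm c) = AddMonoidAlgebra.single m c := rfl

theorem resO_mono {S S' : Chart ι} (h : S ≤ S') (m : Lat ι) (hm) (c : ℂ) :
    resO h (mono S m hm c) = mono S' m (fun i hi => hm i fun hi' => hi (h hi')) c := rfl

theorem mono_mul (S : Chart ι) (m n : Lat ι) (hm hn) (c d : ℂ) :
    mono S m hm c * mono S n hn d =
      mono S (m + n) (fun i hi => add_nonneg (hm i hi) (hn i hi)) (c * d) := by
  apply toLaurent_injective
  rw [map_mul]
  simp only [toLaurent_mono, AddMonoidAlgebra.single_mul_single]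

theorem mono_zero_one (S : Chart ι) : mono S 0 (fun _ _ => le_rfl) 1 = 1 := rfl

theorem mono_congr (S : Chart ι) {m n : Lat ι} (h : m = n) (hm) (c : ℂ) :
    mono S m hm c = mono S n (h ▸ hm) c := by
  subst h; rfl

/-- A monomial `c u^m` all of whose exponents outside `S` vanish is invertible on `U_S`. -/
theorem isUnit_mono (S : Chart ι) (m : Lat ι) (hm : ∀ i ∉ S.1, m.1 i = 0) {c : ℂ} (hc : c ≠ 0) :
    IsUnit (mono S m (fun i hi => (hm i hi).ge) c) := by
  refine IsUnit.of_mul_eq_one (mono S (-m) (fun i hi => ?_) c⁻¹) ?_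
  · show 0 ≤ -(m.1 i)
    rw [hm i hi, neg_zero]
  · rw [mono_mul, mul_inv_cancel₀ hc, mono_congr S (add_neg_cancel m)]
    rfl

theorem toLaurent_coeff_nonneg {S : Chart ι} (f : O S) {m : Lat ι}
    (hm : (toLaurent S f).coeff m ≠ 0) {i : ι} (hi : i ∉ S.1) : 0 ≤ m.1 i := f.2 m hm i hi

/-- Additive induction on functions, from monomials. -/
theorem regular_induction {S : Chart ι} {P : O S → Prop} (zero : P 0)
    (add : ∀ f g, P f → P g → P (f + g)) (mono : ∀ m hm c, P (mono S m hm c)) (f : O S) : P f := by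
  classical
  have key : f = ∑ m ∈ (toLaurent S f).coeff.support.attach,
      ReesPlane.mono S m.1 (f.2 m.1 (Finsupp.mem_support_iff.1 m.2)) ((toLaurent S f).coeff m.1) := by
    apply toLaurent_injective
    rw [map_sum]
    simp only [toLaurent_mono]
    rw [Finset.sum_attach _ (fun m => AddMonoidAlgebra.single m ((toLaurent S f).coeff m))]
    apply AddMonoidAlgebra.ext
    rw [AddMonoidAlgebra.coeff_sum]
    exact (Finsupp.sum_single _).symm
  rw [key]
  exact Finset.sum_induction _ P add zero (fun m _ => mono _ _ _)

/-- A subgroup of ℤ^ι inherits unique sums, which makes the Laurent polynomials, and with them all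
rings of functions `O S`, into domains. -/
instance : TwoUniqueSums (Lat ι) :=
  TwoUniqueSums.of_injective_addHom (Lat ι).subtype.toAddHom Subtype.val_injective inferInstance

instance : IsDomain (Laurent ι) := NoZeroDivisors.to_isDomain _

instance (S : Chart ι) : IsDomain (O S) :=
  (toLaurent_injective S).isDomain (toLaurent S)

/-- There is a monomial `u^b` of degree `0` which is regular on `U_S`, invertible on `U_{S ∪ S'}`,
and vanishes to the order `N` along `u_i = 0` for `i ∈ S' \ S`. -/
theorem exists_clearing_exponent [DecidableEq ι] {S S' : Chart ι} (N : ℕ) :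
    ∃ b : Lat ι, (∀ i ∉ S'.1, i ∉ S.1 → b.1 i = 0) ∧ (∀ i ∉ S.1, i ∈ S'.1 → b.1 i = N) := by
  obtain ⟨s, hs⟩ := S.2
  -- The poles needed for degree 0 are all put on one coordinate u_s with s in S, where they are
  -- harmless.
  refine ⟨∑ i ∈ S'.1 \ S.1, (N : ℤ) • quotExp i s, ?_, ?_⟩
  all_goals
    intro i h1 h2
    have hv : (∑ j ∈ S'.1 \ S.1, (N : ℤ) • quotExp j s : Lat ι).1 i =
        ∑ j ∈ S'.1 \ S.1, (N : ℤ) * ((Pi.single j 1 : ι → ℤ) i - (Pi.single s 1 : ι → ℤ) i) := by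
      rw [AddSubgroup.val_finsetSum, Finset.sum_apply]
      rfl
    have his : i ≠ s := by rintro rfl; contradiction
    rw [hv]
    simp only [Pi.single_apply, his, if_false, sub_zero, mul_ite, mul_one, mul_zero]
    rw [Finset.sum_ite_eq]
    simp [h1, h2]

/-- A function on `U_{S'}` extends to the larger open set `U_S` after multiplication with a monomial
that is regular on `U_S` and invertible on `U_{S'}`. -/
theorem exists_mono_mul_mem_range [DecidableEq ι] {S S' : Chart ι} (h : S ≤ S') (g : O S') :
    ∃ (b : Lat ι) (hb' : ∀ i ∉ S'.1, b.1 i = 0) (_ : ∀ i ∉ S.1, 0 ≤ b.1 i) (f : O S),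
      resO h f = mono S' b (fun i hi => (hb' i hi).ge) 1 * g := by
  classical
  -- One bound for the pole orders of all monomials of g along all coordinates.
  obtain ⟨N, hN⟩ : ∃ N : ℕ, ∀ m ∈ (toLaurent S' g).coeff.support, ∀ i, -(N : ℤ) ≤ m.1 i := by
    refine ⟨∑ m ∈ (toLaurent S' g).coeff.support, ∑ i, (m.1 i).natAbs, fun m hm i => ?_⟩
    have h1 := Finset.single_le_sum (f := fun m : Lat ι => ∑ i, (m.1 i).natAbs)
      (fun _ _ => Nat.zero_le _) hm
    have h2 := Finset.single_le_sum (f := fun i => (m.1 i).natAbs)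
      (fun _ _ => Nat.zero_le _) (Finset.mem_univ i)
    omega
  obtain ⟨b, hb', hb⟩ := exists_clearing_exponent (S := S) (S' := S') N
  have hbS : ∀ i ∉ S'.1, b.1 i = 0 := fun i hi => hb' i hi fun h' => hi (h h')
  refine ⟨b, hbS, ?_, ⟨toLaurent S' (mono S' b (fun i hi => (hbS i hi).ge) 1 * g), ?_⟩, rfl⟩
  · intro i hi
    by_cases hi' : i ∈ S'.1
    · rw [hb i hi hi']; positivity
    · rw [hbS i hi']
  · intro m hm i hi
    obtain ⟨n, rfl⟩ : ∃ n, m = b + n := ⟨-b + m, by abel⟩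
    by_cases hi' : i ∈ S'.1
    · rw [map_mul, toLaurent_mono, AddMonoidAlgebra.coeff_single_mul_add, one_mul] at hm
      have := hN n (Finsupp.mem_support_iff.2 hm) i
      show 0 ≤ b.1 i + n.1 i
      rw [hb i hi hi']
      omega
    · exact toLaurent_coeff_nonneg _ hm hi'

/-- The chart on which all coordinates are invertible. -/
def openOrbit (ι : Type) [Fintype ι] [Nonempty ι] : Chart ι := ⟨Finset.univ, Finset.univ_nonempty⟩

theorem le_openOrbit [Nonempty ι] (S : Chart ι) : S ≤ openOrbit ι := Finset.subset_univ _

theorem mem_openOrbit [Nonempty ι] {i : ι} : i ∈ (openOrbit ι).1 := Finset.mem_univ i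

end Functions

end ReesPlane
end

noncomputable section
namespace ReesPlane

/-! ### Bases adapted to one or two filtrations -/

section Adapted

variable {V : Type u} [AddCommGroup V] [Module ℂ V]

/-- A decreasing filtration that is finite, separated and exhaustive. -/
structure IsFiltration (F : ℤ → Submodule ℂ V) : Prop where
  anti : Antitone F
  bot : ∃ p, F p = ⊥
  top : ∃ q, F q = ⊤

/-- The basis `b` splits the filtrations `F` and `G`, with `b j` of level `p j` for `F` and `q j` for
`G`. -/
def IsAdapted {J : Type*} (F G : ℤ → Submodule ℂ V) (b : Module.Basis J ℂ V) (p q : J → ℤ) : Prop :=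
  ∀ x y, F x ⊓ G y = Submodule.span ℂ (b '' {j | x ≤ p j ∧ y ≤ q j})

/-- The basis `b` splits the filtration `F`, with `b j` of level `p j`. -/
def Splits {J : Type*} (F : ℤ → Submodule ℂ V) (b : Module.Basis J ℂ V) (p : J → ℤ) : Prop :=
  ∀ x, F x = Submodule.span ℂ (b '' {j | x ≤ p j})

variable {F G : ℤ → Submodule ℂ V} {J : Type*} {b : Module.Basis J ℂ V} {p q : J → ℤ}

theorem IsAdapted.mem_iff (h : IsAdapted F G b p q) {x y : ℤ} {v : V} :
    v ∈ F x ∧ v ∈ G y ↔ ∀ j, b.repr v j ≠ 0 → x ≤ p j ∧ y ≤ q j := by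
  rw [← Submodule.mem_inf, h x y, b.mem_span_image]
  simp only [Set.subset_def, Finset.mem_coe, Finsupp.mem_support_iff]
  rfl

theorem Splits.mem_iff (h : Splits F b p) {x : ℤ} {v : V} :
    v ∈ F x ↔ ∀ j, b.repr v j ≠ 0 → x ≤ p j := by
  rw [h x, b.mem_span_image]
  simp only [Set.subset_def, Finset.mem_coe, Finsupp.mem_support_iff]
  rfl

theorem IsAdapted.mem_left (h : IsAdapted F G b p q) (j : J) : b j ∈ F (p j) :=
  (h.mem_iff (y := q j) |>.2 (by
    classical
    intro i hi
    rw [b.repr_self, Finsupp.single_apply] at hi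
    have : j = i := by by_contra h'; exact hi (if_neg h')
    exact this ▸ ⟨le_rfl, le_rfl⟩)).1

theorem IsAdapted.symm (h : IsAdapted F G b p q) : IsAdapted G F b q p := by
  intro x y
  rw [inf_comm, h]
  simp only [and_comm]

theorem IsAdapted.mem_right (h : IsAdapted F G b p q) (j : J) : b j ∈ G (q j) := h.symm.mem_left j

theorem IsAdapted.left (h : IsAdapted F G b p q) (hF : IsFiltration F) (hG : IsFiltration G) :
    Splits F b p := by
  intro x
  obtain ⟨y, hy⟩ := hG.top
  apply le_antisymm
  · intro v hv
    have h1 := h.mem_iff.1 ⟨hv, (hy ▸ Submodule.mem_top : v ∈ G y)⟩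
    rw [b.mem_span_image]
    intro j hj
    exact (h1 j (Finsupp.mem_support_iff.1 hj)).1
  · rw [Submodule.span_le]
    rintro _ ⟨j, hj, rfl⟩
    exact hF.anti hj (h.mem_left j)

theorem IsAdapted.right (h : IsAdapted F G b p q) (hF : IsFiltration F) (hG : IsFiltration G) :
    Splits G b q := h.symm.left hG hF

theorem IsAdapted.reindex {J' : Type*} (h : IsAdapted F G b p q) (e : J ≃ J') :
    IsAdapted F G (b.reindex e) (p ∘ e.symm) (q ∘ e.symm) := by
  intro x y
  rw [h]
  congr 1
  ext v
  constructor
  · rintro ⟨j, hj, rfl⟩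
    exact ⟨e j, by simpa using hj, by simp⟩
  · rintro ⟨j, hj, rfl⟩
    exact ⟨e.symm j, hj, by simp⟩

/-- The class in `Gr_F^n` of an element of `F^n`. -/
abbrev grMk (F : ℤ → Submodule ℂ V) (n : ℤ) : F n →ₗ[ℂ] Gr F n := ((F (n + 1)).submoduleOf (F n)).mkQ

theorem grMk_eq_zero {n : ℤ} {x : F n} : grMk F n x = 0 ↔ (x : V) ∈ F (n + 1) := by
  rw [grMk, Submodule.mkQ_apply, Submodule.Quotient.mk_eq_zero]
  rfl

theorem mem_grFiltration {n y : ℤ} {w : Gr F n} :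
    w ∈ grFiltration F G n y ↔ ∃ x : F n, (x : V) ∈ G y ∧ grMk F n x = w := Iff.rfl

theorem IsFiltration.grFiltration (hG : IsFiltration G) (n : ℤ) :
    IsFiltration (grFiltration F G n) where
  anti := by
    rintro x y h _ ⟨v, hv, rfl⟩
    exact ⟨v, hG.anti h hv, rfl⟩
  bot := by
    obtain ⟨p, hp⟩ := hG.bot
    refine ⟨p, eq_bot_iff.2 ?_⟩
    rintro _ ⟨v, hv, rfl⟩
    have : (v : V) ∈ G p := hv
    rw [hp, Submodule.mem_bot] at this
    rw [Submodule.mem_bot, grMk_eq_zero, this]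
    exact zero_mem _
  top := by
    obtain ⟨p, hp⟩ := hG.top
    refine ⟨p, eq_top_iff.2 ?_⟩
    rintro w -
    obtain ⟨v, rfl⟩ := Submodule.mkQ_surjective _ w
    exact ⟨v, (hp ▸ Submodule.mem_top : (v : V) ∈ G p), rfl⟩

/-- Bases of the graded pieces `Gr_F^n` which split the filtration induced by `G` lift to a basis
which splits both `F` and `G`. -/
theorem exists_adapted_lift (hF : IsFiltration F) (hG : IsFiltration G) {lo hi : ℤ}
    (hlo : F lo = ⊤) (hhi : F hi = ⊥) {r : ℤ → ℕ} (w : ∀ n, Module.Basis (Fin (r n)) ℂ (Gr F n))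
    {q : ∀ n, Fin (r n) → ℤ} (hq : ∀ n, Splits (grFiltration F G n) (w n) (q n)) :
    ∃ b : Module.Basis (Σ n : Finset.Ico lo hi, Fin (r n)) ℂ V,
      (∀ j, ∃ h : b j ∈ F j.1, grMk F j.1 ⟨b j, h⟩ = w j.1 j.2) ∧
      IsAdapted F G b (fun j => j.1) (fun j => q j.1 j.2) := by
  classical
  -- Each vector of `w n` lies in the induced filtration at its own level, so it has a lift in F ∩ G
  -- of that level.
  have hex (j : Σ n : Finset.Ico lo hi, Fin (r n)) : ∃ x : F j.1, (x : V) ∈ G (q j.1 j.2) ∧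
      grMk F j.1 x = w j.1 j.2 := by
    rw [← mem_grFiltration, (hq j.1).mem_iff]
    intro i hi
    rw [Module.Basis.repr_self, Finsupp.single_apply] at hi
    have : j.2 = i := by by_contra h'; exact hi (if_neg h')
    rw [this]
  choose v hvG hvw using hex
  have hvw' (n : ℤ) (hn : n ∈ Finset.Ico lo hi) (i : Fin (r n)) :
      grMk F n (v ⟨⟨n, hn⟩, i⟩) = w n i := hvw ⟨⟨n, hn⟩, i⟩
  -- subtracting a combination of the `v j` of level `n` improves the level by one
  have step (n y : ℤ) (x : V) (hx : x ∈ F n) (hx' : x ∈ G y) :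
      ∃ z ∈ Submodule.span ℂ ((fun j => (v j : V)) '' {j | n ≤ (j.1 : ℤ) ∧ y ≤ q j.1 j.2}),
        x - z ∈ F (n + 1) ∧ x - z ∈ G y := by
    by_cases hn : n ∈ Finset.Ico lo hi
    · have h1 : grMk F n ⟨x, hx⟩ ∈ grFiltration F G n y := ⟨⟨x, hx⟩, hx', rfl⟩
      rw [(hq n).mem_iff] at h1
      set c := (w n).repr (grMk F n ⟨x, hx⟩) with hc
      let z : V := ∑ i, c i • (v ⟨⟨n, hn⟩, i⟩ : V)
      have hzn : z ∈ F n := Submodule.sum_mem _ fun i _ => Submodule.smul_mem _ _ (v ⟨⟨n, hn⟩, i⟩).2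
      refine ⟨z, ?_, ?_, ?_⟩
      · refine Submodule.sum_mem _ fun i _ => ?_
        by_cases h0 : c i = 0
        · rw [h0, zero_smul]; exact zero_mem _
        · exact Submodule.smul_mem _ _ (Submodule.subset_span ⟨⟨⟨n, hn⟩, i⟩, ⟨le_rfl, h1 i h0⟩, rfl⟩)
      · have : grMk F n (⟨x, hx⟩ - ∑ i, c i • v ⟨⟨n, hn⟩, i⟩) = 0 := by
          rw [map_sub, map_sum]
          simp only [map_smul, hvw']
          rw [hc, (w n).sum_repr, sub_self]
        rw [grMk_eq_zero] at this
        convert this using 1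
        simp [z]
      · refine Submodule.sub_mem _ hx' (Submodule.sum_mem _ fun i _ => ?_)
        by_cases h0 : c i = 0
        · rw [h0, zero_smul]; exact zero_mem _
        · exact Submodule.smul_mem _ _ (hG.anti (h1 i h0) (hvG ⟨⟨n, hn⟩, i⟩))
    -- Outside [lo, hi) the graded piece of F is zero and nothing has to be subtracted.
    · refine ⟨0, zero_mem _, ?_, by simpa using hx'⟩
      rw [sub_zero]
      rw [Finset.mem_Ico, not_and_or, not_le, not_lt] at hn
      rcases hn with hn | hn
      · have : F (n + 1) = ⊤ := top_le_iff.1 (hlo ▸ hF.anti (by omega))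
        rw [this]; trivial
      · have : F n = ⊥ := le_bot_iff.1 (hhi ▸ hF.anti hn)
        rw [this, Submodule.mem_bot] at hx
        rw [hx]; exact zero_mem _
  -- Iterating `step` raises the F-level until it reaches `hi`, where F vanishes. All corrections
  -- stay in G^y, so they only involve lifts of G-level at least y.
  have hspan (y : ℤ) (k : ℕ) : ∀ n, hi ≤ n + k → ∀ x, x ∈ F n → x ∈ G y →
      x ∈ Submodule.span ℂ ((fun j => (v j : V)) '' {j | n ≤ (j.1 : ℤ) ∧ y ≤ q j.1 j.2}) := by
    induction k with
    | zero =>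
      intro n hn x hx _
      have : F n = ⊥ := le_bot_iff.1 (hhi ▸ hF.anti (by simpa using hn))
      rw [this, Submodule.mem_bot] at hx
      rw [hx]; exact zero_mem _
    | succ k ih =>
      intro n hn x hx hx'
      obtain ⟨z, hz, h1, h2⟩ := step n y x hx hx'
      rw [← sub_add_cancel x z]
      refine Submodule.add_mem _ (Submodule.span_mono ?_ (ih (n + 1) (by push_cast at hn; omega) _ h1 h2)) hz
      exact Set.image_mono fun j hj => ⟨by have := hj.1; omega, hj.2⟩
  have hli : LinearIndependent ℂ (fun j => (v j : V)) := by
    rw [Fintype.linearIndependent_iff]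
    intro c hc
    -- the coefficients vanish by induction on the level
    have key (k : ℕ) : ∀ j : Σ n : Finset.Ico lo hi, Fin (r n), (j.1 : ℤ) < lo + k → c j = 0 := by
      induction k with
      | zero =>
        intro j hj
        have := (Finset.mem_Ico.1 j.1.2).1
        simp only [Nat.cast_zero, add_zero] at hj
        omega
      | succ k ih =>
        rintro ⟨⟨n, hn⟩, i⟩ hj
        by_cases hlt : n < lo + k
        · exact ih _ hlt
        have hnk : n = lo + k := by
          have hj : n < lo + (k + 1 : ℕ) := hj
          push_cast at hj
          omega
        -- In the relation, lower levels have zero coefficients by induction and higher levels lie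
        -- in F^{n+1}. So the part of level n is a relation among the basis `w n` of the graded
        -- piece.
        have hsum : (∑ i', c ⟨⟨n, hn⟩, i'⟩ • (v ⟨⟨n, hn⟩, i'⟩ : V)) ∈ F (n + 1) := by
          rw [Fintype.sum_sigma, ← Finset.add_sum_erase _ _ (Finset.mem_univ (⟨n, hn⟩ : Finset.Ico lo hi))] at hc
          rw [eq_neg_of_add_eq_zero_left hc]
          refine Submodule.neg_mem _ (Submodule.sum_mem _ fun n' hn' => Submodule.sum_mem _ fun i' _ => ?_)
          have hne : n' ≠ ⟨n, hn⟩ := (Finset.mem_erase.1 hn').1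
          have hne' : (n' : ℤ) ≠ n := fun h => hne (Subtype.ext h)
          by_cases h' : (n' : ℤ) < n
          · rw [ih ⟨n', i'⟩ (show (n' : ℤ) < lo + k from hnk ▸ h'), zero_smul]; exact zero_mem _
          · exact Submodule.smul_mem _ _ (hF.anti (show n + 1 ≤ (n' : ℤ) by omega) (v ⟨n', i'⟩).2)
        have hz : grMk F n (∑ i', c ⟨⟨n, hn⟩, i'⟩ • v ⟨⟨n, hn⟩, i'⟩) = 0 := by
          rw [grMk_eq_zero]
          convert hsum using 1
          simp
        rw [map_sum] at hz
        simp only [map_smul, hvw'] at hz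
        exact Fintype.linearIndependent_iff.1 (w n).linearIndependent _ hz i
    intro j
    refine key (hi - lo).toNat j ?_
    have := Finset.mem_Ico.1 j.1.2
    omega
  have htop : ⊤ ≤ Submodule.span ℂ (Set.range fun j => (v j : V)) := by
    obtain ⟨y, hy⟩ := hG.top
    intro x _
    refine Submodule.span_mono (Set.image_subset_range _ _)
      (hspan y (hi - lo).toNat lo (by omega) x (hlo ▸ trivial) (hy ▸ trivial))
  refine ⟨Module.Basis.mk hli htop, fun j => ?_, fun x y => ?_⟩
  · rw [Module.Basis.mk_apply]
    exact ⟨(v j).2, hvw j⟩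
  · rw [Module.Basis.coe_mk]
    apply le_antisymm
    · rintro z ⟨hz, hz'⟩
      exact hspan y (hi - x).toNat x (by omega) z hz hz'
    · rw [Submodule.span_le]
      rintro _ ⟨j, hj, rfl⟩
      exact ⟨hF.anti hj.1 (v j).2, hG.anti hj.2 (hvG j)⟩

theorem IsFiltration.exists_bounds (hF : IsFiltration F) :
    ∃ lo hi, F lo = ⊤ ∧ F hi = ⊥ := by
  obtain ⟨hi, hhi⟩ := hF.bot
  obtain ⟨lo, hlo⟩ := hF.top
  exact ⟨lo, hi, hlo, hhi⟩

theorem exists_splits [FiniteDimensional ℂ V] (hF : IsFiltration F) :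
    ∃ (r : ℕ) (b : Module.Basis (Fin r) ℂ V) (p : Fin r → ℤ), Splits F b p := by
  classical
  obtain ⟨lo, hi, hlo, hhi⟩ := hF.exists_bounds
  -- A filtration with its only jump at 0 imposes no condition, so arbitrary bases of the graded
  -- pieces can be lifted.
  let G : ℤ → Submodule ℂ V := fun y => if y ≤ 0 then ⊤ else ⊥
  have hG : IsFiltration G :=
    ⟨by
      intro x y h
      by_cases hy : y ≤ 0
      · simp [G, hy, h.trans hy]
      · simp [G, hy], ⟨1, by simp [G]⟩, ⟨0, by simp [G]⟩⟩
  obtain ⟨b, -, hb⟩ := exists_adapted_lift hF hG hlo hhi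
    (fun n => Module.finBasis ℂ (Gr F n)) (q := fun _ _ => 0) (by
      intro n y
      by_cases hy : y ≤ 0
      · have h2 : {j : Fin (Module.finrank ℂ (Gr F n)) | y ≤ 0} = Set.univ := by simp [hy]
        rw [h2, Set.image_univ, Module.Basis.span_eq, eq_top_iff]
        rintro w -
        obtain ⟨v, rfl⟩ := Submodule.mkQ_surjective _ w
        exact ⟨v, by simp [G, hy, Submodule.submoduleOf], rfl⟩
      · have h2 : {j : Fin (Module.finrank ℂ (Gr F n)) | y ≤ 0} = ∅ := by simp [hy]
        rw [h2, Set.image_empty, Submodule.span_empty, eq_bot_iff]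
        rintro _ ⟨v, hv, rfl⟩
        have h0 : (v : V) ∈ (if y ≤ 0 then ⊤ else ⊥ : Submodule ℂ V) := hv
        rw [if_neg hy, Submodule.mem_bot] at h0
        rw [Submodule.mem_bot, grMk_eq_zero, h0]
        exact zero_mem _)
  exact ⟨_, _, _, (hb.reindex (Fintype.equivFin _)).left hF hG⟩

/-- Split the filtration induced by G on each graded piece of F, then lift. For three filtrations
this fails in general, which is why opposedness and the line u_0 = 0 carry content. -/
theorem exists_adapted [FiniteDimensional ℂ V] (hF : IsFiltration F) (hG : IsFiltration G) :
    ∃ (r : ℕ) (b : Module.Basis (Fin r) ℂ V) (p q : Fin r → ℤ), IsAdapted F G b p q := by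
  classical
  obtain ⟨lo, hi, hlo, hhi⟩ := hF.exists_bounds
  have h (n : ℤ) := exists_splits (hG.grFiltration (F := F) n)
  choose r w q hq using h
  obtain ⟨b, -, hb⟩ := exists_adapted_lift hF hG hlo hhi w hq
  exact ⟨_, _, _, _, hb.reindex (Fintype.equivFin _)⟩

end Adapted

/-! ### Opposed filtrations in terms of adapted bases -/

section Opposed

variable {V : Type u} [AddCommGroup V] [Module ℂ V]

theorem subsingleton_gr_iff {F : ℤ → Submodule ℂ V} {n : ℤ} :
    Subsingleton (Gr F n) ↔ F n ≤ F (n + 1) := by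
  rw [Submodule.Quotient.subsingleton_iff, Submodule.submoduleOf, Submodule.comap_subtype_eq_top]

theorem subsingleton_gr_grFiltration_iff {F G : ℤ → Submodule ℂ V} {p q : ℤ} :
    Subsingleton (Gr (grFiltration G F q) p) ↔
      ∀ x, x ∈ F p → x ∈ G q → ∃ y, y ∈ F (p + 1) ∧ y ∈ G q ∧ x - y ∈ G (q + 1) := by
  rw [subsingleton_gr_iff]
  constructor
  · intro h x hx hx'
    obtain ⟨y, hy, hxy⟩ := h ⟨⟨x, hx'⟩, hx, rfl⟩
    refine ⟨y, hy, y.2, ?_⟩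
    have : grMk G q (⟨x, hx'⟩ - y) = 0 := by rw [map_sub, hxy, sub_self]
    rwa [grMk_eq_zero] at this
  · rintro h _ ⟨x, hx, rfl⟩
    obtain ⟨y, hy, hy', hxy⟩ := h x hx x.2
    refine ⟨⟨y, hy'⟩, hy, ?_⟩
    rw [eq_comm, ← sub_eq_zero, ← map_sub, grMk_eq_zero]
    exact hxy

/-- The classes of the basis vectors of bilevel exactly (x, y) form a basis of this double graded
piece. -/
theorem subsingleton_gr_grFiltration_iff_of_adapted {F G : ℤ → Submodule ℂ V} {J : Type*} [Fintype J]
    {b : Module.Basis J ℂ V} {p q : J → ℤ} (hF : IsFiltration F) (hG : IsFiltration G)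
    (h : IsAdapted F G b p q) {x y : ℤ} :
    Subsingleton (Gr (grFiltration G F y) x) ↔ ∀ j, ¬ (p j = x ∧ q j = y) := by
  rw [subsingleton_gr_grFiltration_iff]
  constructor
  · rintro H j ⟨rfl, rfl⟩
    obtain ⟨v, hv, hv', hbv⟩ := H (b j) (h.mem_left j) (h.mem_right j)
    have h1 : b.repr v j = 0 := by
      by_contra h0
      have := (h.left hF hG).mem_iff.1 hv j h0
      omega
    have h2 : b.repr (b j - v) j = 0 := by
      by_contra h0
      have := (h.right hF hG).mem_iff.1 hbv j h0
      omega
    rw [map_sub, Finsupp.sub_apply, h1, sub_zero, b.repr_self, Finsupp.single_eq_same] at h2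
    exact one_ne_zero h2
  · intro H v hv hv'
    classical
    have hvm := h.mem_iff.1 ⟨hv, hv'⟩
    have hsum (P : J → Prop) [DecidablePred P] :
        (∑ j with P j, b.repr v j • b j) + ∑ j with ¬ P j, b.repr v j • b j = v := by
      rw [Finset.sum_filter_add_sum_filter_not, b.sum_repr]
    have hterm (K : Submodule ℂ V) (P : J → Prop) [DecidablePred P]
        (hK : ∀ j, P j → b.repr v j ≠ 0 → b j ∈ K) : ∑ j with P j, b.repr v j • b j ∈ K := by
      refine Submodule.sum_mem _ fun j hj => ?_
      by_cases h0 : b.repr v j = 0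
      · rw [h0, zero_smul]; exact zero_mem _
      · exact Submodule.smul_mem _ _ (hK j (Finset.mem_filter.1 hj).2 h0)
    -- The part of v of F-level above x. What is left has F-level exactly x, hence G-level different
    -- from y, hence at least y + 1.
    refine ⟨∑ j with x + 1 ≤ p j, b.repr v j • b j, ?_, ?_, ?_⟩
    · exact hterm _ _ fun j hj _ => hF.anti hj (h.mem_left j)
    · exact hterm _ _ fun j _ h0 => hG.anti (hvm j h0).2 (h.mem_right j)
    · nth_rewrite 1 [← hsum fun j => x + 1 ≤ p j]
      rw [add_sub_cancel_left]
      refine hterm _ _ fun j hj h0 => hG.anti ?_ (h.mem_right j)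
      have := hvm j h0
      have := H j
      omega

variable {F₀ F₁ F₂ : ℤ → Submodule ℂ V}

/-- The levels (n, p, q) of the basis vectors are exactly the indices of the nonzero triple graded
pieces. -/
theorem opposed_iff_of_adapted (h₁ : IsFiltration F₁) (h₂ : IsFiltration F₂) {r : ℤ → ℕ}
    {w : ∀ n, Module.Basis (Fin (r n)) ℂ (Gr F₀ n)} {p q : ∀ n, Fin (r n) → ℤ}
    (h : ∀ n, IsAdapted (grFiltration F₀ F₁ n) (grFiltration F₀ F₂ n) (w n) (p n) (q n)) :
    Opposed F₀ F₁ F₂ ↔ ∀ n k, n + p n k + q n k = 0 := by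
  constructor
  · intro H n k
    by_contra hne
    have := (subsingleton_gr_grFiltration_iff_of_adapted (h₁.grFiltration n) (h₂.grFiltration n)
      (h n)).1 (H (p n k) (q n k) n (by omega)) k
    exact this ⟨rfl, rfl⟩
  · intro H x y n hne
    refine (subsingleton_gr_grFiltration_iff_of_adapted (h₁.grFiltration n) (h₂.grFiltration n)
      (h n)).2 ?_
    rintro k ⟨rfl, rfl⟩
    have := H n k
    omega

/-- A basis for each of the pairs `F₀, F₁` and `F₀, F₂`, such that the two bases have the same image in
the associated graded space for `F₀`. -/
theorem exists_triadapted [FiniteDimensional ℂ V] (h₀ : IsFiltration F₀) (h₁ : IsFiltration F₁)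
    (h₂ : IsFiltration F₂) :
    ∃ (r : ℕ) (b₁ b₂ : Module.Basis (Fin r) ℂ V) (n p q : Fin r → ℤ),
      IsAdapted F₀ F₁ b₁ n p ∧ IsAdapted F₀ F₂ b₂ n q ∧ (∀ j, b₁ j - b₂ j ∈ F₀ (n j + 1)) ∧
      (Opposed F₀ F₁ F₂ ↔ ∀ j, n j + p j + q j = 0) := by
  classical
  obtain ⟨lo, hi, hlo, hhi⟩ := h₀.exists_bounds
  -- On each graded piece of F₀ one basis splits both induced filtrations; it is lifted twice, once
  -- inside F₁ and once inside F₂.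
  have h (n : ℤ) := exists_adapted (h₁.grFiltration (F := F₀) n) (h₂.grFiltration (F := F₀) n)
  choose r w p q hw using h
  obtain ⟨b₁, hg₁, hb₁⟩ := exists_adapted_lift h₀ h₁ hlo hhi w
    (fun n => (hw n).left (h₁.grFiltration n) (h₂.grFiltration n))
  obtain ⟨b₂, hg₂, hb₂⟩ := exists_adapted_lift h₀ h₂ hlo hhi w
    (fun n => (hw n).right (h₁.grFiltration n) (h₂.grFiltration n))
  let e := Fintype.equivFin (Σ n : Finset.Ico lo hi, Fin (r n))
  refine ⟨_, b₁.reindex e, b₂.reindex e, _, _, _, hb₁.reindex e, hb₂.reindex e, ?_, ?_⟩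
  · intro j
    rw [Module.Basis.reindex_apply, Module.Basis.reindex_apply]
    obtain ⟨m₁, e₁⟩ := hg₁ (e.symm j)
    obtain ⟨m₂, e₂⟩ := hg₂ (e.symm j)
    have : grMk F₀ (e.symm j).1 (⟨_, m₁⟩ - ⟨_, m₂⟩) = 0 := by rw [map_sub, e₁, e₂, sub_self]
    rwa [grMk_eq_zero] at this
  · rw [opposed_iff_of_adapted h₁ h₂ hw]
    constructor
    · intro H j
      exact H _ _
    · intro H n k
      by_cases hn : n ∈ Finset.Ico lo hi
      · have hk := H (e ⟨⟨n, hn⟩, k⟩)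
        simp only [Function.comp_apply] at hk
        rwa [Equiv.symm_apply_apply] at hk
      · exfalso
        have : Subsingleton (Gr F₀ n) := by
          rw [subsingleton_gr_iff]
          rw [Finset.mem_Ico, not_and_or, not_le, not_lt] at hn
          rcases hn with hn | hn
          · exact le_top.trans (hlo ▸ h₀.anti (by omega))
          · exact (h₀.anti hn).trans (hhi ▸ bot_le)
        exact (w n).ne_zero k (Subsingleton.elim _ _)

/-- Opposedness on the graded piece of degree `n`: it is spanned by `F₁^p` and `F₂^{1-p-n}`. -/
theorem Opposed.exists_decomposition [FiniteDimensional ℂ V] (h₁ : IsFiltration F₁)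
    (h₂ : IsFiltration F₂) (h : Opposed F₀ F₁ F₂) (n p : ℤ) {x : V} (hx : x ∈ F₀ n) :
    ∃ y z, y ∈ F₁ p ∧ y ∈ F₀ n ∧ z ∈ F₂ (1 - p - n) ∧ z ∈ F₀ n ∧ x - (y + z) ∈ F₀ (n + 1) := by
  classical
  have H (n : ℤ) := exists_adapted (h₁.grFiltration (F := F₀) n) (h₂.grFiltration (F := F₀) n)
  choose r w s q hw using H
  have h0 := (opposed_iff_of_adapted h₁ h₂ hw).1 h
  let c := (w n).repr (grMk F₀ n ⟨x, hx⟩)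
  -- Vectors of F₁-level at least p go into y. The others have F₁-level at most p - 1, and
  -- opposedness gives them F₂-level at least 1 - p - n.
  have hy : (∑ j with p ≤ s n j, c j • w n j) ∈ grFiltration F₀ F₁ n p :=
    Submodule.sum_mem _ fun j hj => Submodule.smul_mem _ _
      ((h₁.grFiltration n).anti (Finset.mem_filter.1 hj).2 ((hw n).mem_left j))
  have hz : (∑ j with ¬ p ≤ s n j, c j • w n j) ∈ grFiltration F₀ F₂ n (1 - p - n) :=
    Submodule.sum_mem _ fun j hj => Submodule.smul_mem _ _
      ((h₂.grFiltration n).anti (by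
        have := h0 n j
        have := (Finset.mem_filter.1 hj).2
        omega) ((hw n).mem_right j))
  obtain ⟨y, hy, hy'⟩ := hy
  obtain ⟨z, hz, hz'⟩ := hz
  refine ⟨y, z, hy, y.2, hz, z.2, ?_⟩
  have : grMk F₀ n (⟨x, hx⟩ - (y + z)) = 0 := by
    rw [map_sub, map_add]
    erw [hy', hz']
    rw [Finset.sum_filter_add_sum_filter_not, (w n).sum_repr, sub_self]
  rwa [grMk_eq_zero] at this

/-- Opposedness on the graded piece of degree `n`: `F₁^p` and `F₂^q` meet trivially if
`p + q + n > 0`. -/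
theorem Opposed.mem_of_sub_mem [FiniteDimensional ℂ V] (h₁ : IsFiltration F₁)
    (h₂ : IsFiltration F₂) (h : Opposed F₀ F₁ F₂) {n p q : ℤ} (hpq : 0 < p + q + n) {x y : V}
    (hx : x ∈ F₀ n) (hx' : x ∈ F₁ p) (hy : y ∈ F₀ n) (hy' : y ∈ F₂ q) (hxy : x - y ∈ F₀ (n + 1)) :
    x ∈ F₀ (n + 1) := by
  have H (n : ℤ) := exists_adapted (h₁.grFiltration (F := F₀) n) (h₂.grFiltration (F := F₀) n)
  choose r w s t hw using H
  have h0 := (opposed_iff_of_adapted h₁ h₂ hw).1 h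
  have heq : grMk F₀ n ⟨x, hx⟩ = grMk F₀ n ⟨y, hy⟩ := by
    rw [← sub_eq_zero, ← map_sub, grMk_eq_zero]
    exact hxy
  -- A basis vector occurring in the common class of x and y would have levels of sum at least p + q
  -- + n > 0, against opposedness.
  have hm := (hw n).mem_iff.1 (⟨⟨_, hx', rfl⟩, heq ▸ ⟨_, hy', rfl⟩⟩ :
    grMk F₀ n ⟨x, hx⟩ ∈ grFiltration F₀ F₁ n p ∧ grMk F₀ n ⟨x, hx⟩ ∈ grFiltration F₀ F₂ n q)
  have : grMk F₀ n ⟨x, hx⟩ = 0 := by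
    rw [← (w n).repr.map_eq_zero_iff]
    ext j
    by_contra hj
    have := hm j hj
    have := h0 n j
    omega
  rwa [grMk_eq_zero] at this

end Opposed

end ReesPlane
end

noncomputable section
namespace ReesPlane

/-! ### Terms u^m v -/

section Term

variable {V : Type u} [AddCommGroup V] [Module ℂ V]

/-- The element `u^m v`. -/
def term (m : Lat (Fin 3)) : V →ₗ[ℂ] LaurentVec V := Finsupp.lsingle m

open Classical in
theorem term_coeff (m n : Lat (Fin 3)) (v : V) :
    (term m v).coeff n = if m = n then v else 0 := Finsupp.single_apply

theorem term_coeff_self (m : Lat (Fin 3)) (v : V) : (term m v).coeff m = v := by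
  rw [term_coeff, if_pos rfl]

theorem single_smul_term (a m : Lat (Fin 3)) (c : ℂ) (v : V) :
    (AddMonoidAlgebra.single a c : Laurent (Fin 3)) • term m v = term (a + m) (c • v) := by
  ext n
  obtain ⟨n, rfl⟩ : ∃ n', n = a + n' := ⟨-a + n, by abel⟩
  rw [LaurentVec.single_smul_coeff, term_coeff, term_coeff]
  simp only [add_right_inj, smul_ite, smul_zero]

theorem mono_smul_term (S : Chart (Fin 3)) (a m : Lat (Fin 3)) (ha) (c : ℂ) (v : V) :
    mono S a ha c • term m v = term (a + m) (c • v) := single_smul_term a m c v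

theorem coeff_sum {J : Type*} (s : Finset J) (x : J → LaurentVec V) (m : Lat (Fin 3)) :
    (∑ j ∈ s, x j).coeff m = ∑ j ∈ s, (x j).coeff m := by
  classical
  induction s using Finset.induction_on with
  | empty => rfl
  | insert a s ha ih => rw [Finset.sum_insert ha, Finset.sum_insert ha, LaurentVec.coeff_add, ih]

/-- The exponents that occur in an element. -/
def LaurentVec.support (x : LaurentVec V) : Finset (Lat (Fin 3)) :=
  Finsupp.support (show Lat (Fin 3) →₀ V from x)

theorem LaurentVec.mem_support {x : LaurentVec V} {m : Lat (Fin 3)} :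
    m ∈ x.support ↔ x.coeff m ≠ 0 := Finsupp.mem_support_iff

theorem LaurentVec.sum_term (x : LaurentVec V) : ∑ m ∈ x.support, term m (x.coeff m) = x :=
  Finsupp.sum_single (show Lat (Fin 3) →₀ V from x)

end Term

/-! ### The Rees module of three filtrations and its frames -/

section ReesSub

variable {V : Type u} [AddCommGroup V] [Module ℂ V] {F : Fin 3 → ℤ → Submodule ℂ V}

/-- The sections over `U_S` of the Rees module of three filtrations. -/
def reesSub (hF : ∀ i, IsFiltration (F i)) (S : Chart (Fin 3)) : Submodule (O S) (LaurentVec V) where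
  carrier := {x | ∀ m, ∀ i ∉ S.1, x.coeff m ∈ F i (-m.1 i)}
  zero_mem' := fun _ _ _ => Submodule.zero_mem _
  add_mem' := fun hx hy m i hi => Submodule.add_mem _ (hx m i hi) (hy m i hi)
  smul_mem' := by
    intro f x hx m i hi
    rw [LaurentVec.regular_smul, LaurentVec.smul_coeff]
    refine Submodule.sum_mem _ fun a ha => Submodule.smul_mem _ _ ?_
    have h := f.2 a (Finsupp.mem_support_iff.1 ha) i hi
    refine (hF i).anti ?_ (hx (m - a) i hi)
    show -m.1 i ≤ -(m.1 i - a.1 i)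
    omega

variable {hF : ∀ i, IsFiltration (F i)} {S : Chart (Fin 3)}

theorem mem_reesSub {x : LaurentVec V} :
    x ∈ reesSub hF S ↔ ∀ m, ∀ i ∉ S.1, x.coeff m ∈ F i (-m.1 i) := Iff.rfl

theorem term_mem_reesSub {m : Lat (Fin 3)} {v : V} :
    term m v ∈ reesSub hF S ↔ ∀ i ∉ S.1, v ∈ F i (-m.1 i) := by
  rw [mem_reesSub]
  constructor
  · intro h i hi
    have := h m i hi
    rwa [term_coeff_self] at this
  · intro h n i hi
    rw [term_coeff]
    split_ifs with hmn
    · exact hmn ▸ h i hi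
    · exact zero_mem _

/-- The basis `b` of `V` splits the filtrations `F_i`, `i ∉ S`, and `b j` has the level `-m_j(i)` for
`F_i`. -/
def SplitsOn (F : Fin 3 → ℤ → Submodule ℂ V) (S : Chart (Fin 3)) {J : Type*}
    (b : Module.Basis J ℂ V) (m : J → Lat (Fin 3)) : Prop :=
  ∀ (a : Lat (Fin 3)) (v : V), (∀ i ∉ S.1, v ∈ F i (-a.1 i)) ↔
    ∀ j, b.repr v j ≠ 0 → ∀ i ∉ S.1, (m j).1 i ≤ a.1 i

theorem SplitsOn.mem {J : Type*} {b : Module.Basis J ℂ V} {m : J → Lat (Fin 3)}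
    (h : SplitsOn F S b m) (j : J) : ∀ i ∉ S.1, b j ∈ F i (-(m j).1 i) := by
  classical
  refine (h (m j) (b j)).2 fun i hi => ?_
  rw [b.repr_self, Finsupp.single_apply] at hi
  have : j = i := by by_contra h'; exact hi (if_neg h')
  subst this
  exact fun _ _ => le_rfl

variable (hF) in
/-- The frame `u^{m_j} b_j` of the Rees module over `U_S`. -/
def SplitsOn.basis {J : Type*} [Fintype J] {b : Module.Basis J ℂ V} {m : J → Lat (Fin 3)}
    (h : SplitsOn F S b m) : Module.Basis J (O S) (reesSub hF S) :=
  Module.Basis.mk (v := fun j => (⟨term (m j) (b j), term_mem_reesSub.2 (h.mem j)⟩ : reesSub hF S))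
    (by
      rw [Fintype.linearIndependent_iff]
      intro f hf j
      apply toLaurent_injective
      apply AddMonoidAlgebra.ext
      ext n
      have h1 : ∑ j, f j • term (m j) (b j) = 0 := by
        have := congrArg (reesSub hF S).subtype hf
        simpa using this
      have h2 (n : Lat (Fin 3)) (j : J) : (f j • term (m j) (b j)).coeff n =
          (toLaurent S (f j)).coeff (n - m j) • b j := by
        classical
        show (toLaurent S (f j) • term (m j) (b j)).coeff n = _
        generalize toLaurent S (f j) = g
        induction g using AddMonoidAlgebra.induction_linear with
        | zero => rw [zero_smul]; simp [LaurentVec.coeff_zero]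
        | add f g hf hg => rw [add_smul, LaurentVec.coeff_add, hf, hg]; simp [add_smul]
        | single a c =>
          rw [single_smul_term, term_coeff, AddMonoidAlgebra.coeff_single, Finsupp.single_apply,
            ite_smul, zero_smul]
          simp only [eq_sub_iff_add_eq]
      -- In degree n + m_j the relation becomes one among the b's over ℂ, in which b_j has the
      -- coefficient of u^n in f_j.
      have h3 := congrArg (fun x => LaurentVec.coeff x (n + m j)) h1
      simp only [coeff_sum, h2, LaurentVec.coeff_zero] at h3
      have h4 := Fintype.linearIndependent_iff.1 b.linearIndependent _ h3 j
      simpa using h4)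
    (by
      rintro ⟨x, hx⟩ -
      suffices hmem : x ∈ (Submodule.span (O S) (Set.range fun j =>
          (⟨term (m j) (b j), term_mem_reesSub.2 (h.mem j)⟩ : reesSub hF S))).map
            (reesSub hF S).subtype by
        obtain ⟨y, hy, rfl⟩ := hmem
        exact hy
      rw [← x.sum_term]
      refine Submodule.sum_mem _ fun n _ => ?_
      rw [← b.sum_repr (x.coeff n), map_sum]
      refine Submodule.sum_mem _ fun j _ => ?_
      by_cases h0 : b.repr (x.coeff n) j = 0
      · rw [h0, zero_smul, map_zero]
        exact zero_mem _
      -- The level condition on the components of a section is exactly the regularity of u^{n - m_j}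
      -- on U_S.
      · refine ⟨mono S (n - m j)
          (fun i hi => sub_nonneg.2 ((h n (x.coeff n)).1 (hx n) j h0 i hi))
          (b.repr (x.coeff n) j) • ⟨term (m j) (b j), term_mem_reesSub.2 (h.mem j)⟩,
          Submodule.smul_mem _ _ (Submodule.subset_span ⟨j, rfl⟩), ?_⟩
        show mono S (n - m j) _ _ • term (m j) (b j) = _
        rw [mono_smul_term, sub_add_cancel])

theorem SplitsOn.basis_apply {J : Type*} [Fintype J] {b : Module.Basis J ℂ V}
    {m : J → Lat (Fin 3)} (h : SplitsOn F S b m) (j : J) :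
    (h.basis hF j : LaurentVec V) = term (m j) (b j) := by
  rw [SplitsOn.basis, Module.Basis.mk_apply]

/-- The exponent with given entries off the `k`-th one. -/
def chartExp (k : Fin 3) (l : Fin 3 → ℤ) : Lat (Fin 3) :=
  ⟨Function.update (fun i => -l i) k (∑ i ∈ {k}ᶜ, l i), by
    show ∑ i, _ = 0
    have h : ∑ i ∈ {k}ᶜ, Function.update (fun i => -l i) k (∑ i ∈ {k}ᶜ, l i) i =
        ∑ i ∈ {k}ᶜ, -l i := Finset.sum_congr rfl fun i hi =>
      Function.update_of_ne (by simpa using hi) (∑ i ∈ {k}ᶜ, l i) (fun i => -l i)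
    rw [Fintype.sum_eq_add_sum_compl k, h, Function.update_self, Finset.sum_neg_distrib,
      add_neg_cancel]⟩

theorem chartExp_of_ne {k i : Fin 3} (h : i ≠ k) (l : Fin 3 → ℤ) : (chartExp k l).1 i = -l i := by
  show Function.update (fun i => -l i) k (∑ i ∈ {k}ᶜ, l i) i = -l i
  rw [Function.update_of_ne h]

theorem chartExp_self (k : Fin 3) (l : Fin 3 → ℤ) : (chartExp k l).1 k = ∑ i ∈ {k}ᶜ, l i := by
  show Function.update (fun i => -l i) k (∑ i ∈ {k}ᶜ, l i) k = _
  rw [Function.update_self]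

theorem notMem_chart {k i : Fin 3} : i ∉ (chart k).1 ↔ i ≠ k := by simp [chart]

/-- Only two coordinates are non-invertible on U_k, so a basis adapted to the two corresponding
filtrations is enough. -/
theorem IsAdapted.splitsOn {k i i' : Fin 3} (hi : i ≠ k) (hi' : i' ≠ k) (hii' : i ≠ i')
    {J : Type*} {b : Module.Basis J ℂ V} {l : J → Fin 3 → ℤ}
    (h : IsAdapted (F i) (F i') b (fun j => l j i) fun j => l j i') :
    SplitsOn F (chart k) b fun j => chartExp k (l j) := by
  intro a v
  have hcov {P : Fin 3 → Prop} : (∀ s ∉ (chart k).1, P s) ↔ P i ∧ P i' := by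
    constructor
    · exact fun H => ⟨H i (notMem_chart.2 hi), H i' (notMem_chart.2 hi')⟩
    · rintro ⟨h1, h2⟩ s hs
      rw [notMem_chart] at hs
      have : s = i ∨ s = i' := by omega
      rcases this with rfl | rfl <;> assumption
  simp only [hcov, chartExp_of_ne hi, chartExp_of_ne hi', h.mem_iff, neg_le]

end ReesSub

/-- An identification of an `𝒪`-module with the Rees module of three filtrations. -/
structure ReesPresentation (E : ChartModule.{u} (Fin 3)) {V : Type u} [AddCommGroup V] [Module ℂ V]
    {F : Fin 3 → ℤ → Submodule ℂ V} (hF : ∀ i, IsFiltration (F i)) where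
  /-- sections as Laurent polynomials with coefficients in `V` -/
  equiv : ∀ S, E.sec S ≃ₗ[O S] reesSub hF S
  equiv_res : ∀ {S S'} (h : S ≤ S') (x : E.sec S),
    (equiv S' (E.res h x) : LaurentVec V) = equiv S x

namespace ReesPresentation

variable {E : ChartModule.{u} (Fin 3)} {V : Type u} [AddCommGroup V] [Module ℂ V]
  {F : Fin 3 → ℤ → Submodule ℂ V} {hF : ∀ i, IsFiltration (F i)} (R : ReesPresentation E hF)

theorem equiv_smul {S : Chart (Fin 3)} (f : O S) (x : E.sec S) :
    (R.equiv S (f • x) : LaurentVec V) = f • (R.equiv S x : LaurentVec V) := by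
  rw [map_smul]; rfl

theorem isQuasiCoherent (R : ReesPresentation E hF) : E.IsQuasiCoherent where
  surj := by
    classical
    intro S S' h y
    let x : LaurentVec V := R.equiv S' y
    have htop (i : Fin 3) := (hF i).top
    choose q hq using htop
    -- After multiplication by a monomial vanishing to order N, the step of F_i in which the
    -- coefficients have to lie is the whole of V.
    obtain ⟨N, hN⟩ : ∃ N : ℕ, ∀ m ∈ x.support, ∀ i, -(N + m.1 i) ≤ q i := by
      refine ⟨∑ m ∈ x.support, ∑ i, ((m.1 i).natAbs + (q i).natAbs), fun m hm i => ?_⟩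
      have h1 := Finset.single_le_sum
        (f := fun m : Lat (Fin 3) => ∑ i, ((m.1 i).natAbs + (q i).natAbs))
        (fun _ _ => Nat.zero_le _) hm
      have h2 := Finset.single_le_sum (f := fun i => (m.1 i).natAbs + (q i).natAbs)
        (fun _ _ => Nat.zero_le _) (Finset.mem_univ i)
      omega
    obtain ⟨b, hb', hb⟩ := exists_clearing_exponent (S := S) (S' := S') N
    have hbS' : ∀ i ∉ S'.1, b.1 i = 0 := fun i hi => hb' i hi fun h' => hi (h h')
    have hbS : ∀ i ∉ S.1, 0 ≤ b.1 i := by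
      intro i hi
      by_cases hi' : i ∈ S'.1
      · rw [hb i hi hi']; positivity
      · rw [hbS' i hi']
    have hmem : mono S b hbS 1 • x ∈ reesSub hF S := by
      intro m i hi
      obtain ⟨n, rfl⟩ : ∃ n, m = b + n := ⟨-b + m, by abel⟩
      rw [show (mono S b hbS 1 • x).coeff (b + n) = (1 : ℂ) • x.coeff n from
        LaurentVec.single_smul_coeff b 1 x n, one_smul]
      show _ ∈ F i (-(b.1 i + n.1 i))
      by_cases hi' : i ∈ S'.1
      · by_cases hn : n ∈ x.support
        · have : F i (-(b.1 i + n.1 i)) = ⊤ :=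
            top_le_iff.1 (hq i ▸ (hF i).anti (hb i hi hi' ▸ hN n hn i))
          rw [this]; trivial
        · rw [LaurentVec.mem_support, not_not] at hn
          rw [hn]; exact zero_mem _
      · rw [hbS' i hi', zero_add]
        exact (R.equiv S' y).2 n i hi'
    refine ⟨mono S b hbS 1, isUnit_mono S' b hbS' one_ne_zero, (R.equiv S).symm ⟨_, hmem⟩, ?_⟩
    apply (R.equiv S').injective
    apply Subtype.ext
    rw [R.equiv_res, LinearEquiv.apply_symm_apply, R.equiv_smul]
    rfl
  inj := by
    intro S S' h x hx
    refine ⟨1, by rw [map_one]; exact isUnit_one, ?_⟩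
    rw [one_smul]
    apply (R.equiv S).injective
    apply Subtype.ext
    rw [← R.equiv_res h, hx, map_zero, map_zero]
    rfl

/-- The frame of the module over `U_S` given by a splitting basis. -/
def basis {S : Chart (Fin 3)} {J : Type*} [Fintype J] {b : Module.Basis J ℂ V}
    {m : J → Lat (Fin 3)} (h : SplitsOn F S b m) : Module.Basis J (O S) (E.sec S) :=
  (h.basis hF).map (R.equiv S).symm

theorem equiv_basis {S : Chart (Fin 3)} {J : Type*} [Fintype J] {b : Module.Basis J ℂ V}
    {m : J → Lat (Fin 3)} (h : SplitsOn F S b m) (j : J) :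
    (R.equiv S (R.basis h j) : LaurentVec V) = term (m j) (b j) := by
  rw [basis, Module.Basis.map_apply, LinearEquiv.apply_symm_apply, h.basis_apply]

end ReesPresentation

/-! ### Rees modules are vector bundles; their degree -/

section Frames

variable {V : Type u} [AddCommGroup V] [Module ℂ V] {F : Fin 3 → ℤ → Submodule ℂ V}

theorem exists_splitsOn_chart [FiniteDimensional ℂ V] (hF : ∀ i, IsFiltration (F i)) (k : Fin 3) :
    ∃ (r : ℕ) (b : Module.Basis (Fin r) ℂ V) (l : Fin r → Fin 3 → ℤ),
      SplitsOn F (chart k) b (fun j => chartExp k (l j)) ∧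
      ∀ i ≠ k, Splits (F i) b fun j => l j i := by
  have hk : ∃ i i' : Fin 3, i ≠ k ∧ i' ≠ k ∧ i ≠ i' := by
    fin_cases k
    · exact ⟨1, 2, by decide, by decide, by decide⟩
    · exact ⟨0, 2, by decide, by decide, by decide⟩
    · exact ⟨0, 1, by decide, by decide, by decide⟩
  obtain ⟨i, i', hi, hi', hii'⟩ := hk
  obtain ⟨r, b, p, q, hb⟩ := exists_adapted (hF i) (hF i')
  let l : Fin r → Fin 3 → ℤ := fun j s => if s = i then p j else q j
  have hl : IsAdapted (F i) (F i') b (fun j => l j i) fun j => l j i' := by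
    simpa [l, hii'.symm] using hb
  refine ⟨r, b, l, hl.splitsOn hi hi' hii', fun s hs => ?_⟩
  have : s = i ∨ s = i' := by omega
  rcases this with rfl | rfl
  · exact hl.left (hF _) (hF _)
  · exact hl.right (hF _) (hF _)

theorem ReesPresentation.isVectorBundle [FiniteDimensional ℂ V] {E : ChartModule.{u} (Fin 3)}
    {hF : ∀ i, IsFiltration (F i)} (R : ReesPresentation E hF) : E.IsVectorBundle where
  quasiCoherent := R.isQuasiCoherent
  finite k := by
    obtain ⟨r, b, l, h, -⟩ := exists_splitsOn_chart hF k
    exact Module.Finite.of_basis (R.basis h)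
  projective k := by
    obtain ⟨r, b, l, h, -⟩ := exists_splitsOn_chart hF k
    exact Module.Projective.of_basis (R.basis h)

/-- A nonzero term in the expansion of the determinant of the base change gives a permutation σ such
that b_j has a nonzero component along b'_{σ j}, which forces p_j ≤ p'_{σ j}. With the converse
inequality, the degree of a filtration does not depend on the splitting. -/
theorem Splits.sum_le {G : ℤ → Submodule ℂ V} {J : Type*} [Fintype J]
    {b b' : Module.Basis J ℂ V} {p p' : J → ℤ} (h : Splits G b p) (h' : Splits G b' p') :
    ∑ j, p j ≤ ∑ j, p' j := by
  classical
  have hdet : (b'.toMatrix b).det ≠ 0 := by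
    have := b'.isUnit_det b
    rw [Module.Basis.det_apply] at this
    exact this.ne_zero
  rw [Matrix.det_apply] at hdet
  obtain ⟨σ, -, hσ⟩ := Finset.exists_ne_zero_of_sum_ne_zero hdet
  have hprod : ∏ j, b'.toMatrix b (σ j) j ≠ 0 := fun h0 => hσ (by rw [h0, smul_zero])
  rw [Finset.prod_ne_zero_iff] at hprod
  rw [← Equiv.sum_comp σ p']
  refine Finset.sum_le_sum fun j _ => ?_
  have hj : b j ∈ G (p j) := by
    rw [h]
    exact Submodule.subset_span ⟨j, le_refl (p j), rfl⟩
  exact h'.mem_iff.1 hj (σ j) (hprod j (Finset.mem_univ j))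

theorem Splits.sum_eq {G : ℤ → Submodule ℂ V} {J : Type*} [Fintype J]
    {b b' : Module.Basis J ℂ V} {p p' : J → ℤ} (h : Splits G b p) (h' : Splits G b' p') :
    ∑ j, p j = ∑ j, p' j := le_antisymm (h.sum_le h') (h'.sum_le h)

/-- The Rees module of three filtrations has the sum of their degrees as its degree. -/
theorem ReesPresentation.hasRankDegree {E : ChartModule.{u} (Fin 3)}
    {hF : ∀ i, IsFiltration (F i)} (R : ReesPresentation E hF) {r : ℕ}
    {b : Fin 3 → Module.Basis (Fin r) ℂ V} {l : Fin 3 → Fin r → Fin 3 → ℤ}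
    (h : ∀ k, SplitsOn F (chart k) (b k) fun j => chartExp k (l k j)) {δ : Fin 3 → ℤ}
    (hs : ∀ k, ∀ i ≠ k, Splits (F i) (b k) fun j => l k j i)
    (hδ : ∀ k, ∀ i ≠ k, ∑ j, l k j i = δ i) :
    E.HasRankDegree (fun _ => ⊤) r (∑ i, δ i) := by
  classical
  refine ⟨fun k => (R.basis (h k)).map Submodule.topEquiv.symm, fun k k' => ?_⟩
  let P : Matrix (Fin r) (Fin r) ℂ := (b k').toMatrix (b k)
  let m (k : Fin 3) (j : Fin r) : Lat (Fin 3) := chartExp k (l k j)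
  -- For s different from k and k', both bases split F_s, so a nonzero entry of P compares levels in
  -- the right direction.
  have hreg (i j : Fin r) (hP : P i j ≠ 0) (s : Fin 3) (hs' : s ∉ (overlap k k').1) :
      0 ≤ (m k j - m k' i).1 s := by
    have hsk : s ≠ k ∧ s ≠ k' := by simpa [overlap] using hs'
    have hmem : b k j ∈ F s (l k j s) := by
      rw [hs k s hsk.1]
      exact Submodule.subset_span ⟨j, le_refl (l k j s), rfl⟩
    have := (hs k' s hsk.2).mem_iff.1 hmem i hP
    show 0 ≤ (m k j).1 s - (m k' i).1 s
    rw [chartExp_of_ne hsk.1, chartExp_of_ne hsk.2]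
    omega
  -- The transition matrix is the constant matrix P between two diagonal matrices of monomials, so
  -- its determinant is det P times one monomial.
  let g : Matrix (Fin r) (Fin r) (O (overlap k k')) := fun i j =>
    if hP : P i j = 0 then 0 else mono _ (m k j - m k' i) (hreg i j hP) (P i j)
  have hg (i j : Fin r) : toLaurent _ (g i j) = AddMonoidAlgebra.single (m k j - m k' i) (P i j) := by
    by_cases hP : P i j = 0
    · simp only [g, dif_pos hP, map_zero, hP, AddMonoidAlgebra.single_zero]
    · simp only [g, dif_neg hP, toLaurent_mono]
  have hsum (k : Fin 3) : ∑ j, m k j = chartExp k δ := by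
    have hoff (s : Fin 3) (hsk : s ≠ k) : (∑ j, m k j : Lat (Fin 3)).1 s = -δ s := by
      rw [AddSubgroup.val_finsetSum, Finset.sum_apply]
      simp only [m, chartExp_of_ne hsk, Finset.sum_neg_distrib, hδ k s hsk]
    apply Subtype.ext
    funext s
    by_cases hsk : s = k
    · subst hsk
      have h1 : ∑ i, (∑ j, m s j : Lat (Fin 3)).1 i = 0 := (∑ j, m s j : Lat (Fin 3)).2
      rw [Fintype.sum_eq_add_sum_compl s, Finset.sum_congr rfl (g := fun i => -δ i)
        fun i hi => hoff i (by simpa using hi), Finset.sum_neg_distrib] at h1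
      rw [chartExp_self]
      omega
    · rw [hoff s hsk, chartExp_of_ne hsk]
  refine ⟨g, P.det, ?_, ?_, ?_⟩
  · have := (b k').isUnit_det (b k)
    rw [Module.Basis.det_apply] at this
    exact this.ne_zero
  · intro j
    apply (R.equiv _).injective
    apply Subtype.ext
    rw [R.equiv_res, map_sum, AddSubmonoidClass.coe_finsetSum]
    simp only [R.equiv_smul, R.equiv_res]
    have hb (k : Fin 3) (j : Fin r) : (R.equiv (chart k)
        ((((R.basis (h k)).map Submodule.topEquiv.symm) j : (⊤ : Submodule (O (chart k)) _)) :
          E.sec (chart k)) : LaurentVec V) = term (m k j) (b k j) := R.equiv_basis (h k) j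
    simp only [hb]
    have hterm (i : Fin r) : g i j • term (m k' i) (b k' i) = term (m k j) (P i j • b k' i) := by
      show toLaurent _ (g i j) • term (m k' i) (b k' i) = _
      rw [hg, single_smul_term, sub_add_cancel]
    simp only [hterm]
    rw [← map_sum]
    congr 1
    exact ((b k').sum_repr (b k j)).symm
  · apply toLaurent_injective
    rw [AlgHom.map_det]
    have hmat : (toLaurent (overlap k k')).mapMatrix g = Matrix.of fun i j =>
        AddMonoidAlgebra.single (m k j) (1 : ℂ) * (Matrix.of fun i j =>
          AddMonoidAlgebra.single (-m k' i) (1 : ℂ) * (algebraMap ℂ (Laurent (Fin 3))).mapMatrix P i j) i j := by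
      ext1 i j
      rw [AlgHom.mapMatrix_apply, Matrix.map_apply, hg]
      simp only [Matrix.of_apply, RingHom.mapMatrix_apply, Matrix.map_apply,
        AddMonoidAlgebra.coe_algebraMap, Function.comp_apply, AddMonoidAlgebra.single_mul_single,
        Algebra.algebraMap_self, RingHom.id_apply, one_mul, add_zero, sub_eq_add_neg]
    have hprod (f : Fin r → Lat (Fin 3)) : ∏ j, (AddMonoidAlgebra.single (f j) 1 : Laurent (Fin 3)) =
        AddMonoidAlgebra.single (∑ j, f j) 1 := by
      rw [AddMonoidAlgebra.prod_single]
      simp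
    rw [hmat, Matrix.det_mul_row, Matrix.det_mul_column, ← RingHom.map_det, hprod, hprod,
      Finset.sum_neg_distrib, hsum, hsum, AddMonoidAlgebra.coe_algebraMap]
    simp only [Function.comp_apply, AddMonoidAlgebra.single_mul_single,
        Algebra.algebraMap_self, RingHom.id_apply, one_mul, add_zero, overlapUnit, toLaurent_mono]
    congr 1
    apply Subtype.ext
    funext s
    show (chartExp k δ).1 s + -(chartExp k' δ).1 s =
      (∑ i, δ i) * ((Pi.single k 1 : Fin 3 → ℤ) s - (Pi.single k' 1 : Fin 3 → ℤ) s)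
    -- Only the k-th entry depends on the chart, so the difference for two charts is the total
    -- degree times the exponent of u_k / u_{k'}.
    have hval (k : Fin 3) : (chartExp k δ).1 s = -δ s + (∑ i, δ i) * (Pi.single k 1 : Fin 3 → ℤ) s := by
      by_cases hsk : s = k
      · subst hsk
        rw [chartExp_self, Pi.single_eq_same, Fintype.sum_eq_add_sum_compl s]
        ring
      · rw [chartExp_of_ne hsk, Pi.single_eq_of_ne hsk]
        ring
    rw [hval, hval]
    ring

end Frames

end ReesPlane
end

noncomputable section
namespace ReesPlane

/-! ### Maximal minors -/

section Minors

/-- A matrix over a domain with linearly independent columns has a nonzero maximal minor. -/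
theorem exists_det_submatrix_ne_zero {R : Type*} [CommRing R] [IsDomain R] {r s : ℕ}
    (B : Matrix (Fin r) (Fin s) R) (hB : LinearIndependent R B.col) :
    ∃ f : Fin s → Fin r, (B.submatrix f id).det ≠ 0 := by
  classical
  -- Over the fraction field, row rank equals column rank, so s of the rows are independent.
  let K := FractionRing R
  let A : Matrix (Fin r) (Fin s) K := B.map (algebraMap R K)
  have hA : LinearIndependent K A.col := by
    rw [← LinearIndependent.iff_fractionRing R K]
    have := hB.map' ((Algebra.linearMap R K).compLeft (Fin r))
      (LinearMap.ker_eq_bot.2 fun x y hxy => funext fun i =>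
        IsFractionRing.injective R K (congrFun hxy i))
    exact this
  have hrank : A.rank = s := by
    rw [← Matrix.rank_transpose]
    have := LinearIndependent.rank_matrix (M := A.transpose) hA
    simpa using this
  rw [Matrix.rank_eq_finrank_span_row] at hrank
  obtain ⟨f, hf, -, hli⟩ := Submodule.exists_fun_fin_finrank_span_eq K (Set.range A.row)
  choose g hg using hf
  let e : Fin s → Fin (Module.finrank K (Submodule.span K (Set.range A.row))) := Fin.cast hrank.symm
  refine ⟨fun i => g (e i), fun h0 => ?_⟩
  have hli' : LinearIndependent K (A.submatrix (fun i => g (e i)) id).row := by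
    have hrow : (A.submatrix (fun i => g (e i)) id).row = f ∘ e := funext fun i => hg (e i)
    rw [hrow]
    exact hli.comp e (Fin.cast_injective _)
  rw [Matrix.linearIndependent_rows_iff_isUnit, Matrix.isUnit_iff_isUnit_det] at hli'
  apply hli'.ne_zero
  have : A.submatrix (fun i => g (e i)) id =
      (algebraMap R K).mapMatrix (B.submatrix (fun i => g (e i)) id) := rfl
  rw [this, ← RingHom.map_det, h0, map_zero]

end Minors

/-! ### Split bundles and semistability on the projective line -/

section OverlapUnits

variable {ι : Type} [Fintype ι] [DecidableEq ι]

theorem toLaurent_overlapUnit (k l : ι) (d : ℤ) (c : ℂ) :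
    toLaurent _ (overlapUnit k l d c) = AddMonoidAlgebra.single (d • quotExp k l) c := rfl

theorem overlapUnit_self (k : ι) (d : ℤ) : overlapUnit k k d 1 = 1 := by
  apply toLaurent_injective
  rw [toLaurent_overlapUnit, map_one, AddMonoidAlgebra.one_def]
  congr 1
  have : quotExp k k = 0 := Subtype.ext (sub_self _)
  rw [this, smul_zero]

theorem overlapUnit_zero (k l : ι) : overlapUnit k l 0 1 = 1 := by
  apply toLaurent_injective
  rw [toLaurent_overlapUnit, map_one, AddMonoidAlgebra.one_def, zero_smul]

theorem prod_overlapUnit {J : Type*} [Fintype J] (k l : ι) (d : J → ℤ) :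
    ∏ j, overlapUnit k l (d j) 1 = overlapUnit k l (∑ j, d j) 1 := by
  apply toLaurent_injective
  rw [map_prod]
  simp only [toLaurent_overlapUnit]
  rw [AddMonoidAlgebra.prod_single, Finset.prod_const_one, Finset.sum_smul]

end OverlapUnits

/-- A nonzero transition function between functions on the two charts of the line which has the form
`c (u_0 / u_1)^d` has `d ≤ 0`. -/
theorem nonpos_of_transition {f : O (chart (0 : Fin 2))} {g : O (chart (1 : Fin 2))} {d : ℤ} {c : ℂ}
    (hf : f ≠ 0) (h : toLaurent _ f = toLaurent _ g * AddMonoidAlgebra.single (d • quotExp 0 1) c) :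
    d ≤ 0 := by
  have hf' : toLaurent _ f ≠ 0 := fun h0 => hf (toLaurent_injective _ (h0.trans (map_zero _).symm))
  obtain ⟨m, hm⟩ : ∃ m, (toLaurent _ f).coeff m ≠ 0 := by
    by_contra hcon
    push Not at hcon
    exact hf' (AddMonoidAlgebra.ext (Finsupp.ext hcon))
  -- A monomial of f has u_1-exponent at least 0. It is (u_0/u_1)^d times a monomial of g, which has
  -- u_0-exponent at least 0 and hence u_1-exponent at most 0.
  have h1 := toLaurent_coeff_nonneg f hm (i := 1) (by simp [chart])
  obtain ⟨n, rfl⟩ : ∃ n, m = n + d • quotExp 0 1 := ⟨m - d • quotExp 0 1, by abel⟩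
  rw [h, AddMonoidAlgebra.coeff_mul_single_add] at hm
  have h2 := toLaurent_coeff_nonneg g (left_ne_zero_of_mul hm) (i := 0) (by simp [chart])
  have h3 : ∑ i, n.1 i = 0 := n.2
  rw [Fin.sum_univ_two] at h3
  have h4 : (n + d • quotExp (0 : Fin 2) 1).1 1 = n.1 1 + d * (0 - 1) := rfl
  omega

/-- A splitting of an `𝒪`-module on the line into line bundles of degrees `d_j`. -/
structure LineSplitting (L : ChartModule.{u} (Fin 2)) {r : ℕ} (d : Fin r → ℤ) where
  /-- the frames -/
  frame : ∀ k, Module.Basis (Fin r) (O (chart k)) (L.sec (chart k))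
  res_frame : ∀ j, L.res (chart_le_left (0 : Fin 2) 1) (frame 0 j) =
    overlapUnit (0 : Fin 2) 1 (d j) 1 • L.res (chart_le_right (0 : Fin 2) 1) (frame 1 j)
  linearIndependent : LinearIndependent (O (overlap (0 : Fin 2) 1))
    fun j => L.res (chart_le_left (0 : Fin 2) 1) (frame 0 j)

namespace LineSplitting

variable {L : ChartModule.{u} (Fin 2)} {r : ℕ}

theorem res_eq_sum {S S' : Chart (Fin 2)} (h : S ≤ S') {J : Type*} [Fintype J]
    (b : Module.Basis J (O S) (L.sec S)) (x : L.sec S) :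
    L.res h x = ∑ i, resO h (b.repr x i) • L.res h (b i) := by
  conv_lhs => rw [← b.sum_repr x]
  rw [map_sum]
  simp only [L.res_smul]

/-- The transition matrix of a subsheaf of a trivial bundle on the line. -/
theorem map_toMatrix_eq (A : LineSplitting L (0 : Fin r → ℤ)) {s : ℕ}
    {v : ∀ k, Fin s → L.sec (chart k)} {g : Matrix (Fin s) (Fin s) (O (overlap (0 : Fin 2) 1))}
    (hg : ∀ j, L.res (chart_le_left (0 : Fin 2) 1) (v 0 j) = ∑ i, g i j • L.res (chart_le_right (0 : Fin 2) 1) (v 1 i)) :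
    ((A.frame 0).toMatrix (v 0)).map (resO (chart_le_left (0 : Fin 2) 1)) =
      ((A.frame 1).toMatrix (v 1)).map (resO (chart_le_right (0 : Fin 2) 1)) * g := by
  ext1 i j
  have hfr (i : Fin r) : L.res (chart_le_right (0 : Fin 2) 1) (A.frame 1 i) =
      L.res (chart_le_left (0 : Fin 2) 1) (A.frame 0 i) := by
    rw [A.res_frame, Pi.zero_apply, overlapUnit_zero, one_smul]
  have h1 := hg j
  rw [res_eq_sum _ (A.frame 0)] at h1
  have h2 : ∑ k, g k j • L.res (chart_le_right (0 : Fin 2) 1) (v 1 k) =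
      ∑ i, (((A.frame 1).toMatrix (v 1)).map (resO (chart_le_right (0 : Fin 2) 1)) * g) i j •
        L.res (chart_le_left (0 : Fin 2) 1) (A.frame 0 i) := by
    simp only [Matrix.mul_apply, Finset.sum_smul]
    rw [Finset.sum_comm]
    refine Finset.sum_congr rfl fun k _ => ?_
    rw [res_eq_sum _ (A.frame 1), Finset.smul_sum]
    refine Finset.sum_congr rfl fun i _ => ?_
    rw [hfr, smul_smul, mul_comm]
    rfl
  rw [h2, ← sub_eq_zero, ← Finset.sum_sub_distrib] at h1
  simp only [← sub_smul] at h1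
  exact sub_eq_zero.1 (Fintype.linearIndependent_iff.1 A.linearIndependent _ h1 i)

/-- For a subsheaf of degree d, a nonzero maximal minor of its frames is a nonzero global section of
𝒪(-d), so d ≤ 0. For the whole sheaf the determinants are units; applying the argument to their
inverses gives degree at least 0. The slopes compare through 0, also in rank 0. -/
theorem isSemistable (A : LineSplitting L (0 : Fin r → ℤ)) : L.IsSemistable := by
  classical
  rintro N - μ ν ⟨s, d, ⟨b, hb⟩, rfl⟩ ⟨s', d', ⟨b', hb'⟩, rfl⟩
  have hd : d ≤ 0 := by
    obtain ⟨g, c, hc, hg, hdet⟩ := hb 0 1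
    have hmat := (A.map_toMatrix_eq (v := fun k j => (b k j : L.sec (chart k))) hg)
    have hli : LinearIndependent (O (chart (0 : Fin 2))) ((A.frame 0).toMatrix
        fun j => (b 0 j : L.sec (chart 0))).col := by
      have h1 := ((b 0).linearIndependent.map' (N.sub (chart 0)).subtype (Submodule.ker_subtype _)).map'
        (A.frame 0).equivFun.toLinearMap (LinearEquiv.ker _)
      exact h1
    obtain ⟨f, hf⟩ := exists_det_submatrix_ne_zero _ hli
    refine nonpos_of_transition hf (c := c)
      (g := (((A.frame 1).toMatrix fun j => (b 1 j : L.sec (chart 1))).submatrix f id).det) ?_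
    have h2 := congrArg (fun M => (Matrix.submatrix M f id).det) hmat
    have h3 := congrArg (toLaurent _) h2
    rw [Matrix.submatrix_mul _ _ f id id Function.bijective_id, Matrix.submatrix_id_id, Matrix.det_mul, hdet, map_mul,
      toLaurent_overlapUnit] at h3
    rw [← toLaurent_resO (chart_le_left (0 : Fin 2) 1), ← toLaurent_resO (chart_le_right (0 : Fin 2) 1),
      RingHom.map_det, RingHom.map_det]
    exact h3
  have hd' : 0 ≤ d' := by
    obtain ⟨g, c, hc, hg, hdet⟩ := hb' 0 1
    have hmat := (A.map_toMatrix_eq (v := fun k j => (b' k j : L.sec (chart k))) hg)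
    obtain rfl : s' = r := by
      have := Fintype.card_congr (((b' 0).map Submodule.topEquiv).indexEquiv (A.frame 0))
      simpa using this
    have hunit (k : Fin 2) : IsUnit ((A.frame k).toMatrix
        fun j => (b' k j : L.sec (chart k))).det := by
      have := (A.frame k).isUnit_det ((b' k).map Submodule.topEquiv)
      rw [Module.Basis.det_apply] at this
      exact this
    obtain ⟨x, hx⟩ := (hunit 0).exists_right_inv
    obtain ⟨y, hy⟩ := (hunit 1).exists_right_inv
    have hx0 : x ≠ 0 := by
      rintro rfl
      rw [mul_zero] at hx
      exact zero_ne_one hx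
    have h3 := congrArg (fun M => toLaurent _ (Matrix.det M)) hmat
    simp only [Matrix.det_mul, hdet, map_mul, toLaurent_overlapUnit] at h3
    have e (k : Fin 2) (h : chart k ≤ overlap 0 1) (M : Matrix (Fin s') (Fin s') (O (chart k))) :
        toLaurent _ (M.map (resO h)).det = toLaurent _ M.det := by
      rw [← toLaurent_resO h, RingHom.map_det]; rfl
    rw [e, e] at h3
    have hx' := congrArg (toLaurent _) hx
    have hy' := congrArg (toLaurent _) hy
    rw [map_mul, map_one] at hx' hy'
    have hu : (AddMonoidAlgebra.single (d' • quotExp 0 1) c : Laurent (Fin 2)) *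
        AddMonoidAlgebra.single ((-d') • quotExp 0 1) c⁻¹ = 1 := by
      rw [AddMonoidAlgebra.single_mul_single, mul_inv_cancel₀ hc, ← add_smul, add_neg_cancel,
        zero_smul, AddMonoidAlgebra.one_def]
    have := nonpos_of_transition (g := y) (d := -d') (c := c⁻¹) hx0 (by
      rw [h3] at hx'
      linear_combination (toLaurent _ y * AddMonoidAlgebra.single ((-d') • quotExp 0 1) c⁻¹) * hx' -
        toLaurent _ x * hy' * (AddMonoidAlgebra.single (d' • quotExp 0 1) c *
          AddMonoidAlgebra.single ((-d') • quotExp 0 1) c⁻¹) - toLaurent _ x * hu)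
    omega
  exact (div_nonpos_of_nonpos_of_nonneg (by exact_mod_cast hd) (by positivity)).trans
    (div_nonneg (by exact_mod_cast hd') (by positivity))

variable {d : Fin r → ℤ} (A : LineSplitting L d)

theorem res_frame_eq (k l : Fin 2) (j : Fin r) : L.res (chart_le_left k l) (A.frame k j) =
    overlapUnit k l (d j) 1 • L.res (chart_le_right k l) (A.frame l j) := by
  by_cases hkl : k = l
  · subst hkl
    rw [overlapUnit_self, one_smul]
  have h01 : k = 0 ∧ l = 1 ∨ k = 1 ∧ l = 0 := by omega
  rcases h01 with ⟨rfl, rfl⟩ | ⟨rfl, rfl⟩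
  · exact A.res_frame j
  · have hle : overlap (0 : Fin 2) 1 ≤ overlap 1 0 := by decide
    have h1 := congrArg (L.res hle) (A.res_frame j)
    rw [L.res_smul, L.res_trans, L.res_trans] at h1
    rw [h1, smul_smul]
    have : overlapUnit 1 0 (d j) 1 * resO hle (overlapUnit (0 : Fin 2) 1 (d j) 1) = 1 := by
      apply toLaurent_injective
      rw [map_mul, toLaurent_resO, toLaurent_overlapUnit, toLaurent_overlapUnit,
        AddMonoidAlgebra.single_mul_single, map_one, AddMonoidAlgebra.one_def, mul_one, ← smul_add]
      have : quotExp (1 : Fin 2) 0 + quotExp 0 1 = 0 := Subtype.ext (sub_add_sub_cancel _ _ _ |>.trans (sub_self _))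
      rw [this, smul_zero]
    rw [this, one_smul]

/-- The subsheaf spanned by a subfamily of the frame. -/
def subsheaf {s : ℕ} (f : Fin s → Fin r) : L.CoherentSub where
  sub S := Submodule.span (O S) (⋃ i : Fin s, ⋃ k : Fin 2, ⋃ h : chart k ≤ S,
    {L.res h (A.frame k (f i))})
  res_mem {S S'} h x hx := by
    induction hx using Submodule.span_induction with
    | mem x hx =>
      simp only [Set.mem_iUnion, Set.mem_singleton_iff] at hx
      obtain ⟨i, k, hk, rfl⟩ := hx
      rw [L.res_trans]
      refine Submodule.subset_span ?_
      simp only [Set.mem_iUnion, Set.mem_singleton_iff]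
      exact ⟨i, k, hk.trans h, rfl⟩
    | zero => rw [map_zero]; exact zero_mem _
    | add x y _ _ hx hy => rw [map_add]; exact add_mem hx hy
    | smul a x _ hx => rw [L.res_smul]; exact Submodule.smul_mem _ _ hx
  res_span {S S'} h := by
    rw [Submodule.span_le]
    intro x hx
    simp only [Set.mem_iUnion, Set.mem_singleton_iff] at hx
    obtain ⟨i, k, hk, rfl⟩ := hx
    -- A generator coming from U_k need not live on U_S, but over U_{S'} it is a monomial multiple
    -- of the one from any U_l containing U_S.
    obtain ⟨l, hl⟩ := S.2
    have hlS : chart l ≤ S := Finset.singleton_subset_iff.2 hl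
    have hkl : overlap k l ≤ S' := by
      intro t ht
      have : t = k ∨ t = l := by simpa [overlap] using ht
      rcases this with rfl | rfl
      · exact hk (Finset.mem_singleton_self _)
      · exact h hl
    have h1 := congrArg (L.res hkl) (A.res_frame_eq k l (f i))
    rw [L.res_smul, L.res_trans, L.res_trans] at h1
    rw [h1]
    refine Submodule.smul_mem _ _ (Submodule.subset_span ⟨L.res hlS (A.frame l (f i)), ?_, ?_⟩)
    · refine Submodule.subset_span ?_
      simp only [Set.mem_iUnion, Set.mem_singleton_iff]
      exact ⟨i, l, hlS, rfl⟩
    · rw [L.res_trans]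
  fg S := Submodule.fg_span (Set.finite_iUnion fun _ => Set.finite_iUnion fun _ =>
    Set.finite_iUnion fun _ => Set.finite_singleton _)

theorem subsheaf_sub_chart {s : ℕ} (f : Fin s → Fin r) (k : Fin 2) :
    (A.subsheaf f).sub (chart k) = Submodule.span (O (chart k)) (Set.range fun i => A.frame k (f i)) := by
  show Submodule.span _ _ = _
  congr 1
  ext x
  simp only [Set.mem_iUnion, Set.mem_singleton_iff, Set.mem_range]
  constructor
  · rintro ⟨i, l, h, rfl⟩
    obtain rfl : l = k := Finset.mem_singleton.1 (h (Finset.mem_singleton_self l))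
    exact ⟨i, (L.res_refl _).symm⟩
  · rintro ⟨i, rfl⟩
    exact ⟨i, k, le_rfl, (L.res_refl _).symm⟩

/-- Rank and degree are read off from frames over the charts U_k alone. -/
theorem hasRankDegree_congr {ι : Type} [Fintype ι] [DecidableEq ι] {E : ChartModule.{u} ι}
    {N N' : ∀ S, Submodule (O S) (E.sec S)} (h : ∀ k, N (chart k) = N' (chart k)) {s : ℕ} {D : ℤ}
    (hN : E.HasRankDegree N s D) : E.HasRankDegree N' s D := by
  obtain ⟨b, hb⟩ := hN
  exact ⟨fun k => (b k).map (LinearEquiv.ofEq _ _ (h k)), hb⟩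

theorem hasRankDegree_subsheaf {s : ℕ} {f : Fin s → Fin r} (hf : Function.Injective f) :
    L.HasRankDegree (A.subsheaf f).sub s (∑ i, d (f i)) := by
  classical
  refine ⟨fun k => (Module.Basis.span ((A.frame k).linearIndependent.comp f hf)).map
    (LinearEquiv.ofEq _ _ (A.subsheaf_sub_chart f k).symm), fun k l =>
    ⟨Matrix.diagonal fun i => overlapUnit k l (d (f i)) 1, 1, one_ne_zero, fun j => ?_, ?_⟩⟩
  · have hb (k : Fin 2) (j : Fin s) : (((Module.Basis.span ((A.frame k).linearIndependent.comp f hf)).map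
        (LinearEquiv.ofEq _ _ (A.subsheaf_sub_chart f k).symm) j : (A.subsheaf f).sub (chart k)) :
          L.sec (chart k)) = A.frame k (f j) := by
      rw [Module.Basis.map_apply, LinearEquiv.coe_ofEq_apply, Module.Basis.span_apply]
      rfl
    simp only [hb]
    rw [Finset.sum_eq_single j]
    · rw [Matrix.diagonal_apply_eq, A.res_frame_eq]
    · intro i _ hij
      rw [Matrix.diagonal_apply_ne _ hij, zero_smul]
    · simp
  · rw [Matrix.det_diagonal, prod_overlapUnit]

theorem subsheaf_ne_bot {s : ℕ} (f : Fin s → Fin r) (i : Fin s) :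
    ∃ S, (A.subsheaf f).sub S ≠ ⊥ := by
  refine ⟨chart 0, fun h => (A.frame 0).ne_zero (f i) ?_⟩
  rw [subsheaf_sub_chart] at h
  have : A.frame 0 (f i) ∈ Submodule.span (O (chart (0 : Fin 2))) (Set.range fun i => A.frame 0 (f i)) :=
    Submodule.subset_span ⟨i, rfl⟩
  rwa [h, Submodule.mem_bot] at this

/-- A semistable bundle of slope `0` on the line has only summands of degree `0`. -/
theorem eq_zero_of_isSemistable {d : Fin r → ℤ} (A : LineSplitting L d) (hL : L.IsSemistable) (h0 : L.HasSlope (fun _ => ⊤) 0) (j : Fin r) :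
    d j = 0 := by
  -- The j-th summand is a line subbundle of slope d_j.
  have hle (j : Fin r) : d j ≤ 0 := by
    have := hL (A.subsheaf fun _ : Fin 1 => j) (A.subsheaf_ne_bot _ 0) _ 0
      ⟨1, _, A.hasRankDegree_subsheaf (Function.injective_of_subsingleton _), rfl⟩ h0
    simpa using this
  have htop (k : Fin 2) : (A.subsheaf id).sub (chart k) = ⊤ := by
    rw [subsheaf_sub_chart]
    exact (A.frame k).span_eq
  obtain ⟨s, D, hD, hsD⟩ := h0
  -- Semistability applied to the full subsheaf compares the given slope 0 with the slope computed
  -- from the splitting, so well-definedness of the degree need not be proved.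
  have hge := hL (A.subsheaf id) (A.subsheaf_ne_bot id j) 0 _
    ⟨s, D, hasRankDegree_congr (fun k => (htop k).symm) hD, hsD⟩
    ⟨r, _, hasRankDegree_congr htop (A.hasRankDegree_subsheaf Function.injective_id), rfl⟩
  have hr : (0 : ℚ) < r := by exact_mod_cast j.pos
  have hsum : 0 ≤ ∑ i, d i := by
    rw [le_div_iff₀ hr, zero_mul] at hge
    exact_mod_cast hge
  have := (Finset.sum_eq_zero_iff_of_nonpos fun i _ => hle i).1
    (le_antisymm (Finset.sum_nonpos fun i _ => hle i) hsum)
  exact this j (Finset.mem_univ j)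

end LineSplitting

end ReesPlane
end

noncomputable section
namespace ReesPlane

/-! ### Restriction to the line u_0 = 0 -/

section RestrictLine

theorem planeChart_chart (k : Fin 2) : planeChart (chart k) = chart k.succ := rfl

theorem succ_mem_planeChart {S : Chart (Fin 2)} {i : Fin 2} :
    i.succ ∈ (planeChart S).1 ↔ i ∈ S.1 :=
  Finset.mem_map' (Fin.succEmb 2)

theorem overlap_le_planeChart (k l : Fin 2) : overlap k.succ l.succ ≤ planeChart (overlap k l) := by
  intro i hi
  have : i = k.succ ∨ i = l.succ := by simpa [overlap] using hi
  rcases this with rfl | rfl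
  · exact succ_mem_planeChart.2 (by simp [overlap])
  · exact succ_mem_planeChart.2 (by simp [overlap])

theorem lineRes_mono (S : Chart (Fin 2)) (m : Lat (Fin 2)) (hm hm') (c : ℂ) :
    lineRes S (mono (planeChart S) (extendExp m) hm c) = mono S m hm' c := by
  classical
  apply toLaurent_injective
  apply AddMonoidAlgebra.ext
  ext n
  show (AddMonoidAlgebra.single (extendExp m) c).coeff (extendExp n) =
    (AddMonoidAlgebra.single m c).coeff n
  simp only [AddMonoidAlgebra.coeff_single, Finsupp.single_apply, extendExp_injective.eq_iff]

theorem lineRes_mono_of_ne_zero (S : Chart (Fin 2)) (m : Lat (Fin 3)) (hm) (c : ℂ)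
    (h : m.1 0 ≠ 0) : lineRes S (mono (planeChart S) m hm c) = 0 := by
  classical
  apply toLaurent_injective
  apply AddMonoidAlgebra.ext
  ext n
  show (AddMonoidAlgebra.single m c).coeff (extendExp n) = 0
  rw [AddMonoidAlgebra.coeff_single, Finsupp.single_apply, if_neg]
  rintro rfl
  exact h rfl

theorem extendExp_zsmul_quotExp (d : ℤ) (k l : Fin 2) :
    extendExp (d • quotExp k l) = d • quotExp k.succ l.succ := by
  apply Subtype.ext
  funext i
  refine Fin.cases ?_ (fun j => ?_) i
  · show (0 : ℤ) = d * ((Pi.single k.succ 1 : Fin 3 → ℤ) 0 - (Pi.single l.succ 1 : Fin 3 → ℤ) 0)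
    rw [Pi.single_eq_of_ne (Fin.succ_ne_zero k).symm, Pi.single_eq_of_ne (Fin.succ_ne_zero l).symm]
    simp
  · show d * ((Pi.single k 1 : Fin 2 → ℤ) j - (Pi.single l 1 : Fin 2 → ℤ) j) =
      d * ((Pi.single k.succ 1 : Fin 3 → ℤ) j.succ - (Pi.single l.succ 1 : Fin 3 → ℤ) j.succ)
    simp only [Pi.single_apply, Fin.succ_inj]

/-- The pullback to the line of a section. -/
def lineMk (E : ChartModule.{u} (Fin 3)) (S : Chart (Fin 2)) :
    E.sec (planeChart S) →+ E.restrictLine.sec S :=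
  (TensorProduct.mk (O (planeChart S)) (O S) (E.sec (planeChart S)) 1).toAddMonoidHom

variable {E : ChartModule.{u} (Fin 3)}

theorem lineMk_smul {S : Chart (Fin 2)} (f : O (planeChart S)) (x : E.sec (planeChart S)) :
    lineMk E S (f • x) = lineRes S f • lineMk E S x := by
  show TensorProduct.tmul _ _ _ = (lineRes S f • TensorProduct.tmul (O (planeChart S)) (1 : O S) x :
    TensorProduct (O (planeChart S)) (O S) (E.sec (planeChart S)))
  rw [TensorProduct.tmul_smul, TensorProduct.smul_tmul', TensorProduct.smul_tmul']
  rfl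

theorem res_lineMk {S S' : Chart (Fin 2)} (h : S ≤ S') (x : E.sec (planeChart S)) :
    E.restrictLine.res h (lineMk E S x) = lineMk E S' (E.res (planeChart_mono h) x) := by
  show lineResMap E h (TensorProduct.tmul _ 1 x) = TensorProduct.tmul _ _ _
  rw [lineResMap_tmul, map_one]

/-- The pullback to the line of a frame. -/
def lineBasis {S : Chart (Fin 2)} {J : Type*}
    (b : Module.Basis J (O (planeChart S)) (E.sec (planeChart S))) :
    Module.Basis J (O S) (E.restrictLine.sec S) :=
  Algebra.TensorProduct.basis (O S) b

theorem lineBasis_apply {S : Chart (Fin 2)} {J : Type*}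
    (b : Module.Basis J (O (planeChart S)) (E.sec (planeChart S))) (j : J) :
    lineBasis b j = lineMk E S (b j) := Algebra.TensorProduct.basis_apply b j

/-- Rank and degree of a bundle on the plane are those of its restriction to the line. -/
theorem hasRankDegree_restrictLine {r : ℕ} {d : ℤ}
    (h : E.HasRankDegree (fun _ => ⊤) r d) : E.restrictLine.HasRankDegree (fun _ => ⊤) r d := by
  classical
  obtain ⟨b, hb⟩ := h
  let b' (k : Fin 3) : Module.Basis (Fin r) (O (chart k)) (E.sec (chart k)) :=
    (b k).map Submodule.topEquiv
  let β (k : Fin 2) : Module.Basis (Fin r) (O (planeChart (chart k))) (E.sec (planeChart (chart k))) :=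
    b' k.succ
  refine ⟨fun k => (lineBasis (β k)).map Submodule.topEquiv.symm, fun k l => ?_⟩
  obtain ⟨g, c, hc, hg, hdet⟩ := hb k.succ l.succ
  let φ : O (overlap k.succ l.succ) →+* O (overlap k l) :=
    (lineRes _).comp (resO (overlap_le_planeChart k l))
  refine ⟨φ.mapMatrix g, c, hc, fun j => ?_, ?_⟩
  · show E.restrictLine.res _ (lineBasis (β k) j) = ∑ i, φ.mapMatrix g i j •
      E.restrictLine.res _ (lineBasis (β l) i)
    simp only [lineBasis_apply, res_lineMk]
    have h1 := congrArg (E.res (overlap_le_planeChart k l)) (hg j)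
    rw [map_sum, E.res_trans] at h1
    simp only [E.res_smul, E.res_trans] at h1
    have h2 : E.res (planeChart_mono (chart_le_left k l)) (β k j) = ∑ i,
        resO (overlap_le_planeChart k l) (g i j) •
          E.res (planeChart_mono (chart_le_right k l)) (β l i) := h1
    rw [h2, map_sum]
    exact Finset.sum_congr rfl fun i _ => lineMk_smul _ _
  · rw [← RingHom.map_det, hdet]
    show lineRes _ (resO (overlap_le_planeChart k l) (overlapUnit k.succ l.succ d c)) = _
    rw [overlapUnit, resO_mono, mono_congr _ (extendExp_zsmul_quotExp d k l).symm]
    exact lineRes_mono _ _ _ _ _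

theorem hasSlope_restrictLine {μ : ℚ}
    (h : E.HasSlope (fun _ => ⊤) μ) : E.restrictLine.HasSlope (fun _ => ⊤) μ := by
  obtain ⟨r, d, hr, rfl⟩ := h
  exact ⟨r, d, hasRankDegree_restrictLine hr, rfl⟩

end RestrictLine

/-! ### Opposedness and semistability on the line -/

section SplitLine

variable {V : Type u} [AddCommGroup V] [Module ℂ V] {F : Fin 3 → ℤ → Submodule ℂ V}
  {hF : ∀ i, IsFiltration (F i)} {E : ChartModule.{u} (Fin 3)}

/-- The source of the degree: frame vectors over U_1 and U_2 with the same three levels differ by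
(u_1/u_2) to the power of the sum of the levels. -/
theorem chartExp_one (l : Fin 3 → ℤ) :
    chartExp 1 l = (∑ i, l i) • quotExp 1 2 + chartExp 2 l := by
  apply Subtype.ext
  funext s
  show (chartExp 1 l).1 s = (∑ i, l i) * ((Pi.single 1 1 : Fin 3 → ℤ) s -
    (Pi.single 2 1 : Fin 3 → ℤ) s) + (chartExp 2 l).1 s
  have e1 : ({1}ᶜ : Finset (Fin 3)) = {0, 2} := by decide
  have e2 : ({2}ᶜ : Finset (Fin 3)) = {0, 1} := by decide
  rw [Fin.sum_univ_three]
  fin_cases s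
  · simp [chartExp_of_ne (k := 1) (i := 0) (by decide), chartExp_of_ne (k := 2) (i := 0) (by decide)]
  · simp [chartExp_self, chartExp_of_ne (k := 2) (i := 1) (by decide), e1]
    ring
  · simp [chartExp_self, chartExp_of_ne (k := 1) (i := 2) (by decide), e2]
    ring

/-- The restriction to the line of the Rees module splits, with one summand of degree `n + p + q` for
each vector of levels `n, p, q` in the associated graded space for `F₀`. -/
theorem ReesPresentation.exists_lineSplitting (R : ReesPresentation E hF) {r : ℕ}
    {b₁ b₂ : Module.Basis (Fin r) ℂ V} {n p q : Fin r → ℤ} (h₁ : IsAdapted (F 0) (F 1) b₁ n p)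
    (h₂ : IsAdapted (F 0) (F 2) b₂ n q) (h : ∀ j, b₁ j - b₂ j ∈ F 0 (n j + 1)) :
    Nonempty (LineSplitting E.restrictLine fun j => n j + p j + q j) := by
  let l (j : Fin r) : Fin 3 → ℤ := ![n j, p j, q j]
  have hl (j : Fin r) : ∑ i, l j i = n j + p j + q j := by rw [Fin.sum_univ_three]; rfl
  -- The line's chart 0 is cut out by U_1, where F₀ and F₂ impose conditions; its chart 1 is cut out
  -- by U_2, where F₀ and F₁ do.
  let b : Fin 2 → Module.Basis (Fin r) ℂ V := ![b₂, b₁]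
  have hb (k : Fin 2) : SplitsOn F (planeChart (chart k)) (b k) fun j => chartExp k.succ (l j) := by
    rw [planeChart_chart]
    fin_cases k
    · exact IsAdapted.splitsOn (k := 1) (i := 0) (i' := 2) (by decide) (by decide) (by decide) h₂
    · exact IsAdapted.splitsOn (k := 2) (i := 0) (i' := 1) (by decide) (by decide) (by decide) h₁
  have hP : ∀ i, i ∉ (planeChart (overlap (0 : Fin 2) 1)).1 ↔ i = 0 := by decide
  have hbP : SplitsOn F (planeChart (overlap (0 : Fin 2) 1)) b₂ fun j => chartExp 1 (l j) := by
    intro a v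
    simp only [hP, forall_eq, chartExp_of_ne (k := 1) (i := 0) (by decide)]
    rw [(h₂.left (hF 0) (hF 2)).mem_iff]
    exact forall_congr' fun j => imp_congr_right fun _ => neg_le
  have he (k : Fin 2) (j : Fin r) {S : Chart (Fin 2)} (h : chart k ≤ S) :
      E.restrictLine.res h (lineBasis (R.basis (hb k)) j) =
        lineMk E S (E.res (planeChart_mono h) (R.basis (hb k) j)) := by
    rw [lineBasis_apply, res_lineMk]
  refine ⟨⟨fun k => lineBasis (R.basis (hb k)), fun j => ?_, ?_⟩⟩
  · rw [he, he]
    let P := planeChart (overlap (0 : Fin 2) 1)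
    have hreg1 : ∀ i ∉ P.1, 0 ≤ ((∑ i, l j i) • quotExp (1 : Fin 3) 2).1 i := by
      intro i hi
      obtain rfl := (hP i).1 hi
      show 0 ≤ (∑ i, l j i) * ((Pi.single 1 1 : Fin 3 → ℤ) 0 - (Pi.single 2 1 : Fin 3 → ℤ) 0)
      simp
    have hreg2 : ∀ i ∉ P.1, 0 ≤ (quotExp (0 : Fin 3) 1).1 i := by
      intro i hi
      obtain rfl := (hP i).1 hi
      decide
    -- Since b₂ j - b₁ j lies one step deeper in F₀, the discrepancy between the two frames is
    -- divisible by u_0/u_1 on the overlap and dies on the line.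
    have hz : term (chartExp 1 (l j) - quotExp 0 1) (b₂ j - b₁ j) ∈ reesSub hF P := by
      rw [term_mem_reesSub]
      intro i hi
      obtain rfl := (hP i).1 hi
      have : -(chartExp 1 (l j) - quotExp (0 : Fin 3) 1).1 0 = n j + 1 := by
        show -((chartExp 1 (l j)).1 0 - (1 - 0)) = _
        rw [chartExp_of_ne (by decide)]
        show -(-n j - (1 - 0)) = _
        ring
      rw [this, ← neg_sub]
      exact Submodule.neg_mem _ (h j)
    have hx : E.res (planeChart_mono (chart_le_left (0 : Fin 2) 1)) (R.basis (hb 0) j) =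
        mono P _ hreg1 1 •
          E.res (planeChart_mono (chart_le_right (0 : Fin 2) 1)) (R.basis (hb 1) j) +
        mono P _ hreg2 1 • (R.equiv P).symm ⟨_, hz⟩ := by
      apply (R.equiv P).injective
      apply Subtype.ext
      rw [map_add, Submodule.coe_add, R.equiv_smul, R.equiv_smul, R.equiv_res, R.equiv_res,
        R.equiv_basis, R.equiv_basis, LinearEquiv.apply_symm_apply]
      show term (chartExp 1 (l j)) (b₂ j) = mono P _ hreg1 1 • term (chartExp 2 (l j)) (b₁ j) +
        mono P _ hreg2 1 • term _ (b₂ j - b₁ j)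
      rw [mono_smul_term, mono_smul_term, ← chartExp_one, add_sub_cancel, ← map_add, one_smul,
        one_smul, add_sub_cancel]
    rw [hx, map_add, lineMk_smul, lineMk_smul,
      lineRes_mono_of_ne_zero _ (quotExp 0 1) _ _ (by decide), zero_smul, add_zero]
    congr 1
    have h1 := mono_congr P ((congrArg (· • quotExp (1 : Fin 3) 2) (hl j)).trans
      (extendExp_zsmul_quotExp (n j + p j + q j) 0 1).symm) hreg1 1
    rw [h1]
    exact lineRes_mono _ _ _ _ _
  -- On the overlap only F₀ imposes a condition, and b₂ still splits it, so the restricted frame is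
  -- again a frame.
  · have heq : (fun j => E.restrictLine.res (chart_le_left (0 : Fin 2) 1)
        (lineBasis (R.basis (hb 0)) j)) = lineBasis (R.basis hbP) := by
      funext j
      rw [he, lineBasis_apply]
      congr 1
      apply (R.equiv _).injective
      apply Subtype.ext
      rw [R.equiv_res, R.equiv_basis, R.equiv_basis]
      rfl
    rw [heq]
    exact (lineBasis (R.basis hbP)).linearIndependent

/-- The Rees module of three opposed filtrations is a bundle which is semistable of slope `0` on the
line. -/
theorem ReesPresentation.isSemistable [FiniteDimensional ℂ V] (R : ReesPresentation E hF)
    (h : Opposed (F 0) (F 1) (F 2)) : E.restrictLine.IsSemistable := by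
  obtain ⟨r, b₁, b₂, n, p, q, h₁, h₂, h₃, hopp⟩ := exists_triadapted (hF 0) (hF 1) (hF 2)
  obtain ⟨A⟩ := R.exists_lineSplitting h₁ h₂ h₃
  rw [show (fun j => n j + p j + q j) = 0 from funext (hopp.1 h)] at A
  exact A.isSemistable

/-- The degree is the sum of the degrees of the three filtrations. Each can be computed in the bases
adapted to F₀, F₁ or to F₀, F₂, where the contributions n_j + p_j + q_j vanish one by one. -/
theorem ReesPresentation.hasSlope [FiniteDimensional ℂ V] (R : ReesPresentation E hF)
    (h : Opposed (F 0) (F 1) (F 2)) : E.HasSlope (fun _ => ⊤) 0 := by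
  obtain ⟨r, b₁, b₂, n, p, q, h₁, h₂, h₃, hopp⟩ := exists_triadapted (hF 0) (hF 1) (hF 2)
  have hch (k : Fin 3) : ∃ (b : Module.Basis (Fin r) ℂ V) (l : Fin r → Fin 3 → ℤ),
      SplitsOn F (chart k) b (fun j => chartExp k (l j)) ∧
      ∀ i ≠ k, Splits (F i) b fun j => l j i := by
    obtain ⟨r', b, l, hb⟩ := exists_splitsOn_chart hF k
    obtain rfl : r' = r := by
      have := Fintype.card_congr (b.indexEquiv b₁)
      simpa using this
    exact ⟨b, l, hb⟩
  choose b l hb hs using hch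
  let δ : Fin 3 → ℤ := ![∑ j, n j, ∑ j, p j, ∑ j, q j]
  have hδ : ∑ i, δ i = 0 := by
    rw [Fin.sum_univ_three]
    show ∑ j, n j + ∑ j, p j + ∑ j, q j = 0
    rw [← Finset.sum_add_distrib, ← Finset.sum_add_distrib]
    exact Finset.sum_eq_zero fun j _ => hopp.1 h j
  refine ⟨r, 0, ?_, by simp⟩
  rw [← hδ]
  refine R.hasRankDegree hb hs fun k i hi => ?_
  fin_cases i
  · exact (hs k 0 hi).sum_eq (h₁.left (hF 0) (hF 1))
  · exact (hs k 1 hi).sum_eq (h₁.right (hF 0) (hF 1))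
  · exact (hs k 2 hi).sum_eq (h₂.right (hF 0) (hF 2))

/-- If the Rees module of three filtrations is semistable of slope `0` on the line, then the
filtrations are opposed. -/
theorem ReesPresentation.opposed [FiniteDimensional ℂ V] (R : ReesPresentation E hF)
    (h : E.restrictLine.IsSemistable) (h0 : E.HasSlope (fun _ => ⊤) 0) :
    Opposed (F 0) (F 1) (F 2) := by
  obtain ⟨r, b₁, b₂, n, p, q, h₁, h₂, h₃, hopp⟩ := exists_triadapted (hF 0) (hF 1) (hF 2)
  obtain ⟨A⟩ := R.exists_lineSplitting h₁ h₂ h₃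
  exact hopp.2 (A.eq_zero_of_isSemistable h (hasSlope_restrictLine h0))

end SplitLine

end ReesPlane
end

noncomputable section
namespace ReesPlane

/-! ### Deligne's functorial splittings and strictness -/

section Strictness

variable {V : Type u} [AddCommGroup V] [Module ℂ V] {F₀ F₁ F₂ : ℤ → Submodule ℂ V}

theorem Opposed.swap [FiniteDimensional ℂ V] (h₁ : IsFiltration F₁) (h₂ : IsFiltration F₂)
    (h : Opposed F₀ F₁ F₂) : Opposed F₀ F₂ F₁ := by
  have H (n : ℤ) := exists_adapted (h₁.grFiltration (F := F₀) n) (h₂.grFiltration (F := F₀) n)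
  choose r w p q hw using H
  rw [opposed_iff_of_adapted h₂ h₁ fun n => (hw n).symm]
  intro n k
  have := (opposed_iff_of_adapted h₁ h₂ hw).1 h n k
  omega

/-- For opposed filtrations, a complement of `F₁^p ∩ F₀^n` in `F₀^n` which depends functorially on the
filtrations. -/
def oppositeSpace (F₀ F₂ : ℤ → Submodule ℂ V) (p n : ℤ) : Submodule ℂ V :=
  ⨆ m, ⨆ _ : n ≤ m, F₂ (1 - p - m) ⊓ F₀ m

theorem oppositeSpace_anti {p n n' : ℤ} (h : n ≤ n') :
    oppositeSpace F₀ F₂ p n' ≤ oppositeSpace F₀ F₂ p n :=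
  iSup_mono fun _ => iSup_mono' fun hm => ⟨h.trans hm, le_rfl⟩

theorem oppositeSpace_le (h₀ : IsFiltration F₀) (p n : ℤ) : oppositeSpace F₀ F₂ p n ≤ F₀ n :=
  iSup₂_le fun _ hm => inf_le_right.trans (h₀.anti hm)

theorem le_oppositeSpace (p n : ℤ) : F₂ (1 - p - n) ⊓ F₀ n ≤ oppositeSpace F₀ F₂ p n :=
  le_iSup₂_of_le n le_rfl le_rfl

theorem oppositeSpace_eq_sup (p n : ℤ) :
    oppositeSpace F₀ F₂ p n = (F₂ (1 - p - n) ⊓ F₀ n) ⊔ oppositeSpace F₀ F₂ p (n + 1) := by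
  apply le_antisymm
  · refine iSup₂_le fun m hm => ?_
    rcases hm.eq_or_lt with rfl | hlt
    · exact le_sup_left
    · exact le_sup_of_le_right (le_iSup₂_of_le m (by omega) le_rfl)
  · exact sup_le (le_oppositeSpace p n) (oppositeSpace_anti (by omega))

/-- The space `I^{p,q}` of Deligne's bigrading, for `q = -p - n`: a functorial lift to `F₁^p ∩ F₀^n` of
the part of type `(p, q)` of `Gr_{F₀}^n`. -/
def deligneSpace (F₀ F₁ F₂ : ℤ → Submodule ℂ V) (p n : ℤ) : Submodule ℂ V :=
  (F₁ p ⊓ F₀ n) ⊓ ((F₂ (-p - n) ⊓ F₀ n) ⊔ oppositeSpace F₀ F₂ p (n + 2))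

variable {V' : Type u} [AddCommGroup V'] [Module ℂ V'] {F₀' F₁' F₂' : ℤ → Submodule ℂ V'}
  (f : V →ₗ[ℂ] V')

theorem map_mem_oppositeSpace (f₀ : ∀ p, ∀ v ∈ F₀ p, f v ∈ F₀' p) (f₂ : ∀ p, ∀ v ∈ F₂ p, f v ∈ F₂' p)
    {p n : ℤ} {x : V} (hx : x ∈ oppositeSpace F₀ F₂ p n) : f x ∈ oppositeSpace F₀' F₂' p n := by
  have : oppositeSpace F₀ F₂ p n ≤ (oppositeSpace F₀' F₂' p n).comap f :=
    iSup₂_le fun m hm v hv => Submodule.mem_comap.2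
      ((le_iSup₂_of_le (f := fun m (_ : n ≤ m) => F₂' (1 - p - m) ⊓ F₀' m) m hm le_rfl)
        ⟨f₂ _ _ hv.1, f₀ _ _ hv.2⟩)
  exact this hx

theorem map_mem_deligneSpace (f₀ : ∀ p, ∀ v ∈ F₀ p, f v ∈ F₀' p) (f₁ : ∀ p, ∀ v ∈ F₁ p, f v ∈ F₁' p)
    (f₂ : ∀ p, ∀ v ∈ F₂ p, f v ∈ F₂' p) {p n : ℤ} {x : V} (hx : x ∈ deligneSpace F₀ F₁ F₂ p n) :
    f x ∈ deligneSpace F₀' F₁' F₂' p n := by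
  refine ⟨⟨f₁ _ _ hx.1.1, f₀ _ _ hx.1.2⟩, ?_⟩
  obtain ⟨y, hy, z, hz, rfl⟩ := Submodule.mem_sup.1 hx.2
  rw [map_add]
  exact Submodule.add_mem_sup ⟨f₂ _ _ hy.1, f₀ _ _ hy.2⟩ (map_mem_oppositeSpace f f₀ f₂ hz)

variable [FiniteDimensional ℂ V] [FiniteDimensional ℂ V']

/-- On Gr of degree n the leading part of x lies in F₁^p and in F₂^{1-p-n}, whose indices have total
1 > 0, so it vanishes. Thus x moves up in F₀ until it reaches 0. -/
theorem Opposed.eq_zero_of_mem (h₀ : IsFiltration F₀) (h₁ : IsFiltration F₁) (h₂ : IsFiltration F₂)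
    (h : Opposed F₀ F₁ F₂) {p n : ℤ} {x : V} (hx : x ∈ F₁ p) (hx' : x ∈ oppositeSpace F₀ F₂ p n) :
    x = 0 := by
  obtain ⟨hi, hhi⟩ := h₀.bot
  have key (k : ℕ) : ∀ n, hi ≤ n + k → ∀ x, x ∈ F₁ p → x ∈ oppositeSpace F₀ F₂ p n → x = 0 := by
    induction k with
    | zero =>
      intro n hn x _ hx'
      have := h₀.anti (by simpa using hn) (oppositeSpace_le h₀ p n hx')
      rwa [hhi, Submodule.mem_bot] at this
    | succ k ih =>
      intro n hn x hx hx'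
      have hxn := oppositeSpace_le h₀ p n hx'
      rw [oppositeSpace_eq_sup] at hx'
      obtain ⟨y, ⟨hy2, hy0⟩, z, hz, rfl⟩ := Submodule.mem_sup.1 hx'
      have hz0 := oppositeSpace_le h₀ p (n + 1) hz
      have hy : y ∈ F₀ (n + 1) := by
        have hm := h.mem_of_sub_mem h₁ h₂ (n := n) (p := p) (q := 1 - p - n) (by omega) hxn hx hy0 hy2
          (by simpa using hz0)
        simpa using Submodule.sub_mem _ hm hz0
      refine ih (n + 1) (by push_cast at hn; omega) _ hx (Submodule.add_mem _ ?_ hz)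
      exact le_oppositeSpace p (n + 1) ⟨h₂.anti (by omega) hy2, hy⟩
  exact key (hi - n).toNat n (by omega) x hx hx'

/-- The spanning half of complementarity: decompose on the top graded piece and repeat with the
remainder in F₀^{n+1}. -/
theorem Opposed.exists_add_eq (h₀ : IsFiltration F₀) (h₁ : IsFiltration F₁) (h₂ : IsFiltration F₂)
    (h : Opposed F₀ F₁ F₂) (p : ℤ) {n : ℤ} {x : V} (hx : x ∈ F₀ n) :
    ∃ y z, y ∈ F₁ p ∧ y ∈ F₀ n ∧ z ∈ oppositeSpace F₀ F₂ p n ∧ y + z = x := by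
  obtain ⟨hi, hhi⟩ := h₀.bot
  have key (k : ℕ) : ∀ n, hi ≤ n + k → ∀ x, x ∈ F₀ n →
      ∃ y z, y ∈ F₁ p ∧ y ∈ F₀ n ∧ z ∈ oppositeSpace F₀ F₂ p n ∧ y + z = x := by
    induction k with
    | zero =>
      intro n hn x hx
      have := h₀.anti (by simpa using hn) hx
      rw [hhi, Submodule.mem_bot] at this
      exact ⟨0, 0, zero_mem _, zero_mem _, zero_mem _, by rw [this, add_zero]⟩
    | succ k ih =>
      intro n hn x hx
      obtain ⟨y, z, hy1, hy0, hz2, hz0, hs⟩ := h.exists_decomposition h₁ h₂ n p hx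
      obtain ⟨y', z', hy1', hy0', hz', hs'⟩ := ih (n + 1) (by push_cast at hn; omega) _ hs
      refine ⟨y + y', z + z', add_mem hy1 hy1', add_mem hy0 (h₀.anti (by omega) hy0'), add_mem
        (le_oppositeSpace p n ⟨hz2, hz0⟩) (oppositeSpace_anti (by omega) hz'), ?_⟩
      rw [add_add_add_comm, hs', add_sub_cancel]
  exact key (hi - n).toNat n (by omega) x hx

/-- The lift is injective into Gr of degree n: inside F₀^{n+1} its elements belong to the complement
of F₁^p, since -p - n = 1 - p - (n + 1). -/
theorem Opposed.eq_zero_of_mem_deligneSpace (h₀ : IsFiltration F₀) (h₁ : IsFiltration F₁)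
    (h₂ : IsFiltration F₂) (h : Opposed F₀ F₁ F₂) {p n : ℤ} {x : V}
    (hx : x ∈ deligneSpace F₀ F₁ F₂ p n) (hx' : x ∈ F₀ (n + 1)) : x = 0 := by
  obtain ⟨⟨hx1, -⟩, hx2⟩ := hx
  obtain ⟨y, ⟨hy2, hy0⟩, z, hz, rfl⟩ := Submodule.mem_sup.1 hx2
  have hz' := oppositeSpace_anti (F₀ := F₀) (F₂ := F₂) (p := p) (show n + 1 ≤ n + 2 by omega) hz
  have hy : y ∈ F₀ (n + 1) := by
    simpa using Submodule.sub_mem _ hx' (oppositeSpace_le h₀ p _ hz')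
  refine h.eq_zero_of_mem h₀ h₁ h₂ hx1 (n := n + 1) (add_mem (le_oppositeSpace p (n + 1) ⟨?_, hy⟩) hz')
  exact h₂.anti (by omega) hy2

/-- Modulo deeper steps of F₁ and of F₀, every element of F₁^p ∩ F₀^n comes from the bigraded lift;
this drives the induction for strictness. -/
theorem Opposed.exists_deligne_decomposition (h₀ : IsFiltration F₀) (h₁ : IsFiltration F₁)
    (h₂ : IsFiltration F₂) (h : Opposed F₀ F₁ F₂) {p n : ℤ} {x : V} (hx1 : x ∈ F₁ p)
    (hx0 : x ∈ F₀ n) :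
    ∃ x₁ i a, x₁ ∈ F₁ (p + 1) ∧ x₁ ∈ F₀ n ∧ i ∈ deligneSpace F₀ F₁ F₂ p n ∧ a ∈ F₀ (n + 1) ∧
      x = x₁ + i + a := by
  obtain ⟨x₁, x₂, hx11, hx10, hx2, rfl⟩ := h.exists_add_eq h₀ h₁ h₂ (p + 1) hx0
  have hx20 := oppositeSpace_le h₀ _ _ hx2
  have hx21 : x₂ ∈ F₁ p := by
    simpa using Submodule.sub_mem _ hx1 (h₁.anti (by omega : p ≤ p + 1) hx11)
  rw [oppositeSpace_eq_sup] at hx2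
  obtain ⟨y, ⟨hy2, hy0⟩, z, hz, rfl⟩ := Submodule.mem_sup.1 hx2
  -- The tail z belongs to the complement for p + 1, not for p. Splitting it with respect to F₁^p
  -- moves the excess a into F₀^{n+1} and leaves a tail of the shape that `deligneSpace` requires.
  obtain ⟨a, b, ha1, ha0, hb, rfl⟩ := h.exists_add_eq h₀ h₁ h₂ p (oppositeSpace_le h₀ _ _ hz)
  rw [oppositeSpace_eq_sup, show n + 1 + 1 = n + 2 by ring] at hb
  obtain ⟨b₁, ⟨hb12, hb10⟩, b₂, hb2, rfl⟩ := Submodule.mem_sup.1 hb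
  have hi : y + b₁ + b₂ = y + (a + (b₁ + b₂)) - a := by abel
  refine ⟨x₁, y + b₁ + b₂, a, hx11, hx10, ⟨?_, ?_⟩, ha0, by abel⟩
  · rw [hi]
    exact ⟨sub_mem hx21 ha1, sub_mem hx20 (h₀.anti (by omega) ha0)⟩
  · refine Submodule.add_mem_sup (add_mem ⟨h₂.anti (by omega) hy2, hy0⟩
      ⟨h₂.anti (by omega) hb12, h₀.anti (by omega) hb10⟩) hb2

/-- In Gr of degree n, i has a representative in F₂^{-p-n} while x lies in F₁^{p+1}. The indices
have total 1, so the classes cannot cancel unless both vanish. -/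
theorem Opposed.mem_of_add_deligne_mem (h₀ : IsFiltration F₀) (h₁ : IsFiltration F₁)
    (h₂ : IsFiltration F₂) (h : Opposed F₀ F₁ F₂) {p n : ℤ} {x i : V} (hx1 : x ∈ F₁ (p + 1))
    (hx0 : x ∈ F₀ n) (hi : i ∈ deligneSpace F₀ F₁ F₂ p n) (hxi : x + i ∈ F₀ (n + 1)) :
    i ∈ F₀ (n + 1) := by
  obtain ⟨-, hi2⟩ := hi
  obtain ⟨y, ⟨hy2, hy0⟩, z, hz, rfl⟩ := Submodule.mem_sup.1 hi2
  have hz0 := h₀.anti (show n + 1 ≤ n + 2 by omega) (oppositeSpace_le h₀ _ _ hz)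
  have hxm : x ∈ F₀ (n + 1) := by
    refine h.mem_of_sub_mem h₁ h₂ (n := n) (p := p + 1) (q := -p - n) (by omega) hx0 hx1
      (neg_mem hy0) (neg_mem hy2) ?_
    have := sub_mem hxi hz0
    convert this using 1
    abel
  simpa using sub_mem hxi hxm

/-- Morphisms of opposed filtrations are strict for the first filtration. -/
theorem Opposed.strict_zero (h₀ : IsFiltration F₀) (h₁ : IsFiltration F₁) (h₂ : IsFiltration F₂)
    (h : Opposed F₀ F₁ F₂) (h₀' : IsFiltration F₀') (h₁' : IsFiltration F₁') (h₂' : IsFiltration F₂')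
    (h' : Opposed F₀' F₁' F₂') (f₀ : ∀ p, ∀ v ∈ F₀ p, f v ∈ F₀' p)
    (f₁ : ∀ p, ∀ v ∈ F₁ p, f v ∈ F₁' p) (f₂ : ∀ p, ∀ v ∈ F₂ p, f v ∈ F₂' p) {n : ℤ} {x : V}
    (hx : f x ∈ F₀' n) : ∃ x' ∈ F₀ n, f x' = f x := by
  obtain ⟨hi, hhi⟩ := h₁.bot
  obtain ⟨lo, hlo⟩ := h₁.top
  obtain ⟨lo₀, hlo₀⟩ := h₀.top
  have step (k : ℕ) : ∀ p n, hi ≤ p + k → ∀ x, x ∈ F₁ p → x ∈ F₀ n → f x ∈ F₀' (n + 1) →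
      ∃ x' ∈ F₀ (n + 1), f x' = f x := by
    induction k with
    | zero =>
      intro p n hp x hx _ _
      have := h₁.anti (by simpa using hp) hx
      rw [hhi, Submodule.mem_bot] at this
      exact ⟨x, this ▸ zero_mem _, rfl⟩
    | succ k ih =>
      intro p n hp x hx1 hx0 hfx
      obtain ⟨x₁, i, a, hx11, hx10, hi', ha, rfl⟩ := h.exists_deligne_decomposition h₀ h₁ h₂ hx1 hx0
      have hfi := map_mem_deligneSpace f f₀ f₁ f₂ hi'
      have hsum : f x₁ + f i ∈ F₀' (n + 1) := by
        have := sub_mem hfx (f₀ _ _ ha)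
        simpa using this
      -- By functoriality f i lies in the bigraded lift of the target. As it also lies in F₀'^{n+1},
      -- it vanishes, and i can be dropped from x without changing the image.
      have hfi0 := h'.eq_zero_of_mem_deligneSpace h₀' h₁' h₂' hfi
        (h'.mem_of_add_deligne_mem h₀' h₁' h₂' (f₁ _ _ hx11) (f₀ _ _ hx10) hfi hsum)
      obtain ⟨x', hx', hfx'⟩ := ih (p + 1) n (by push_cast at hp; omega) x₁ hx11 hx10
        (by simpa [hfi0] using hsum)
      exact ⟨x' + a, add_mem hx' ha, by simp [hfx', hfi0]⟩
  have raise (k : ℕ) : ∀ m, n ≤ m + k → ∀ x, x ∈ F₀ m → f x ∈ F₀' n →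
      ∃ x' ∈ F₀ n, f x' = f x := by
    induction k with
    | zero =>
      intro m hm x hx _
      exact ⟨x, h₀.anti (by simpa using hm) hx, rfl⟩
    | succ k ih =>
      intro m hm x hx hfx
      by_cases hmn : n ≤ m
      · exact ⟨x, h₀.anti hmn hx, rfl⟩
      · obtain ⟨x', hx', hfx'⟩ := step (hi - lo).toNat lo m (by omega) x (hlo ▸ trivial) hx
          (h₀'.anti (by omega) hfx)
        obtain ⟨x'', hx'', hfx''⟩ := ih (m + 1) (by push_cast at hm; omega) x' hx' (hfx' ▸ hfx)
        exact ⟨x'', hx'', hfx''.trans hfx'⟩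
  exact raise (n - lo₀).toNat lo₀ (by omega) x (hlo₀ ▸ trivial) hx

/-- Morphisms of opposed filtrations are strict for the second filtration, even within a step of the
first one. -/
theorem Opposed.strict_one (h₀ : IsFiltration F₀) (h₁ : IsFiltration F₁) (h₂ : IsFiltration F₂)
    (h : Opposed F₀ F₁ F₂) (h₀' : IsFiltration F₀') (h₁' : IsFiltration F₁') (h₂' : IsFiltration F₂')
    (h' : Opposed F₀' F₁' F₂') (f₀ : ∀ p, ∀ v ∈ F₀ p, f v ∈ F₀' p)
    (f₁ : ∀ p, ∀ v ∈ F₁ p, f v ∈ F₁' p) (f₂ : ∀ p, ∀ v ∈ F₂ p, f v ∈ F₂' p) {n p : ℤ} {x : V}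
    (hx0 : x ∈ F₀ n) (hx : f x ∈ F₁' p) : ∃ x', x' ∈ F₀ n ∧ x' ∈ F₁ p ∧ f x' = f x := by
  obtain ⟨y, z, hy1, hy0, hz, rfl⟩ := h.exists_add_eq h₀ h₁ h₂ p hx0
  have hz1 : f z ∈ F₁' p := by
    have := sub_mem hx (f₁ _ _ hy1)
    simpa using this
  -- f z lies in F₁'^p and in its functorial complement.
  have hz0 := h'.eq_zero_of_mem h₀' h₁' h₂' hz1 (map_mem_oppositeSpace f f₀ f₂ hz)
  exact ⟨y, hy0, hy1, by rw [map_add, hz0, add_zero]⟩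

/-- In the cokernel of a morphism of opposed filtrations, the images of the first two filtrations meet
in the image of their intersection. -/
theorem Opposed.exists_mem_inf_of_sub_eq (h₀ : IsFiltration F₀) (h₁ : IsFiltration F₁)
    (h₂ : IsFiltration F₂) (h : Opposed F₀ F₁ F₂) (h₀' : IsFiltration F₀') (h₁' : IsFiltration F₁')
    (h₂' : IsFiltration F₂') (h' : Opposed F₀' F₁' F₂') (f₀ : ∀ p, ∀ v ∈ F₀ p, f v ∈ F₀' p)
    (f₁ : ∀ p, ∀ v ∈ F₁ p, f v ∈ F₁' p) (f₂ : ∀ p, ∀ v ∈ F₂ p, f v ∈ F₂' p) {n p : ℤ} {y y' : V'}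
    {x : V} (hy : y ∈ F₀' n) (hy' : y' ∈ F₁' p) (hx : y - y' = f x) :
    ∃ z w, z ∈ F₀' n ∧ z ∈ F₁' p ∧ y - z = f w := by
  obtain ⟨lo, hlo⟩ := h₀.top
  obtain ⟨x₁, x₂, hx11, -, hx2, rfl⟩ := h.exists_add_eq h₀ h₁ h₂ p (hlo ▸ trivial : x ∈ F₀ lo)
  obtain ⟨y₁, y₂, hy11, hy10, hy2, rfl⟩ := h'.exists_add_eq h₀' h₁' h₂' p hy
  have heq : y₂ - f x₂ = y' + f x₁ - y₁ := by
    rw [map_add] at hx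
    rw [sub_eq_iff_eq_add] at hx ⊢
    have : y₂ = f x₁ + f x₂ + y' - y₁ := by rw [← hx]; abel
    rw [this]; abel
  have hzero : y₂ - f x₂ = 0 := by
    -- The two complements start at different levels of F₀; the minimum contains both.
    refine h'.eq_zero_of_mem h₀' h₁' h₂' (n := min n lo) (p := p) ?_ (sub_mem
      (oppositeSpace_anti (min_le_left _ _) hy2)
      (oppositeSpace_anti (min_le_right _ _) (map_mem_oppositeSpace f f₀ f₂ hx2)))
    rw [heq]
    exact sub_mem (add_mem hy' (f₁ _ _ hx11)) hy11
  exact ⟨y₁, x₂, hy10, hy11, by rw [← sub_eq_zero.1 hzero]; abel⟩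

end Strictness

end ReesPlane
end

noncomputable section
namespace ReesPlane

/-! ### Free loci by comparison with a free module -/

section FreeLocus

/-- A module is free at a prime at which it is isomorphic to a free module. -/
theorem mem_freeLocus_of_locally_bijective {R M N : Type*} [CommRing R] [AddCommGroup M] [Module R M]
    [AddCommGroup N] [Module R N] [Module.Free R N] (φ : M →ₗ[R] N) (p : PrimeSpectrum R)
    (surj : ∀ y, ∃ s ∉ p.asIdeal, ∃ x, φ x = s • y)
    (inj : ∀ x, φ x = 0 → ∃ s ∉ p.asIdeal, s • x = 0) : p ∈ Module.freeLocus R M := by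
  let S := p.asIdeal.primeCompl
  let ψ := LocalizedModule.mkLinearMap S N
  -- Since φ is bijective up to elements outside p, the localization of N also serves as the
  -- localization of M.
  have : IsLocalizedModule S (ψ ∘ₗ φ) :=
    { map_units := IsLocalizedModule.map_units ψ
      surj := by
        intro y
        obtain ⟨⟨z, s⟩, hz⟩ := IsLocalizedModule.surj S ψ y
        obtain ⟨t, ht, x, hx⟩ := surj z
        refine ⟨⟨x, ⟨t, ht⟩ * s⟩, ?_⟩
        simp only at hz
        rw [LinearMap.comp_apply, hx, map_smul, ← hz, mul_smul]
        rfl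
      exists_of_eq := by
        intro x₁ x₂ h
        obtain ⟨c, hc⟩ := IsLocalizedModule.exists_of_eq (S := S) (f := ψ) h
        have h0 : φ ((c : R) • (x₁ - x₂)) = 0 := by
          rw [map_smul, map_sub, smul_sub, sub_eq_zero]
          exact hc
        obtain ⟨s, hs, hs0⟩ := inj _ h0
        refine ⟨⟨s, hs⟩ * c, ?_⟩
        rw [smul_smul, smul_sub, sub_eq_zero] at hs0
        exact hs0 }
  have hfree : Module.Free (Localization.AtPrime p.asIdeal) (LocalizedModule S N) :=
    Module.free_of_isLocalizedModule S ψ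
  exact (Module.mem_freeLocus_of_isLocalization p (Localization.AtPrime p.asIdeal)
    (LocalizedModule S N) (ψ ∘ₗ φ)).2 hfree

/-- The elements a multiple of which, by an element outside of the prime ideal `p`, lies in `N`. -/
def saturation {R M : Type*} [CommRing R] [AddCommGroup M] [Module R M] (p : PrimeSpectrum R)
    (N : Submodule R M) : Submodule R M where
  carrier := {x | ∃ s ∉ p.asIdeal, s • x ∈ N}
  zero_mem' := ⟨1, p.2.one_notMem, by rw [smul_zero]; exact zero_mem _⟩
  add_mem' := by
    rintro x y ⟨s, hs, hx⟩ ⟨t, ht, hy⟩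
    refine ⟨s * t, fun h => (p.2.mem_or_mem h).elim hs ht, ?_⟩
    rw [smul_add, mul_smul, mul_smul, smul_comm s t x]
    exact add_mem (N.smul_mem t hx) (N.smul_mem s hy)
  smul_mem' := by
    rintro c x ⟨s, hs, hx⟩
    exact ⟨s, hs, by rw [smul_comm]; exact N.smul_mem c hx⟩

end FreeLocus

section MapLaurent

variable {V W : Type u} [AddCommGroup V] [Module ℂ V] [AddCommGroup W] [Module ℂ W]

/-- `u^m v ↦ u^m f(v)`. -/
def mapLaurent (S : Chart (Fin 3)) (f : V →ₗ[ℂ] W) : LaurentVec V →ₗ[O S] LaurentVec W where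
  toFun := Finsupp.mapRange f (map_zero f)
  map_add' x y := Finsupp.mapRange_add (map_add f) x y
  map_smul' a x := by
    apply LaurentVec.ext
    intro m
    let y : LaurentVec W := Finsupp.mapRange f (map_zero f) x
    show f ((a.1 • x).coeff m) = (a.1 • y).coeff m
    rw [LaurentVec.smul_coeff, LaurentVec.smul_coeff, map_finsuppSum]
    simp only [map_smul]
    rfl

theorem mapLaurent_term (S : Chart (Fin 3)) (f : V →ₗ[ℂ] W) (m : Lat (Fin 3)) (v : V) :
    mapLaurent S f (term m v) = term m (f v) :=
  Finsupp.mapRange_single (hf := map_zero f)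

theorem IsFiltration.map_mkQ {F : ℤ → Submodule ℂ V} (hF : IsFiltration F) (N : Submodule ℂ V) :
    IsFiltration fun p => (F p).map N.mkQ where
  anti _ _ h := Submodule.map_mono (hF.anti h)
  bot := by
    obtain ⟨p, hp⟩ := hF.bot
    exact ⟨p, by simp only [hp, Submodule.map_bot]⟩
  top := by
    obtain ⟨p, hp⟩ := hF.top
    exact ⟨p, by simp only [hp, Submodule.map_top, Submodule.range_mkQ]⟩

end MapLaurent

namespace RealTrifiltered

variable (X Y : RealTrifiltered.{u})

theorem isFiltration (i : Fin 3) : IsFiltration (X.F i) :=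
  ⟨X.decreasing i, (X.exhaustive i).1, (X.exhaustive i).2⟩

/-- The Rees module of a trifiltered space is presented by its filtrations. -/
def presentation : ReesPresentation X.rees.E X.isFiltration where
  equiv S := LinearEquiv.refl (O S) (X.reesSections S)
  equiv_res _ _ := rfl

theorem semistableBundle_rees : EquivariantModule.semistableBundle X.rees :=
  ⟨X.presentation.isVectorBundle, X.presentation.isSemistable X.opposed,
    X.presentation.hasSlope X.opposed⟩

variable {X Y}

/-! ### All morphisms are strict -/

section Strict

variable (g : Hom X Y)

theorem exists_mem_zero {n : ℤ} {x : X.V} (hx : g.f x ∈ Y.F 0 n) : ∃ x' ∈ X.F 0 n, g.f x' = g.f x :=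
  X.opposed.strict_zero g.f (X.isFiltration 0) (X.isFiltration 1) (X.isFiltration 2)
    (Y.isFiltration 0) (Y.isFiltration 1) (Y.isFiltration 2) Y.opposed (g.map_F 0) (g.map_F 1)
    (g.map_F 2) hx

/-- First strictness for F₀, then strictness for F_i inside the step of F₀ so reached. Opposedness
is symmetric in F₁ and F₂, which covers i = 2. -/
theorem exists_mem_inf {i : Fin 3} (hi : i ≠ 0) {n p : ℤ} {x : X.V} (hx0 : g.f x ∈ Y.F 0 n)
    (hx : g.f x ∈ Y.F i p) : ∃ x', x' ∈ X.F 0 n ∧ x' ∈ X.F i p ∧ g.f x' = g.f x := by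
  obtain ⟨x₀, hx₀, he⟩ := exists_mem_zero g hx0
  rw [← he] at hx ⊢
  have h12 : i = 1 ∨ i = 2 := by omega
  rcases h12 with rfl | rfl
  · exact X.opposed.strict_one g.f (X.isFiltration 0) (X.isFiltration 1) (X.isFiltration 2)
      (Y.isFiltration 0) (Y.isFiltration 1) (Y.isFiltration 2) Y.opposed (g.map_F 0) (g.map_F 1)
      (g.map_F 2) hx₀ hx
  · exact (X.opposed.swap (X.isFiltration 1) (X.isFiltration 2)).strict_one g.f (X.isFiltration 0)
      (X.isFiltration 2) (X.isFiltration 1) (Y.isFiltration 0) (Y.isFiltration 2) (Y.isFiltration 1)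
      (Y.opposed.swap (Y.isFiltration 1) (Y.isFiltration 2)) (g.map_F 0) (g.map_F 2) (g.map_F 1) hx₀ hx

theorem exists_mem_inf_of_sub_eq {i : Fin 3} (hi : i ≠ 0) {n p : ℤ} {y y' : Y.V} {x : X.V}
    (hy : y ∈ Y.F 0 n) (hy' : y' ∈ Y.F i p) (hx : y - y' = g.f x) :
    ∃ z w, z ∈ Y.F 0 n ∧ z ∈ Y.F i p ∧ y - z = g.f w := by
  have h12 : i = 1 ∨ i = 2 := by omega
  rcases h12 with rfl | rfl
  · exact X.opposed.exists_mem_inf_of_sub_eq g.f (X.isFiltration 0) (X.isFiltration 1)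
      (X.isFiltration 2) (Y.isFiltration 0) (Y.isFiltration 1) (Y.isFiltration 2) Y.opposed
      (g.map_F 0) (g.map_F 1) (g.map_F 2) hy hy' hx
  · exact (X.opposed.swap (X.isFiltration 1) (X.isFiltration 2)).exists_mem_inf_of_sub_eq g.f
      (X.isFiltration 0) (X.isFiltration 2) (X.isFiltration 1) (Y.isFiltration 0) (Y.isFiltration 2)
      (Y.isFiltration 1) (Y.opposed.swap (Y.isFiltration 1) (Y.isFiltration 2)) (g.map_F 0)
      (g.map_F 2) (g.map_F 1) hy hy' hx

theorem exists_mem {i : Fin 3} {p : ℤ} {x : X.V} (hx : g.f x ∈ Y.F i p) :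
    ∃ x' ∈ X.F i p, g.f x' = g.f x := by
  by_cases hi : i = 0
  · subst hi
    exact exists_mem_zero g hx
  · obtain ⟨q, hq⟩ := (Y.exhaustive 0).2
    obtain ⟨x', -, hx', he⟩ := exists_mem_inf g hi (hq ▸ trivial : g.f x ∈ Y.F 0 q) hx
    exact ⟨x', hx', he⟩

/-- All morphisms of opposed filtrations are strict. -/
theorem strict_eq_top : strict.{u} = ⊤ := by
  ext X Y g
  refine ⟨fun _ => trivial, fun _ i p => le_antisymm ?_ ?_⟩
  · rintro _ ⟨x, hx, rfl⟩
    exact ⟨⟨x, rfl⟩, Hom.map_F g i p x hx⟩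
  · rintro _ ⟨⟨x, rfl⟩, hx⟩
    obtain ⟨x', hx', he⟩ := exists_mem g hx
    exact ⟨x', hx', he⟩

end Strict

/-! ### Cokernels away from (1:0:0) -/

section Cokernel

variable (g : Hom X Y)

/-- The filtrations on the cokernel of a morphism. -/
def cokerF (i : Fin 3) (p : ℤ) : Submodule ℂ (Y.V ⧸ LinearMap.range g.f) :=
  (Y.F i p).map (LinearMap.range g.f).mkQ

theorem isFiltration_cokerF (i : Fin 3) : IsFiltration (cokerF g i) :=
  (Y.isFiltration i).map_mkQ _

/-- The map from the cokernel of a morphism of Rees modules to the Rees module of the cokernel. -/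
def cokerMap (S : Chart (Fin 3)) :
    EquivariantModule.Hom.coker (reesMap g) S →ₗ[O S] reesSub (isFiltration_cokerF g) S :=
  Submodule.liftQ _ (LinearMap.codRestrict _
    ((mapLaurent S (LinearMap.range g.f).mkQ).comp (Y.reesSections S).subtype) (fun y m i hi =>
      Submodule.mem_map_of_mem (y.2 m i hi))) (by
    rintro _ ⟨x, rfl⟩
    rw [LinearMap.mem_ker]
    apply Subtype.ext
    apply LaurentVec.ext
    intro m
    show (LinearMap.range g.f).mkQ (g.f (x.1.coeff m)) = 0
    rw [Submodule.mkQ_apply, Submodule.Quotient.mk_eq_zero]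
    exact ⟨_, rfl⟩)

theorem coord_pow (k i : Fin 3) (N : ℕ) : ∃ h, coord k i ^ N =
    mono (chart k) ((N : ℤ) • quotExp i k) h 1 := by
  have h : ∀ j ∉ (chart k).1, 0 ≤ ((N : ℤ) • quotExp i k).1 j := by
    intro j hj
    rw [notMem_chart] at hj
    show 0 ≤ (N : ℤ) * ((Pi.single i 1 : Fin 3 → ℤ) j - (Pi.single k 1 : Fin 3 → ℤ) j)
    rw [Pi.single_eq_of_ne hj, sub_zero, Pi.single_apply]
    split_ifs <;> simp
  refine ⟨h, ?_⟩
  apply toLaurent_injective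
  rw [map_pow, toLaurent_mono]
  show AddMonoidAlgebra.single (quotExp i k) 1 ^ N = _
  rw [AddMonoidAlgebra.single_pow, one_pow, natCast_zsmul]

theorem exists_pair_of_ne_zero {k : Fin 3} (hk : k ≠ 0) :
    ∃ i : Fin 3, i ≠ 0 ∧ i ≠ k ∧ ∀ j, j ≠ k → j = 0 ∨ j = i := by
  have h12 : k = 1 ∨ k = 2 := by omega
  rcases h12 with rfl | rfl
  · exact ⟨2, by decide, by decide, by decide⟩
  · exact ⟨1, by decide, by decide, by decide⟩

/-- Away from the point `(1 : 0 : 0)` of the chart `U_0`, one of the two coordinates does not vanish. -/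
theorem exists_coord_notMem {p : PrimeSpectrum (O (chart (0 : Fin 3)))}
    (hp : ¬(coord 0 1 ∈ p.asIdeal ∧ coord 0 2 ∈ p.asIdeal)) :
    ∃ i i' : Fin 3, i ≠ 0 ∧ i' ≠ 0 ∧ i ≠ i' ∧ (∀ j, j ≠ 0 → j = i ∨ j = i') ∧
      coord 0 i ∉ p.asIdeal := by
  rw [not_and_or] at hp
  rcases hp with hp | hp
  · exact ⟨1, 2, by decide, by decide, by decide, by decide, hp⟩
  · exact ⟨2, 1, by decide, by decide, by decide, by decide, hp⟩

theorem exists_forall_mem (Z : RealTrifiltered.{u}) (i : Fin 3) (t : ℤ) :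
    ∃ N : ℕ, ∀ v, v ∈ Z.F i (-(N + t)) := by
  obtain ⟨q, hq⟩ := (Z.exhaustive i).2
  refine ⟨(-q - t).toNat, fun v => Z.decreasing i (?_ : _ ≤ q) (hq ▸ trivial)⟩
  omega

variable {g} {k : Fin 3} {p : PrimeSpectrum (O (chart k))}

/-- Local surjectivity of `cokerMap` on terms. On U_1 and U_2 the filtrations are F₀ and one F_i,
and the images of their steps meet in the image of the intersection. On U_0 the relevant F₁ and F₂
need not behave so; but some u_i/u_0 lies outside p, and a power of it removes the condition for
F_i. -/
theorem exists_lift_term (hp : ¬(coord k 1 ∈ p.asIdeal ∧ coord k 2 ∈ p.asIdeal))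
    {m : Lat (Fin 3)} {q : Y.V ⧸ LinearMap.range g.f} (hq : ∀ i, i ≠ k → q ∈ cokerF g i (-m.1 i)) :
    ∃ (a : Lat (Fin 3)) (ha : _), mono (chart k) a ha 1 ∉ p.asIdeal ∧
      ∃ v, (LinearMap.range g.f).mkQ v = q ∧ ∀ i, i ≠ k → v ∈ Y.F i (-(a + m).1 i) := by
  by_cases hk : k = 0
  · subst hk
    obtain ⟨i, i', hi, hi', hii', hcov, hip⟩ := exists_coord_notMem hp
    obtain ⟨v, hv, hvq⟩ := hq i' hi'
    obtain ⟨N, hN⟩ := Y.exists_forall_mem i (m.1 i)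
    obtain ⟨ha, hpow⟩ := coord_pow 0 i N
    refine ⟨_, ha, fun h => hip (p.2.mem_of_pow_mem N (hpow ▸ h)), v, hvq, fun j hj => ?_⟩
    show v ∈ Y.F j (-((N : ℤ) * ((Pi.single i 1 : Fin 3 → ℤ) j - (Pi.single 0 1 : Fin 3 → ℤ) j) + m.1 j))
    rcases hcov j hj with rfl | rfl
    · rw [Pi.single_eq_same, Pi.single_eq_of_ne hj, sub_zero, mul_one]
      exact hN v
    · rw [Pi.single_eq_of_ne hii'.symm, Pi.single_eq_of_ne hj, sub_zero, mul_zero, zero_add]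
      exact hv
  · obtain ⟨i, hi, hik, hcov⟩ := exists_pair_of_ne_zero hk
    obtain ⟨y, hy, hyq⟩ := hq 0 (Ne.symm hk)
    obtain ⟨y', hy', hyq'⟩ := hq i hik
    have hsub : y - y' ∈ LinearMap.range g.f := by
      rw [← Submodule.Quotient.mk_eq_zero, Submodule.Quotient.mk_sub, sub_eq_zero]
      exact hyq.trans hyq'.symm
    obtain ⟨x, hx⟩ := hsub
    obtain ⟨z, w, hz0, hzi, hzw⟩ := exists_mem_inf_of_sub_eq g hi hy hy' hx.symm
    refine ⟨0, fun _ _ => le_rfl, p.2.one_notMem, z, ?_, fun j hj => ?_⟩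
    · rw [← hyq, eq_comm, ← sub_eq_zero, ← map_sub, hzw, Submodule.mkQ_apply,
        Submodule.Quotient.mk_eq_zero]
      exact ⟨w, rfl⟩
    · rw [zero_add]
      rcases hcov j hj with rfl | rfl
      · exact hz0
      · exact hzi

/-- Local injectivity of `cokerMap` on terms, by the same dichotomy: joint strictness for F₀ and F_i
on U_1 and U_2, strictness for a single filtration on U_0. -/
theorem exists_preimage_term (hp : ¬(coord k 1 ∈ p.asIdeal ∧ coord k 2 ∈ p.asIdeal))
    {m : Lat (Fin 3)} {x : X.V} (hx : ∀ i, i ≠ k → g.f x ∈ Y.F i (-m.1 i)) :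
    ∃ (a : Lat (Fin 3)) (ha : _), mono (chart k) a ha 1 ∉ p.asIdeal ∧
      ∃ x', g.f x' = g.f x ∧ ∀ i, i ≠ k → x' ∈ X.F i (-(a + m).1 i) := by
  by_cases hk : k = 0
  · subst hk
    obtain ⟨i, i', hi, hi', hii', hcov, hip⟩ := exists_coord_notMem hp
    obtain ⟨x', hx', he⟩ := exists_mem g (hx i' hi')
    obtain ⟨N, hN⟩ := X.exists_forall_mem i (m.1 i)
    obtain ⟨ha, hpow⟩ := coord_pow 0 i N
    refine ⟨_, ha, fun h => hip (p.2.mem_of_pow_mem N (hpow ▸ h)), x', he, fun j hj => ?_⟩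
    show x' ∈ X.F j (-((N : ℤ) * ((Pi.single i 1 : Fin 3 → ℤ) j - (Pi.single 0 1 : Fin 3 → ℤ) j) + m.1 j))
    rcases hcov j hj with rfl | rfl
    · rw [Pi.single_eq_same, Pi.single_eq_of_ne hj, sub_zero, mul_one]
      exact hN x'
    · rw [Pi.single_eq_of_ne hii'.symm, Pi.single_eq_of_ne hj, sub_zero, mul_zero, zero_add]
      exact hx'
  · obtain ⟨i, hi, hik, hcov⟩ := exists_pair_of_ne_zero hk
    obtain ⟨x', hx0, hxi, he⟩ := exists_mem_inf g hi (hx 0 (Ne.symm hk)) (hx i hik)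
    refine ⟨0, fun _ _ => le_rfl, p.2.one_notMem, x', he, fun j hj => ?_⟩
    rw [zero_add]
    rcases hcov j hj with rfl | rfl
    · exact hx0
    · exact hxi

/-- A section `u^m v` of the Rees module. -/
def termSection {Z : RealTrifiltered.{u}} {S : Chart (Fin 3)} (m : Lat (Fin 3)) (v : Z.V)
    (h : ∀ i ∉ S.1, v ∈ Z.F i (-m.1 i)) : Z.reesSections S :=
  ⟨term m v, (term_mem_reesSub (hF := Z.isFiltration)).2 h⟩

/-- The cokernel of a morphism of Rees bundles is locally free away from the point `(1 : 0 : 0)`. -/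
theorem mem_freeLocus_coker (hp : ¬(coord k 1 ∈ p.asIdeal ∧ coord k 2 ∈ p.asIdeal)) :
    p ∈ Module.freeLocus (O (chart k)) (EquivariantModule.Hom.coker (reesMap g) (chart k)) := by
  -- The object of comparison is the Rees module of the quotient filtrations, free because U_k sees
  -- only two of them.
  have hfree : Module.Free (O (chart k)) (reesSub (isFiltration_cokerF g) (chart k)) := by
    obtain ⟨r, b, l, h, -⟩ := exists_splitsOn_chart (isFiltration_cokerF g) k
    exact Module.Free.of_basis (h.basis (isFiltration_cokerF g))
  refine mem_freeLocus_of_locally_bijective (cokerMap g (chart k)) p (fun y => ?_) (fun x hx => ?_)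
  · suffices hy : y ∈ saturation p (LinearMap.range (cokerMap g (chart k))) by
      obtain ⟨s, hs, x, hx⟩ := hy
      exact ⟨s, hs, x, hx⟩
    suffices hy : y.1 ∈ (saturation p (LinearMap.range (cokerMap g (chart k)))).map
        (reesSub (isFiltration_cokerF g) (chart k)).subtype by
      obtain ⟨z, hz, hzy⟩ := hy
      rwa [← Subtype.ext hzy]
    rw [← y.1.sum_term]
    refine Submodule.sum_mem _ fun m _ => ?_
    have hym := y.2 m
    obtain ⟨a, ha, hap, v, hv, hvF⟩ := exists_lift_term hp fun i hi => hym i (notMem_chart.2 hi)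
    refine ⟨⟨term m (y.1.coeff m), term_mem_reesSub.2 hym⟩, ⟨_, hap, Submodule.Quotient.mk
      (termSection (a + m) v fun i hi => hvF i (notMem_chart.1 hi)), ?_⟩, rfl⟩
    apply Subtype.ext
    show mapLaurent (chart k) (LinearMap.range g.f).mkQ (term (a + m) v) =
      mono (chart k) a ha 1 • term m (y.1.coeff m)
    rw [mapLaurent_term, hv, mono_smul_term, one_smul]
  · obtain ⟨y, rfl⟩ := Submodule.Quotient.mk_surjective _ x
    suffices hy : y ∈ saturation p (LinearMap.range ((reesMap g).app (chart k))) by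
      obtain ⟨s, hs, hx⟩ := hy
      refine ⟨s, hs, ?_⟩
      rw [← Submodule.Quotient.mk_smul, Submodule.Quotient.mk_eq_zero]
      exact hx
    suffices hy : y.1 ∈ (saturation p (LinearMap.range ((reesMap g).app (chart k)))).map
        (Y.reesSections (chart k)).subtype by
      obtain ⟨z, hz, hzy⟩ := hy
      rwa [← Subtype.ext hzy]
    rw [← y.1.sum_term]
    refine Submodule.sum_mem _ fun m _ => ?_
    have hym := y.2 m
    have hr : y.1.coeff m ∈ LinearMap.range g.f := by
      have h0 := congrArg
        (fun z : reesSub (isFiltration_cokerF g) (chart k) => LaurentVec.coeff z.1 m) hx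
      have h1 : (LinearMap.range g.f).mkQ (y.1.coeff m) = 0 := h0
      rwa [Submodule.mkQ_apply, Submodule.Quotient.mk_eq_zero] at h1
    obtain ⟨x, hxm⟩ := hr
    obtain ⟨a, ha, hap, x', hx', hxF⟩ := exists_preimage_term (g := g) (x := x) (m := m) hp
      fun i hi => hxm ▸ hym i (notMem_chart.2 hi)
    refine ⟨termSection m (y.1.coeff m) hym, ⟨_, hap, termSection (a + m) x'
      fun i hi => hxF i (notMem_chart.1 hi), ?_⟩, rfl⟩
    apply Subtype.ext
    show mapLaurent (chart k) g.f (term (a + m) x') =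
      mono (chart k) a ha 1 • term m (y.1.coeff m)
    rw [mapLaurent_term, hx', hxm, mono_smul_term, one_smul]

end Cokernel

end RealTrifiltered

end ReesPlane
end

noncomputable section
namespace ReesPlane

/-! ### Extension of sections across codimension two -/

section Sections

/-- u^a and u^b vanish along disjoint sets of divisors. Where a_i = 0, dividing f by u^a creates no
pole; where b_i = 0, the quotient has the same order in u_i as g. -/
theorem mono_dvd_of_mul_eq {ι : Type} [Fintype ι] {S : Chart ι} {a b : Lat ι} (ha hb)
    (hab : ∀ i ∉ S.1, a.1 i = 0 ∨ b.1 i = 0) {f g : O S}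
    (h : mono S b hb 1 * f = mono S a ha 1 * g) : ∃ f' : O S, mono S a ha 1 * f' = f := by
  classical
  refine ⟨⟨AddMonoidAlgebra.single (-a) 1 * toLaurent S f, ?_⟩, ?_⟩
  · intro m hm i hi
    obtain ⟨n, rfl⟩ : ∃ n, m = -a + n := ⟨a + m, by abel⟩
    rw [AddMonoidAlgebra.coeff_single_mul_add, one_mul] at hm
    show 0 ≤ -a.1 i + n.1 i
    have hn := toLaurent_coeff_nonneg f hm hi
    rcases hab i hi with h0 | h0
    · omega
    · have h1 := congrArg (fun z => (toLaurent S z).coeff (b + n)) h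
      simp only [map_mul, toLaurent_mono, AddMonoidAlgebra.coeff_single_mul_add, one_mul] at h1
      rw [h1, show b + n = a + (b + n - a) by abel, AddMonoidAlgebra.coeff_single_mul_add,
        one_mul] at hm
      have h2 := toLaurent_coeff_nonneg g hm hi
      have h3 : (b + n - a).1 i = b.1 i + n.1 i - a.1 i := rfl
      omega
  · apply toLaurent_injective
    show AddMonoidAlgebra.single a 1 * (AddMonoidAlgebra.single (-a) 1 * toLaurent S f) = _
    rw [← mul_assoc, AddMonoidAlgebra.single_mul_single, add_neg_cancel, one_mul]
    exact one_mul _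

/-- If `a` divides every `f` for which it divides `b f`, then the same holds in projective modules. -/
theorem exists_smul_eq_of_projective {R M : Type*} [CommRing R] [AddCommGroup M] [Module R M]
    [Module.Projective R M] {a b : R} (h : ∀ f g : R, b * f = a * g → ∃ f', a * f' = f) {x y : M}
    (hxy : b • x = a • y) : ∃ z, a • z = x := by
  classical
  -- Divide coordinatewise in a free module of which M is a retract, then map back.
  obtain ⟨s, hs⟩ := Module.projective_def.1 ‹Module.Projective R M›
  have hc (m : M) : ∃ f', a * f' = s x m := by
    refine h _ (s y m) ?_
    have := congrArg (fun z => s z m) hxy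
    simpa using this
  choose f' hf' using hc
  refine ⟨∑ m ∈ (s x).support, f' m • m, ?_⟩
  rw [Finset.smul_sum]
  refine Eq.trans ?_ (hs x)
  rw [Finsupp.linearCombination_apply, Finsupp.sum]
  refine Finset.sum_congr rfl fun m _ => ?_
  rw [smul_smul, hf']
  rfl

namespace ChartModule

/-- A section over `U_{S'}` extends to the larger open set `U_S` after multiplication with a monomial
that is regular on `U_S` and invertible on `U_{S'}`. -/
theorem IsQuasiCoherent.exists_mono_smul {ι : Type} [Fintype ι] [DecidableEq ι]
    {E : ChartModule.{u} ι} (hE : E.IsQuasiCoherent) {S S' : Chart ι} (h : S ≤ S') (y : E.sec S') :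
    ∃ (b : Lat ι) (hb' : ∀ i ∉ S'.1, b.1 i = 0) (_ : ∀ i ∉ S.1, 0 ≤ b.1 i) (x : E.sec S),
      E.res h x = mono S' b (fun i hi => (hb' i hi).ge) 1 • y := by
  obtain ⟨f, hf, x, hx⟩ := hE.surj h y
  obtain ⟨g, hg⟩ := hf.exists_left_inv
  obtain ⟨b, hb', hb, f', hf'⟩ := exists_mono_mul_mem_range h g
  refine ⟨b, hb', hb, f' • x, ?_⟩
  rw [E.res_smul, hx, hf', smul_smul, mul_assoc, hg, mul_one]

variable {E : ChartModule.{u} (Fin 3)}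

theorem chart_le {S : Chart (Fin 3)} {k : Fin 3} (hk : k ∈ S.1) : chart k ≤ S :=
  Finset.singleton_subset_iff.2 hk

/-- Over a chart U_k, projective modules over a domain are torsion-free. Over a general U_S, a
section comes from some U_k after multiplication by an invertible monomial. -/
theorem IsVectorBundle.res_injective (hE : E.IsVectorBundle) {S S' : Chart (Fin 3)} (h : S ≤ S') :
    Function.Injective (E.res h) := by
  have key (k : Fin 3) {S' : Chart (Fin 3)} (h : chart k ≤ S') (x : E.sec (chart k))
      (hx : E.res h x = 0) : x = 0 := by
    obtain ⟨f, hf, hfx⟩ := hE.quasiCoherent.inj h x hx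
    have := hE.projective k
    have hf0 : f ≠ 0 := by
      rintro rfl
      rw [map_zero] at hf
      exact not_isUnit_zero hf
    have : Module.IsTorsionFree (O (chart k)) (E.sec (chart k)) := inferInstance
    exact (smul_eq_zero.1 hfx).resolve_left hf0
  rw [injective_iff_map_eq_zero]
  intro x hx
  obtain ⟨k, hk⟩ := S.2
  obtain ⟨b, hb', hb, z, hz⟩ := hE.quasiCoherent.exists_mono_smul (chart_le hk) x
  have hz0 : z = 0 := by
    refine key k ((chart_le hk).trans h) z ?_
    rw [← E.res_trans (chart_le hk) h, hz, E.res_smul, hx, smul_zero]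
  rw [hz0, map_zero] at hz
  exact ((isUnit_mono S b hb' one_ne_zero).smul_eq_zero).1 hz.symm

/-- The open set on which all coordinates but `u_i` are invertible. -/
def coChart (i : Fin 3) : Chart (Fin 3) :=
  ⟨{i}ᶜ, by fin_cases i <;> decide⟩

theorem notMem_coChart {i j : Fin 3} : j ∉ (coChart i).1 ↔ j = i := by simp [coChart]

theorem chart_cases (S : Chart (Fin 3)) :
    S = openOrbit (Fin 3) ∨ (∃ i, S = coChart i) ∨ ∃ k, S = chart k := by
  revert S
  decide

theorem exists_complement (k : Fin 3) :
    ∃ i j : Fin 3, i ≠ k ∧ j ≠ k ∧ i ≠ j ∧ ∀ s, s ≠ k → s = i ∨ s = j := by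
  revert k
  decide

variable (E) in
/-- The sections over the open orbit that extend to `U_S`. -/
def extendable (S : Chart (Fin 3)) : AddSubgroup (E.sec (openOrbit (Fin 3))) :=
  (E.res (le_openOrbit S)).range

theorem smul_mem_extendable {S : Chart (Fin 3)} (f : O S) {y : E.sec (openOrbit (Fin 3))}
    (hy : y ∈ E.extendable S) : resO (le_openOrbit S) f • y ∈ E.extendable S := by
  obtain ⟨x, rfl⟩ := hy
  exact ⟨f • x, E.res_smul _ f x⟩

theorem extendable_mono {S S' : Chart (Fin 3)} (h : S ≤ S') : E.extendable S ≤ E.extendable S' := by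
  rintro _ ⟨x, rfl⟩
  exact ⟨E.res h x, E.res_trans _ _ x⟩

/-- A section over the open orbit that extends over the generic points of the divisors `u_i = 0`,
`i ∉ S`, extends to `U_S`. -/
theorem IsVectorBundle.mem_extendable (hE : E.IsVectorBundle) {S : Chart (Fin 3)}
    {y : E.sec (openOrbit (Fin 3))} :
    y ∈ E.extendable S ↔ ∀ i ∉ S.1, y ∈ E.extendable (coChart i) := by
  constructor
  · intro h i hi
    refine extendable_mono (fun j hj => ?_) h
    by_contra h'
    rw [notMem_coChart] at h'
    exact hi (h' ▸ hj)
  intro h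
  rcases chart_cases S with rfl | ⟨i, rfl⟩ | ⟨k, rfl⟩
  · exact ⟨y, E.res_refl y⟩
  · exact h i (notMem_coChart.2 rfl)
  obtain ⟨i, j, hi, hj, hij, hcov⟩ : ∃ i j : Fin 3, i ≠ k ∧ j ≠ k ∧ i ≠ j ∧
      ∀ s, s ≠ k → s = i ∨ s = j := exists_complement k
  -- As y already extends across u_i = 0, only the other divisor of the chart needs clearing, and
  -- the exponent at i stays 0.
  have key (i : Fin 3) (hi : i ≠ k) : ∃ (b : Lat (Fin 3)) (_ : b.1 i = 0)
      (hb : ∀ s ∉ (chart k).1, 0 ≤ b.1 s) (x : E.sec (chart k)),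
      E.res (le_openOrbit _) x = resO (le_openOrbit _) (mono (chart k) b hb 1) • y := by
    obtain ⟨z, hz⟩ := h i (notMem_chart.2 hi)
    have hle : chart k ≤ coChart i := chart_le (by
      by_contra h'
      exact hi (notMem_coChart.1 h').symm)
    obtain ⟨b, hb', hb, x, hx⟩ := hE.quasiCoherent.exists_mono_smul hle z
    refine ⟨b, hb' i (notMem_coChart.2 rfl), hb, x, ?_⟩
    rw [← E.res_trans hle (le_openOrbit _), hx, E.res_smul, hz]
    rfl
  obtain ⟨a, hai, ha, x, hx⟩ := key i hi
  obtain ⟨b, hbj, hb, x', hx'⟩ := key j hj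
  have := hE.projective k
  -- The extensions x of u^a y and x' of u^b y satisfy u^b x = u^a x', so x is divisible by u^a; the
  -- quotient extends y.
  obtain ⟨z, hz⟩ := exists_smul_eq_of_projective
    (a := mono (chart k) a ha 1) (b := mono (chart k) b hb 1) (x := x) (y := x')
    (fun f g hfg => mono_dvd_of_mul_eq ha hb (fun s hs => by
      rcases hcov s (notMem_chart.1 hs) with rfl | rfl
      · exact Or.inl hai
      · exact Or.inr hbj) hfg)
    (hE.res_injective (le_openOrbit _) (by
      rw [E.res_smul, E.res_smul, hx, hx', smul_comm]))
  refine ⟨z, ?_⟩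
  have hu := isUnit_mono (openOrbit (Fin 3)) a (fun s hs => absurd mem_openOrbit hs) one_ne_zero
  refine hu.smul_left_cancel.1 ?_
  refine Eq.trans ?_ hx
  rw [← hz, E.res_smul]
  rfl

end ChartModule

end Sections

end ReesPlane
end

noncomputable section
namespace ReesPlane

open ChartModule

/-! ### Invariant sections over the open orbit -/

section Bounded

theorem exists_eq_top_of_antitone {V : Type*} [AddCommGroup V] [Module ℂ V] [FiniteDimensional ℂ V]
    {F : ℤ → Submodule ℂ V} (hF : Antitone F) (h : ∀ v, ∃ p, v ∈ F p) : ∃ p, F p = ⊤ := by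
  obtain ⟨s, hs⟩ := Module.Finite.fg_top (R := ℂ) (M := V)
  choose p hp using h
  obtain ⟨q, hq⟩ := (s.image p).bddBelow
  refine ⟨q, top_le_iff.1 (hs ▸ Submodule.span_le.2 fun v hv => ?_)⟩
  exact hF (hq (Finset.mem_coe.2 (Finset.mem_image_of_mem p hv))) (hp v)

end Bounded

namespace EquivariantModule

variable (A : EquivariantModule.{u})

/-- The complex vector space of sections over `U_S`. -/
instance (S : Chart (Fin 3)) : Module ℂ (A.E.sec S) :=
  Module.compHom _ (algebraMap ℂ (O S))

/-- The monomial `c u^m` as a function on the open orbit. -/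
abbrev orbitMono (m : Lat (Fin 3)) (c : ℂ) : O (openOrbit (Fin 3)) :=
  mono (openOrbit (Fin 3)) m (fun _ hi => absurd mem_openOrbit hi) c

theorem orbitMono_mul (m n : Lat (Fin 3)) (c d : ℂ) :
    orbitMono m c * orbitMono n d = orbitMono (m + n) (c * d) := mono_mul _ _ _ _ _ _ _

theorem isUnit_orbitMono (m : Lat (Fin 3)) : IsUnit (orbitMono m 1) :=
  isUnit_mono _ m (fun _ hi => absurd mem_openOrbit hi) one_ne_zero

variable {A}

theorem coact_mono_smul {S : Chart (Fin 3)} (m : Lat (Fin 3)) (hm) (c : ℂ) (x : A.E.sec S)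
    (χ : Lat (Fin 3)) :
    A.coact S (mono S m hm c • x) χ = mono S m hm c • A.coact S x (χ - m) := by
  rw [← A.coact_smul, add_sub_cancel]

theorem coact_smul_complex {S : Chart (Fin 3)} (c : ℂ) (x : A.E.sec S) (χ : Lat (Fin 3)) :
    A.coact S (c • x) χ = c • A.coact S x χ := by
  have := coact_mono_smul 0 (fun _ _ => le_rfl) c x χ
  rwa [sub_zero] at this

variable (A)

/-- The sections over the open orbit that are invariant under the torus. -/
def invariants : Submodule ℂ (A.E.sec (openOrbit (Fin 3))) where
  carrier := {x | A.coact _ x = Finsupp.single 0 x}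
  zero_mem' := by simp
  add_mem' := by
    intro x y hx hy
    simp only [Set.mem_ofPred_eq] at *
    rw [map_add, hx, hy, Finsupp.single_add]
  smul_mem' := by
    classical
    intro c x hx
    simp only [Set.mem_ofPred_eq] at *
    ext χ
    rw [coact_smul_complex, hx, Finsupp.single_apply, Finsupp.single_apply, smul_ite, smul_zero]

variable {A}

open Classical in
theorem coact_orbitMono_smul (v : A.invariants) (m χ : Lat (Fin 3)) (c : ℂ) :
    A.coact _ (orbitMono m c • v.1) χ = if m = χ then orbitMono m c • v.1 else 0 := by
  rw [coact_mono_smul, show A.coact _ v.1 = Finsupp.single 0 v.1 from v.2, Finsupp.single_apply,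
    smul_ite, smul_zero]
  simp only [eq_comm (a := (0 : Lat (Fin 3))), sub_eq_zero, eq_comm (a := χ)]

theorem orbitMono_smul_complex (v : A.invariants) (m : Lat (Fin 3)) (c : ℂ) :
    orbitMono m 1 • (c • v : A.invariants).1 = orbitMono m c • v.1 := by
  show orbitMono m 1 • (orbitMono 0 c • v.1) = _
  rw [smul_smul, orbitMono_mul, add_zero, one_mul]

variable (A) in
/-- The map `u^m v ↦ u^m • v`. -/
def evalAdd : LaurentVec A.invariants →+ A.E.sec (openOrbit (Fin 3)) :=
  Finsupp.liftAddHom fun m =>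
    (DistribSMul.toAddMonoidHom _ (orbitMono m 1)).comp A.invariants.subtype.toAddMonoidHom

theorem evalAdd_term (m : Lat (Fin 3)) (v : A.invariants) :
    A.evalAdd (term m v) = orbitMono m 1 • v.1 :=
  Finsupp.liftAddHom_apply_single _ _ _

theorem laurentVec_induction {V : Type u} [AddCommGroup V] [Module ℂ V] {P : LaurentVec V → Prop}
    (zero : P 0) (add : ∀ x y, P x → P y → P (x + y)) (term : ∀ m v, P (term m v))
    (x : LaurentVec V) : P x :=
  Finsupp.induction_linear x zero add term

theorem evalAdd_smul (f : O (openOrbit (Fin 3))) (x : LaurentVec A.invariants) :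
    A.evalAdd (f • x) = f • A.evalAdd x := by
  induction f using regular_induction with
  | zero => rw [zero_smul, zero_smul, map_zero]
  | add f g hf hg => rw [add_smul, add_smul, map_add, hf, hg]
  | mono m hm c =>
    induction x using laurentVec_induction with
    | zero => rw [smul_zero, map_zero, smul_zero]
    | add x y hx hy => rw [smul_add, map_add, hx, hy, map_add, smul_add]
    | term n v =>
      rw [mono_smul_term, evalAdd_term, evalAdd_term, orbitMono_smul_complex, smul_smul]
      congr 1
      exact ((orbitMono_mul m n c 1).trans (by rw [mul_one])).symm

theorem coact_evalAdd (x : LaurentVec A.invariants) (χ : Lat (Fin 3)) :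
    A.coact _ (A.evalAdd x) χ = orbitMono χ 1 • (x.coeff χ).1 := by
  classical
  induction x using laurentVec_induction with
  | zero => rw [map_zero, map_zero, LaurentVec.coeff_zero]; exact (smul_zero _).symm
  | add x y hx hy =>
    rw [map_add, map_add, Finsupp.add_apply, hx, hy, LaurentVec.coeff_add, ← smul_add]; rfl
  | term n v =>
    rw [evalAdd_term, coact_orbitMono_smul, term_coeff]
    split_ifs with h
    · rw [h]
    · exact (smul_zero _).symm

variable (A) in
/-- The invariant section `u^{-χ} x_χ`, where `x_χ` is the part of `x` of weight `χ`. -/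
def invariantPart (χ : Lat (Fin 3)) (x : A.E.sec (openOrbit (Fin 3))) : A.invariants :=
  ⟨orbitMono (-χ) 1 • A.coact _ x χ, by
    classical
    show A.coact _ _ = Finsupp.single 0 _
    ext ψ
    rw [coact_mono_smul, A.coact_coassoc, Finsupp.single_apply, Finsupp.single_apply, smul_ite,
      smul_zero]
    simp only [sub_neg_eq_add, right_eq_add, eq_comm (a := (0 : Lat (Fin 3)))]⟩

theorem orbitMono_smul_invariantPart (χ : Lat (Fin 3)) (x : A.E.sec (openOrbit (Fin 3))) :
    orbitMono χ 1 • (A.invariantPart χ x).1 = A.coact _ x χ := by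
  show orbitMono χ 1 • (orbitMono (-χ) 1 • _) = _
  rw [smul_smul, orbitMono_mul, mul_one, orbitMono, mono_congr _ (add_neg_cancel χ), mono_zero_one,
    one_smul]

/-- Monomials are invertible on the orbit, so each weight part is its monomial times a unique
invariant section; the counit axiom says that a section is the sum of its weight parts. -/
theorem evalAdd_bijective : Function.Bijective A.evalAdd := by
  constructor
  · rw [injective_iff_map_eq_zero]
    intro x hx
    apply LaurentVec.ext
    intro m
    have h := coact_evalAdd x m
    rw [hx, map_zero, Finsupp.zero_apply, eq_comm, (isUnit_orbitMono m).smul_eq_zero] at h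
    exact Subtype.ext h
  · intro y
    refine ⟨∑ χ ∈ (A.coact _ y).support, term χ (A.invariantPart χ y), ?_⟩
    rw [map_sum]
    simp only [evalAdd_term, orbitMono_smul_invariantPart]
    exact A.coact_counit _ y

variable (A) in
/-- The sections over the open orbit as Laurent polynomials with coefficients in the invariants. -/
def orbitEquiv : LaurentVec A.invariants ≃ₗ[O (openOrbit (Fin 3))] A.E.sec (openOrbit (Fin 3)) :=
  LinearEquiv.ofBijective
    { A.evalAdd with map_smul' := evalAdd_smul } evalAdd_bijective

theorem orbitEquiv_term (m : Lat (Fin 3)) (v : A.invariants) :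
    A.orbitEquiv (term m v) = orbitMono m 1 • v.1 := evalAdd_term m v

theorem coact_orbitEquiv (x : LaurentVec A.invariants) (χ : Lat (Fin 3)) :
    A.coact _ (A.orbitEquiv x) χ = A.orbitEquiv (term χ (x.coeff χ)) :=
  (coact_evalAdd x χ).trans (orbitEquiv_term _ _).symm

section Finite

variable {V : Type u} [AddCommGroup V] [Module ℂ V]

/-- The elements all of whose coefficients lie in `W`. -/
def coeffIn (W : Submodule ℂ V) (S : Chart (Fin 3)) : Submodule (O S) (LaurentVec V) where
  carrier := {x | ∀ m, x.coeff m ∈ W}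
  zero_mem' := fun _ => W.zero_mem
  add_mem' := fun hx hy m => W.add_mem (hx m) (hy m)
  smul_mem' := by
    intro f x hx m
    rw [LaurentVec.regular_smul, LaurentVec.smul_coeff]
    exact Submodule.sum_mem _ fun a _ => W.smul_mem _ (hx _)

/-- The coefficients of finitely many generators span V, since multiplication by functions never
leaves their span. -/
theorem finiteDimensional_of_laurentVec (S : Chart (Fin 3)) [Module.Finite (O S) (LaurentVec V)] :
    FiniteDimensional ℂ V := by
  classical
  obtain ⟨s, hs⟩ := Module.Finite.fg_top (R := O S) (M := LaurentVec V)
  let t : Finset V := s.biUnion fun x => x.support.image x.coeff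
  refine ⟨⟨t, top_le_iff.1 fun v _ => ?_⟩⟩
  have h : (⊤ : Submodule (O S) (LaurentVec V)) ≤ coeffIn (Submodule.span ℂ t) S := by
    rw [← hs]
    refine Submodule.span_le.2 fun x hx m => ?_
    by_cases hm : m ∈ x.support
    · exact Submodule.subset_span (Finset.mem_coe.2 (Finset.mem_biUnion.2
        ⟨x, hx, Finset.mem_image_of_mem _ hm⟩))
    · rw [LaurentVec.mem_support, not_not] at hm
      rw [hm]
      exact zero_mem _
  have := h (x := term 0 v) trivial 0
  rwa [term_coeff_self] at this

end Finite

theorem finite_sec (hA : A.E.IsVectorBundle) (S : Chart (Fin 3)) :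
    Module.Finite (O S) (A.E.sec S) := by
  classical
  obtain ⟨k, hk⟩ := S.2
  obtain ⟨s, hs⟩ := (hA.finite k).fg_top
  refine ⟨⟨s.image (A.E.res (chart_le hk)), top_le_iff.1 fun y _ => ?_⟩⟩
  obtain ⟨b, hb', hb, x, hx⟩ := hA.quasiCoherent.exists_mono_smul (chart_le hk) y
  have hmem (x : A.E.sec (chart k)) : A.E.res (chart_le hk) x ∈
      Submodule.span (O S) (s.image (A.E.res (chart_le hk)) : Set (A.E.sec S)) := by
    have hx : x ∈ Submodule.span (O (chart k)) (s : Set (A.E.sec (chart k))) := hs ▸ trivial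
    induction hx using Submodule.span_induction with
    | mem x hx => exact Submodule.subset_span (Finset.mem_coe.2 (Finset.mem_image_of_mem _ hx))
    | zero => rw [map_zero]; exact zero_mem _
    | add x y _ _ hx hy => rw [map_add]; exact add_mem hx hy
    | smul c x _ hx => rw [A.E.res_smul]; exact Submodule.smul_mem _ _ hx
  obtain ⟨g, hg⟩ := (isUnit_mono S b hb' one_ne_zero).exists_left_inv
  have := Submodule.smul_mem _ g (hmem x)
  rwa [hx, smul_smul, hg, one_smul] at this

theorem finiteDimensional_invariants (hA : A.E.IsVectorBundle) :
    FiniteDimensional ℂ A.invariants := by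
  have := finite_sec hA (openOrbit (Fin 3))
  have := Module.Finite.equiv A.orbitEquiv.symm
  exact finiteDimensional_of_laurentVec (openOrbit (Fin 3))

end EquivariantModule
end ReesPlane
end

noncomputable section
namespace ReesPlane

open ChartModule

namespace EquivariantModule

variable {A : EquivariantModule.{u}}

/-! ### The vanishing-order filtrations -/

section Filtration

theorem orbitMono_smul_mem_extendable {S : Chart (Fin 3)} {m n : Lat (Fin 3)}
    (h : ∀ i ∉ S.1, m.1 i ≤ n.1 i) {c d : ℂ} (hd : d ≠ 0) {y : A.E.sec (openOrbit (Fin 3))}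
    (hy : orbitMono m d • y ∈ A.E.extendable S) : orbitMono n c • y ∈ A.E.extendable S := by
  have h1 := smul_mem_extendable (mono S (n - m) (fun i hi => sub_nonneg.2 (h i hi)) (c * d⁻¹)) hy
  rw [resO_mono, smul_smul, mono_mul, mono_congr _ (sub_add_cancel n m),
    inv_mul_cancel_right₀ hd] at h1
  exact h1

variable (A) in
/-- The filtration of the invariants by the order of vanishing along `u_i = 0`. -/
def vanishing (i : Fin 3) (p : ℤ) : Submodule ℂ A.invariants where
  carrier := {v | ∀ m : Lat (Fin 3), -p ≤ m.1 i → orbitMono m 1 • v.1 ∈ A.E.extendable (coChart i)}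
  zero_mem' := fun m _ => by
    have : orbitMono m 1 • (0 : A.invariants).1 = 0 := smul_zero _
    rw [this]
    exact zero_mem _
  add_mem' := by
    intro v w hv hw m hm
    have : orbitMono m 1 • (v + w).1 = orbitMono m 1 • v.1 + orbitMono m 1 • w.1 := smul_add _ _ _
    rw [this]
    exact add_mem (hv m hm) (hw m hm)
  smul_mem' := by
    intro c v hv m hm
    rw [orbitMono_smul_complex]
    exact orbitMono_smul_mem_extendable (fun _ _ => le_rfl) one_ne_zero (hv m hm)

/-- A single exponent suffices as a test, because all coordinates other than u_i are invertible on
`coChart i`. -/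
theorem mem_vanishing {i : Fin 3} {v : A.invariants} (m : Lat (Fin 3)) :
    v ∈ A.vanishing i (-m.1 i) ↔ orbitMono m 1 • v.1 ∈ A.E.extendable (coChart i) := by
  refine ⟨fun h => h m (neg_neg _).le, fun h n hn => ?_⟩
  refine orbitMono_smul_mem_extendable (fun j hj => ?_) one_ne_zero h
  rw [neg_neg] at hn
  rwa [notMem_coChart.1 hj]

theorem vanishing_antitone (i : Fin 3) : Antitone (A.vanishing i) :=
  fun _ _ hpq _ hv m hm => hv m ((neg_le_neg hpq).trans hm)

theorem exists_mem_vanishing (hA : A.E.IsVectorBundle) (i : Fin 3) (v : A.invariants) :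
    ∃ p, v ∈ A.vanishing i p := by
  obtain ⟨b, _, _, x, hx⟩ := hA.quasiCoherent.exists_mono_smul (le_openOrbit (coChart i)) v.1
  exact ⟨_, (mem_vanishing b).2 ⟨x, hx⟩⟩

/-- The sections over `U_S` whose weights `χ` satisfy `n ≤ χ_i`. -/
def weightsGE {S : Chart (Fin 3)} {i : Fin 3} (hi : i ∉ S.1) (n : ℤ) :
    Submodule (O S) (A.E.sec S) where
  carrier := {x | ∀ χ : Lat (Fin 3), A.coact S x χ ≠ 0 → n ≤ χ.1 i}
  zero_mem' := by
    intro χ h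
    simp at h
  add_mem' := by
    intro x y hx hy χ h
    by_cases hx0 : A.coact S x χ = 0
    · refine hy χ fun hy0 => h ?_
      rw [map_add, Finsupp.add_apply, hx0, hy0, add_zero]
    · exact hx χ hx0
  smul_mem' := by
    intro f x hx
    induction f using regular_induction with
    | zero =>
      intro χ h
      simp at h
    | add f g hf hg =>
      intro χ h
      by_cases hx0 : A.coact S (f • x) χ = 0
      · refine hg χ fun hy0 => h ?_
        rw [add_smul, map_add, Finsupp.add_apply, hx0, hy0, add_zero]
      · exact hf χ hx0
    | mono m hm c =>
      intro χ h
      rw [coact_mono_smul] at h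
      have h1 : n ≤ χ.1 i - m.1 i := hx (χ - m) fun h0 => h (by rw [h0, smul_zero])
      have h2 := hm i hi
      omega

theorem exists_weightsGE_eq_top {S : Chart (Fin 3)} {i : Fin 3} (hi : i ∉ S.1)
    [Module.Finite (O S) (A.E.sec S)] : ∃ n, weightsGE (A := A) hi n = ⊤ := by
  classical
  obtain ⟨s, hs⟩ := Module.Finite.fg_top (R := O S) (M := A.E.sec S)
  obtain ⟨n, hn⟩ := (s.biUnion fun x => (A.coact S x).support.image fun χ => χ.1 i).bddBelow
  refine ⟨n, top_le_iff.1 (hs ▸ Submodule.span_le.2 fun x hx χ hχ => hn ?_)⟩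
  exact Finset.mem_coe.2 (Finset.mem_biUnion.2
    ⟨x, hx, Finset.mem_image.2 ⟨χ, Finsupp.mem_support_iff.2 hχ, rfl⟩⟩)

/-- Sections over a chart U_k with k ≠ i are finitely generated, so the i-th entries of their
weights are at least some n. A nonzero invariant vector of vanishing order 1 - n would produce a
section over U_k whose weight has i-th entry n - 1. -/
theorem exists_vanishing_eq_bot (hA : A.E.IsVectorBundle) (i : Fin 3) :
    ∃ p, A.vanishing i p = ⊥ := by
  classical
  obtain ⟨k, -, hk, -⟩ := exists_complement i
  have hik : i ∉ (chart k).1 := notMem_chart.2 hk.symm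
  have := hA.finite k
  obtain ⟨n, hn⟩ := exists_weightsGE_eq_top (A := A) hik
  refine ⟨1 - n, (Submodule.eq_bot_iff _).2 fun v hv => ?_⟩
  obtain ⟨m, hm⟩ : ∃ m : Lat (Fin 3), m.1 i = n - 1 :=
    ⟨chartExp k fun _ => 1 - n, by rw [chartExp_of_ne hk.symm]; omega⟩
  have hle : chart k ≤ coChart i := chart_le (by
    by_contra h'
    exact hk (notMem_coChart.1 h'))
  obtain ⟨z, hz⟩ := hv m (by omega)
  obtain ⟨b, hb', hb, x, hx⟩ := hA.quasiCoherent.exists_mono_smul hle z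
  have hbi := hb' i (notMem_coChart.2 rfl)
  have hres : A.E.res (le_openOrbit _) x = orbitMono (b + m) 1 • v.1 := by
    rw [← A.E.res_trans hle (le_openOrbit _), hx, A.E.res_smul, hz, resO_mono, smul_smul,
      orbitMono_mul, mul_one]
  have hx0 : A.coact _ x (b + m) = 0 := by
    by_contra h0
    have h1 : n ≤ b.1 i + m.1 i := (hn ▸ trivial : x ∈ weightsGE (A := A) hik n) (b + m) h0
    omega
  have h2 := A.coact_res (le_openOrbit _) x (b + m)
  rw [hx0, map_zero, hres, coact_orbitMono_smul, if_pos rfl,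
    (isUnit_orbitMono _).smul_eq_zero] at h2
  exact Subtype.ext h2

theorem isFiltration_vanishing (hA : A.E.IsVectorBundle) (i : Fin 3) :
    IsFiltration (A.vanishing i) where
  anti := vanishing_antitone i
  bot := exists_vanishing_eq_bot hA i
  top := by
    have := finiteDimensional_invariants hA
    exact exists_eq_top_of_antitone (vanishing_antitone i) (exists_mem_vanishing hA i)

end Filtration

/-! ### Equivariant bundles as Rees modules -/

section Presentation

theorem coact_mem_extendable {S : Chart (Fin 3)} {y : A.E.sec (openOrbit (Fin 3))}
    (hy : y ∈ A.E.extendable S) (χ : Lat (Fin 3)) : A.coact _ y χ ∈ A.E.extendable S := by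
  obtain ⟨x, rfl⟩ := hy
  exact ⟨A.coact S x χ, (A.coact_res _ x χ).symm⟩

/-- Extendability can be tested one divisor at a time, by the extension theorem, and one weight at a
time, since the coaction commutes with restriction. -/
theorem orbitEquiv_mem_extendable (hA : A.E.IsVectorBundle) {S : Chart (Fin 3)}
    {x : LaurentVec A.invariants} :
    A.orbitEquiv x ∈ A.E.extendable S ↔ x ∈ reesSub (isFiltration_vanishing hA) S := by
  rw [hA.mem_extendable, mem_reesSub, forall_comm]
  refine forall_congr' fun i => ?_
  rw [forall_comm]
  refine forall_congr' fun hi => ?_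
  constructor
  · intro h m
    rw [mem_vanishing, ← orbitEquiv_term, ← coact_orbitEquiv]
    exact coact_mem_extendable h m
  · intro h
    rw [← x.sum_term, map_sum]
    refine sum_mem fun m _ => ?_
    rw [orbitEquiv_term, ← mem_vanishing]
    exact h m

/-- The expansion of a section. -/
def expand (S : Chart (Fin 3)) : A.E.sec S →ₗ[O S] LaurentVec A.invariants where
  toFun x := A.orbitEquiv.symm (A.E.res (le_openOrbit S) x)
  map_add' x y := by rw [map_add, map_add]
  map_smul' f x := by
    rw [A.E.res_smul, map_smul]
    rfl

theorem orbitEquiv_expand {S : Chart (Fin 3)} (x : A.E.sec S) :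
    A.orbitEquiv (expand S x) = A.E.res (le_openOrbit S) x := LinearEquiv.apply_symm_apply _ _

/-- An equivariant vector bundle is the Rees module of the filtrations of the invariants. -/
def vanishingPresentation (hA : A.E.IsVectorBundle) :
    ReesPresentation A.E (isFiltration_vanishing hA) where
  equiv S := LinearEquiv.ofBijective
    (LinearMap.codRestrict (reesSub (isFiltration_vanishing hA) S) (expand S) fun x =>
      (orbitEquiv_mem_extendable hA).1 ⟨x, (orbitEquiv_expand x).symm⟩) (by
    constructor
    · intro x y hxy
      have h : expand S x = expand S y := congrArg Subtype.val hxy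
      apply hA.res_injective (le_openOrbit S)
      rw [← orbitEquiv_expand, h, orbitEquiv_expand]
    · rintro ⟨y, hy⟩
      obtain ⟨x, hx⟩ := (orbitEquiv_mem_extendable hA).2 hy
      refine ⟨x, Subtype.ext ?_⟩
      exact A.orbitEquiv.symm_apply_eq.2 hx)
  equiv_res h x := by
    show A.orbitEquiv.symm _ = A.orbitEquiv.symm _
    rw [A.E.res_trans]

end Presentation

/-! ### The real structure on the invariants -/

section Conjugation

variable (A) in
/-- The action of `τ` on the sections over the open orbit. -/
def tauOrbit : A.E.sec (openOrbit (Fin 3)) →+ A.E.sec (openOrbit (Fin 3)) :=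
  -- τ preserves the open orbit; the restriction map transports sections along this identification
  -- of index sets.
  (A.E.res (le_openOrbit (swChart (openOrbit (Fin 3))))).comp (A.tau _)

theorem tauOrbit_res {S : Chart (Fin 3)} (x : A.E.sec S) :
    A.tauOrbit (A.E.res (le_openOrbit S) x) = A.E.res (le_openOrbit (swChart S)) (A.tau S x) := by
  show A.E.res _ (A.tau _ (A.E.res _ x)) = _
  rw [A.tau_res, A.E.res_trans]

theorem tauOrbit_tauOrbit (x : A.E.sec (openOrbit (Fin 3))) : A.tauOrbit (A.tauOrbit x) = x := by
  show A.tauOrbit (A.E.res _ (A.tau _ x)) = x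
  rw [tauOrbit_res]
  exact A.tau_tau _ x

theorem tauOrbit_orbitMono_smul (m : Lat (Fin 3)) (c : ℂ) (x : A.E.sec (openOrbit (Fin 3))) :
    A.tauOrbit (orbitMono m c • x) = orbitMono (swLat m) (starRingEnd ℂ c) • A.tauOrbit x := by
  show A.E.res _ (A.tau _ (_ • x)) = _ • A.E.res _ (A.tau _ x)
  rw [A.tau_smul, A.E.res_smul]
  congr 1
  exact toLaurent_injective _ (tauLaurent_single m c)

theorem coact_tauOrbit (x : A.E.sec (openOrbit (Fin 3))) (χ : Lat (Fin 3)) :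
    A.coact _ (A.tauOrbit x) χ = A.tauOrbit (A.coact _ x (swLat χ)) := by
  show A.coact _ (A.E.res _ (A.tau _ x)) χ = A.E.res _ (A.tau _ _)
  rw [A.coact_res, ← A.coact_tau, swLat_swLat]

variable (A) in
/-- Complex conjugation on the invariants. -/
def invariantsConj : A.invariants →ₛₗ[starRingEnd ℂ] A.invariants where
  toFun v := ⟨A.tauOrbit v.1, by
    classical
    show A.coact _ _ = Finsupp.single 0 _
    ext χ
    rw [coact_tauOrbit, show A.coact _ v.1 = Finsupp.single 0 v.1 from v.2, Finsupp.single_apply,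
      Finsupp.single_apply]
    have : (0 = swLat χ) ↔ 0 = χ :=
      ⟨fun h => by rw [← swLat_swLat χ, ← h, map_zero], fun h => by rw [← h, map_zero]⟩
    simp only [this]
    split_ifs
    · rfl
    · exact map_zero _⟩
  map_add' v w := Subtype.ext (map_add A.tauOrbit v.1 w.1)
  map_smul' c v := Subtype.ext (tauOrbit_orbitMono_smul 0 c v.1)

theorem invariantsConj_mem {i : Fin 3} {p : ℤ} {v : A.invariants} (hv : v ∈ A.vanishing i p) :
    A.invariantsConj v ∈ A.vanishing (sw i) p := by
  intro m hm
  obtain ⟨z, hz⟩ := hv (swLat m) hm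
  have h1 : orbitMono m 1 • (A.invariantsConj v).1 =
      A.E.res (le_openOrbit (swChart (coChart i))) (A.tau _ z) := by
    rw [← tauOrbit_res, hz, tauOrbit_orbitMono_smul, swLat_swLat, map_one]
    rfl
  rw [h1]
  refine extendable_mono (fun j hj => ?_) ⟨A.tau _ z, rfl⟩
  by_contra hj'
  rw [notMem_coChart] at hj'
  rw [mem_swChart, hj', Equiv.swap_apply_self] at hj
  exact notMem_coChart.2 rfl hj

theorem map_invariantsConj {i j : Fin 3} (hj : sw i = j) (p : ℤ) :
    (A.vanishing i p).map A.invariantsConj = A.vanishing j p := by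
  subst hj
  refine le_antisymm ?_ fun v hv => ?_
  · rintro _ ⟨v, hv, rfl⟩
    exact invariantsConj_mem hv
  · refine ⟨A.invariantsConj v, ?_, Subtype.ext (tauOrbit_tauOrbit v.1)⟩
    have := invariantsConj_mem hv
    rwa [Equiv.swap_apply_self] at this

end Conjugation

/-- The trifiltered vector space of a semistable bundle. -/
def trifiltered (hA : semistableBundle A) : RealTrifiltered.{u} :=
  have := finiteDimensional_invariants hA.1
  { V := A.invariants
    conj := A.invariantsConj
    conj_conj := fun v => Subtype.ext (tauOrbit_tauOrbit v.1)
    F := A.vanishing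
    decreasing := vanishing_antitone
    exhaustive := fun i => ⟨(isFiltration_vanishing hA.1 i).bot, (isFiltration_vanishing hA.1 i).top⟩
    opposed := (vanishingPresentation hA.1).opposed hA.2.1 hA.2.2
    real := map_invariantsConj (by decide)
    conjugate := map_invariantsConj (by decide) }

theorem orbitEquiv_conj {T : LaurentVec A.invariants →+ LaurentVec A.invariants}
    (hT : ∀ x n, (T x).coeff n = A.invariantsConj (x.coeff (swLat n))) (x : LaurentVec A.invariants) :
    A.orbitEquiv (T x) = A.tauOrbit (A.orbitEquiv x) := by
  classical
  induction x using laurentVec_induction with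
  | zero => simp only [map_zero]
  | add x y hx hy => simp only [map_add, hx, hy]
  | term m v =>
    rw [orbitEquiv_term, tauOrbit_orbitMono_smul, map_one]
    refine Eq.trans (congrArg _ ?_) (orbitEquiv_term (swLat m) (A.invariantsConj v))
    apply LaurentVec.ext
    intro n
    have h : swLat m = n ↔ m = swLat n :=
      ⟨fun h => by rw [← h, swLat_swLat], fun h => by rw [h, swLat_swLat]⟩
    rw [hT, term_coeff, term_coeff]
    simp only [h]
    split_ifs
    · rfl
    · exact map_zero _

/-- The identification of a semistable bundle with a Rees module. -/
def toRees (hA : semistableBundle A) : Hom A (trifiltered hA).rees where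
  app S := ((vanishingPresentation hA.1).equiv S).toLinearMap
  app_res h x := Subtype.ext ((vanishingPresentation hA.1).equiv_res h x)
  app_coact S x χ := by
    apply Subtype.ext
    show term χ ((expand S x).coeff χ) = expand S (A.coact S x χ)
    apply A.orbitEquiv.injective
    rw [← coact_orbitEquiv, orbitEquiv_expand, orbitEquiv_expand, A.coact_res]
  app_tau S x := by
    apply Subtype.ext
    show expand (swChart S) (A.tau S x) = (trifiltered hA).tauVec (expand S x)
    apply A.orbitEquiv.injective
    refine (Eq.trans (orbitEquiv_conj (T := (trifiltered hA).tauVec)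
      (RealTrifiltered.tauVec_coeff (X := trifiltered hA)) _) ?_).symm
    rw [orbitEquiv_expand, orbitEquiv_expand, tauOrbit_res]

/-- A bijective morphism is an isomorphism. -/
def isoOfBijective {A B : EquivariantModule.{u}} (f : Hom A B)
    (hf : ∀ S, Function.Bijective (f.app S)) : A ≅ B where
  hom := f
  inv :=
    { app := fun S => (LinearEquiv.ofBijective (f.app S) (hf S)).symm.toLinearMap
      app_res := fun {S S'} h x => by
        obtain ⟨y, rfl⟩ := (LinearEquiv.ofBijective (f.app S) (hf S)).surjective x
        refine (LinearEquiv.symm_apply_eq _).2 ?_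
        show B.E.res h (f.app S y) = f.app S' (A.E.res h _)
        rw [LinearEquiv.coe_coe, LinearEquiv.symm_apply_apply, f.app_res]
      app_coact := fun S x χ => by
        obtain ⟨y, rfl⟩ := (LinearEquiv.ofBijective (f.app S) (hf S)).surjective x
        refine ((LinearEquiv.symm_apply_eq _).2 ?_).symm
        show B.coact S (f.app S y) χ = f.app S (A.coact S _ χ)
        rw [LinearEquiv.coe_coe, LinearEquiv.symm_apply_apply, f.app_coact]
      app_tau := fun S x => by
        obtain ⟨y, rfl⟩ := (LinearEquiv.ofBijective (f.app S) (hf S)).surjective x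
        refine (LinearEquiv.symm_apply_eq _).2 ?_
        show B.tau S (f.app S y) = f.app (swChart S) (A.tau S _)
        rw [LinearEquiv.coe_coe, LinearEquiv.symm_apply_apply, f.app_tau] }
  hom_inv_id := by
    apply Hom.ext
    funext S
    exact LinearMap.ext (LinearEquiv.ofBijective (f.app S) (hf S)).symm_apply_apply
  inv_hom_id := by
    apply Hom.ext
    funext S
    exact LinearMap.ext (LinearEquiv.ofBijective (f.app S) (hf S)).apply_symm_apply

/-- Every semistable bundle of slope `0` is the Rees module of a trifiltered vector space. -/
def isoRees (hA : semistableBundle A) : A ≅ (trifiltered hA).rees :=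
  isoOfBijective (toRees hA) fun S => ((vanishingPresentation hA.1).equiv S).bijective

end EquivariantModule
end ReesPlane
end

noncomputable section
namespace ReesPlane

namespace RealTrifiltered

variable {X Y : RealTrifiltered.{u}}

/-! ### Full faithfulness -/

section Full

variable (h : EquivariantModule.Hom X.rees Y.rees)

/-- The action of a morphism of Rees modules on the sections `u^0 v`. -/
def fiberFun (v : X.V) : Y.V :=
  (show Y.reesSections (openOrbit (Fin 3)) from
    h.app (openOrbit (Fin 3)) (termSection 0 v fun _ hi => absurd mem_openOrbit hi)).1.coeff 0

/-- Equivariance isolates the term of weight m, restriction carries it to the open orbit, and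
linearity over u^m reduces it to weight 0. -/
theorem app_coeff {S : Chart (Fin 3)} (x : X.reesSections S) (m : Lat (Fin 3)) :
    (show Y.reesSections S from h.app S x).1.coeff m = fiberFun h (x.1.coeff m) := by
  have h1 : (show Y.reesSections S from h.app S x).1.coeff m =
      (show Y.reesSections S from h.app S (reesTerm x m)).1.coeff m := by
    have := congrArg (fun z : Y.reesSections S => z.1.coeff m) (h.app_coact S x m)
    refine Eq.trans (Eq.symm ?_) this
    exact term_coeff_self m _
  have h2 : (show Y.reesSections S from h.app S (reesTerm x m)).1 =
      (show Y.reesSections (openOrbit (Fin 3)) from h.app (openOrbit (Fin 3))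
        (X.rees.E.res (le_openOrbit S) (reesTerm x m))).1 :=
    (congrArg (fun z : Y.reesSections (openOrbit (Fin 3)) => z.1)
      (h.app_res (le_openOrbit S) (reesTerm x m))).symm
  have h3 : X.rees.E.res (le_openOrbit S) (reesTerm x m) =
      EquivariantModule.orbitMono m 1 •
        (show X.rees.E.sec (openOrbit (Fin 3)) from
          termSection 0 (x.1.coeff m) fun _ hi => absurd mem_openOrbit hi) := by
    apply Subtype.ext
    show term m (x.1.coeff m) = mono _ m _ 1 • term 0 (x.1.coeff m)
    rw [mono_smul_term, add_zero, one_smul]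
  rw [h1, h2, h3, map_smul]
  have h4 := LaurentVec.single_smul_coeff m 1 (show Y.reesSections (openOrbit (Fin 3)) from
    h.app (openOrbit (Fin 3))
      (termSection 0 (x.1.coeff m) fun _ hi => absurd mem_openOrbit hi)).1 0
  rw [add_zero, one_smul] at h4
  exact h4

/-- The linear map given by a morphism of Rees modules. -/
def fiberMap : X.V →ₗ[ℂ] Y.V where
  toFun := fiberFun h
  map_add' v w := by
    have h1 : (show X.rees.E.sec (openOrbit (Fin 3)) from
        termSection 0 (v + w) fun _ hi => absurd mem_openOrbit hi) =
        (show X.rees.E.sec (openOrbit (Fin 3)) from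
          termSection 0 v fun _ hi => absurd mem_openOrbit hi) +
        (show X.rees.E.sec (openOrbit (Fin 3)) from
          termSection 0 w fun _ hi => absurd mem_openOrbit hi) :=
      Subtype.ext (map_add (term 0) v w)
    have h2 := (congrArg (h.app (openOrbit (Fin 3))) h1).trans (map_add _ _ _)
    exact congrArg (fun z : Y.reesSections (openOrbit (Fin 3)) => z.1.coeff 0) h2
  map_smul' c v := by
    have h1 : (show X.rees.E.sec (openOrbit (Fin 3)) from
        termSection 0 (c • v) fun _ hi => absurd mem_openOrbit hi) =
        EquivariantModule.orbitMono 0 c • (show X.rees.E.sec (openOrbit (Fin 3)) from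
          termSection 0 v fun _ hi => absurd mem_openOrbit hi) := by
      apply Subtype.ext
      show term 0 (c • v) = mono _ 0 _ c • term 0 v
      rw [mono_smul_term, add_zero]
    have h2 := (congrArg (h.app (openOrbit (Fin 3))) h1).trans (map_smul _ _ _)
    refine (congrArg (fun z : Y.reesSections (openOrbit (Fin 3)) => z.1.coeff 0) h2).trans ?_
    exact LaurentVec.single_smul_coeff 0 c (show Y.reesSections (openOrbit (Fin 3)) from
      h.app (openOrbit (Fin 3)) (termSection 0 v fun _ hi => absurd mem_openOrbit hi)).1 0

/-- The morphism of trifiltered vector spaces given by a morphism of Rees modules. -/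
def fiberHom : Hom X Y where
  f := fiberMap h
  map_conj v := by
    let x : X.reesSections (openOrbit (Fin 3)) :=
      termSection 0 v fun _ hi => absurd mem_openOrbit hi
    have h1 := congrArg (fun z : Y.reesSections (swChart (openOrbit (Fin 3))) => z.1.coeff 0)
      (h.app_tau (openOrbit (Fin 3)) x)
    have h2 := app_coeff h (reesTau _ x) 0
    have h3 : (reesTau (openOrbit (Fin 3)) x).1.coeff 0 = X.conj v := by
      refine (tauVec_coeff _ 0).trans (congrArg _ ?_)
      rw [map_zero]
      exact term_coeff_self 0 v
    rw [h3] at h2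
    refine Eq.trans h2.symm (h1.trans ((tauVec_coeff _ 0).trans ?_))
    rw [map_zero]
    rfl
  map_F i p v hv := by
    obtain ⟨k, -, hk, -⟩ := ChartModule.exists_complement i
    -- On `coChart i` the only condition is the one for F_i, so u^m v with m_i = -p is a section
    -- exactly when v lies in F_i^p.
    let m := chartExp k fun _ => p
    have hm : -m.1 i = p := by rw [chartExp_of_ne hk.symm, neg_neg]
    let x : X.reesSections (ChartModule.coChart i) := termSection m v fun j hj => by
      rw [ChartModule.notMem_coChart.1 hj, hm]
      exact hv
    have h1 := (show Y.reesSections (ChartModule.coChart i) from h.app _ x).2 m i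
      (ChartModule.notMem_coChart.2 rfl)
    rw [app_coeff, hm] at h1
    have h2 : x.1.coeff m = v := term_coeff_self m v
    rwa [h2] at h1

theorem reesMap_fiberHom : reesMap (fiberHom h) = h := by
  apply EquivariantModule.Hom.ext
  funext S
  apply LinearMap.ext
  intro x
  apply Subtype.ext
  apply LaurentVec.ext
  intro m
  exact (app_coeff h x m).symm

end Full

theorem reesMap_injective : Function.Injective (reesMap : Hom X Y → _) := by
  intro f g hfg
  apply Hom.ext
  apply LinearMap.ext
  intro v
  have h (f : Hom X Y) : fiberFun (reesMap f) v = f.f v := by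
    show f.f ((term 0 v).coeff 0) = f.f v
    rw [term_coeff_self]
  rw [← h f, hfg, h g]

end RealTrifiltered

namespace EquivariantModule

/-- Isomorphic modules have isomorphic sections. -/
def isoApp {A B : EquivariantModule.{u}} (e : A ≅ B) (S : Chart (Fin 3)) :
    A.E.sec S ≃ₗ[O S] B.E.sec S :=
  LinearEquiv.ofLinearMap (Hom.app e.hom S) (Hom.app e.inv S)
    (congrFun (congrArg Hom.app e.inv_hom_id) S) (congrFun (congrArg Hom.app e.hom_inv_id) S)

/-- Isomorphic morphisms have isomorphic cokernels. -/
def cokerCongr {A B A' B' : EquivariantModule.{u}} (α : A' ≅ A) (β : B ≅ B') (f : A ⟶ B)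
    (S : Chart (Fin 3)) :
    Hom.coker f S ≃ₗ[O S] Hom.coker (α.hom ≫ f ≫ β.hom : A' ⟶ B') S :=
  Submodule.Quotient.equiv _ _ (isoApp β S) (by
    ext y
    constructor
    · rintro ⟨_, ⟨x, rfl⟩, rfl⟩
      obtain ⟨x, rfl⟩ := (isoApp α S).surjective x
      exact ⟨x, rfl⟩
    · rintro ⟨x, rfl⟩
      exact ⟨_, ⟨Hom.app α.hom S x, rfl⟩, rfl⟩)

/-- By `isoRees` and fullness, every morphism of semistable bundles is isomorphic to one induced by
a morphism of trifiltered spaces, and the free locus of the cokernel is invariant under isomorphism.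
-/
theorem singularOnlyAtPoint_eq_top : singularOnlyAtPoint.{u} = ⊤ := by
  ext A B f
  refine ⟨fun _ => trivial, fun _ k p => Not.imp_symm fun hp => ?_⟩
  let e := cokerCongr (isoRees A.property).symm (isoRees B.property) f.hom (chart k)
  rw [Module.freeLocus_congr e]
  have h := RealTrifiltered.mem_freeLocus_coker (p := p) (g := RealTrifiltered.fiberHom
    ((isoRees A.property).symm.hom ≫ f.hom ≫ (isoRees B.property).hom)) hp
  rw [RealTrifiltered.reesMap_fiberHom] at h
  exact h

end EquivariantModule

/-! ### The equivalence -/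

section Equivalence

open RealTrifiltered EquivariantModule

theorem strict_isMultiplicative : strict.{u}.IsMultiplicative :=
  strict_eq_top.{u} ▸ inferInstance

theorem singularOnlyAtPoint_isMultiplicative : singularOnlyAtPoint.{u}.IsMultiplicative :=
  singularOnlyAtPoint_eq_top.{u} ▸ inferInstance

attribute [local instance] strict_isMultiplicative singularOnlyAtPoint_isMultiplicative

theorem strict_of_hom {X Y : RealTrifiltered.{u}} (f : X ⟶ Y) : strict f := by
  rw [strict_eq_top]
  trivial

theorem singularOnlyAtPoint_of_hom {A B : SemistableBundle.{u}} (f : A ⟶ B) :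
    singularOnlyAtPoint f := by
  rw [singularOnlyAtPoint_eq_top]
  trivial

/-- The Rees construction from trifiltered vector spaces to semistable bundles. -/
def reesBundle : WideSubcategory strict.{u} ⥤ WideSubcategory singularOnlyAtPoint.{u} where
  obj X := ⟨⟨X.obj.rees, X.obj.semistableBundle_rees⟩⟩
  map f := ⟨ObjectProperty.homMk (reesFunctor.map f.hom), singularOnlyAtPoint_of_hom _⟩
  map_id X := WideSubcategory.hom_ext _
    (ObjectProperty.hom_ext _ (reesFunctor.map_id X.obj))
  map_comp f g := WideSubcategory.hom_ext _
    (ObjectProperty.hom_ext _ (reesFunctor.map_comp f.hom g.hom))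

instance : reesBundle.{u}.Faithful where
  map_injective h := WideSubcategory.hom_ext _
    (reesMap_injective (congrArg (fun f => f.hom.hom) h))

instance : reesBundle.{u}.Full where
  map_surjective h := ⟨⟨fiberHom h.hom.hom, strict_of_hom _⟩, WideSubcategory.hom_ext _
    (ObjectProperty.hom_ext _ (reesMap_fiberHom h.hom.hom))⟩

instance : reesBundle.{u}.EssSurj where
  mem_essImage A := ⟨⟨trifiltered A.obj.property⟩, ⟨WideSubcategory.isoMk
    (ObjectProperty.isoMk _ (isoRees A.obj.property).symm) (singularOnlyAtPoint_of_hom _)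
    (singularOnlyAtPoint_of_hom _)⟩⟩

instance : reesBundle.{u}.IsEquivalence where

end Equivalence

end ReesPlane
end

theorem mainTheorem2 :
    ∃ (_ : ReesPlane.RealTrifiltered.strict.{u}.IsMultiplicative)
      (_ : ReesPlane.EquivariantModule.singularOnlyAtPoint.{u}.IsMultiplicative)
      (Φ : WideSubcategory ReesPlane.RealTrifiltered.strict.{u} ≌
        WideSubcategory ReesPlane.EquivariantModule.singularOnlyAtPoint.{u}),
      Nonempty (Φ.functor ⋙ wideSubcategoryInclusion _ ⋙
          ReesPlane.EquivariantModule.semistableBundle.ι ≅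
        wideSubcategoryInclusion _ ⋙ ReesPlane.reesFunctor) :=
  ⟨ReesPlane.strict_isMultiplicative, ReesPlane.singularOnlyAtPoint_isMultiplicative,
    ReesPlane.reesBundle.asEquivalence, ⟨Iso.refl _⟩⟩
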